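/- Let $0<k<1$, $k^2\le b\le 1$, and let $c\in\mathbb R$ satisfy $c^2=b(1-b)(b-k^2)$. Put $\omega=\tfrac12(1+k^2-3b)$ and let $\phi(x)=R(x)e^{i\theta(x)}$ be the elliptic solution of $\omega\phi+\tfrac12\phi''+\phi|\phi|^2=0$ given by $$R^2(x)=b-k^2\,\mathrm{sn}^2(x,k),\qquad \theta(x)=c\int_0^x\frac{dy}{R^2(y)},$$ where $R$ is the positive square root if $b>k^2$, while $R(x)=k\,\mathrm{cn}(x,k)$ and $\theta=0$ if $b=k^2$. The Lax spectrum $\sigma_L\subset\mathbb C$ is the set of $\zeta\in\mathbb C$ for which the Lax pair $$\chi_x=\begin{pmatrix}-i\zeta&\phi\\-\overline{\phi}&i\zeta\end{pmatrix}\chi,\qquad \chi_t=\begin{pmatrix}A&B\\C&-A\end{pmatrix}\chi,$$ $$A=-i\zeta^2+\tfrac i2|\phi|^2+\tfrac i2\omega,\quad B=\zeta\phi+\tfrac i2\phi',\quad C=-\zeta\overline{\phi}+\tfrac i2\overline{\phi'},$$ has, for some $\Omega\in\mathbb C$, a nontrivial solution $\chi(x,t)=e^{\Omega t}\varphi(x)$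 with $\varphi:\mathbb R\to\mathbb C^2$ bounded on $\mathbb R$; then $\Omega$ satisfies $$\Omega^2=\Omega^2(\zeta)=A^2+BC=-\zeta^4+\omega\zeta^2+c\zeta-\tfrac1{16}\left(4\omega b+3b^2+(1-k^2)^2\right).$$ Then $\Omega^2(\zeta)$ has exactly four distinct roots, and $$\sigma_L=\mathbb R\cup S_1\cup S_2,$$ where $S_1$ and $S_2$ are two bands, i.e. simple compact arcs in $\mathbb C$, each connecting two of the roots of $\Omega$: the two endpoints of $S_1$ together with the two endpoints of $S_2$ are the four roots. Moreover each band meets the real line in at most one point, and the two bands meet each other in at most one point. -/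

import Mathlib

noncomputable section

/-- The incomplete elliptic integral of the first kind, with elliptic modulus `k`. -/
def ellipticF (k p : ℝ) : ℝ :=
  ∫ y in (0 : ℝ)..p, 1 / √(1 - k ^ 2 * Real.sin y ^ 2)

/-- The Jacobi amplitude `am(x, k)`: the inverse of `ellipticF k`
(a bijection of `ℝ` for `0 ≤ k < 1`, see `ellipticF_bijective`). -/
def jacobiAm (k x : ℝ) : ℝ := Function.invFun (ellipticF k) x

/-- The Jacobi function `sn(x, k)`. -/
def jacobiSn (k x : ℝ) : ℝ := Real.sin (jacobiAm k x)

/-- The Jacobi function `cn(x, k)`. -/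
def jacobiCn (k x : ℝ) : ℝ := Real.cos (jacobiAm k x)

/-- The squared amplitude `R² = b - k² sn²` of the elliptic solution. -/
def ampSq (k b x : ℝ) : ℝ := b - k ^ 2 * jacobiSn k x ^ 2

/-- The real amplitude `R`: the smooth square root of `R²`. For `b = k²` this is the sign-changing
function `k cn(x, k)` (cn solutions); for `b > k²` it is the positive square root
(for `b = 1` it is `dn(x, k)`). -/
def amp (k b x : ℝ) : ℝ :=
  if b = k ^ 2 then k * jacobiCn k x else √(ampSq k b x)

/-- The phase `θ(x) = c ∫₀ˣ dy / R²(y)`. In the trivial-phase cases `c = 0`, so `θ = 0`. -/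
def phase (k b c x : ℝ) : ℝ := c * ∫ y in (0 : ℝ)..x, 1 / ampSq k b y

/-- The frequency `ω = (1 + k² - 3b)/2`. -/
def freq (k b : ℝ) : ℝ := (1 + k ^ 2 - 3 * b) / 2

/-- The elliptic solution `φ(x) = R(x) e^{iθ(x)}` of `ω φ + φ''/2 + φ |φ|² = 0`. -/
def ellipticSol (k b c x : ℝ) : ℂ :=
  (amp k b x : ℂ) * Complex.exp (Complex.I * (phase k b c x : ℂ))

/-- The matrix of the `x`-equation of the Lax pair of focusing NLS with potential `φ`. -/
def laxX (φ : ℝ → ℂ) (ζ : ℂ) (x : ℝ) : Matrix (Fin 2) (Fin 2) ℂ :=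
  !![-Complex.I * ζ, φ x; -(starRingEnd ℂ (φ x)), Complex.I * ζ]

/-- The matrix `(A, B; C, -A)` of the `t`-equation of the Lax pair, with stationary potential `φ`
and frequency `ω`. -/
def laxT (φ : ℝ → ℂ) (ω : ℝ) (ζ : ℂ) (x : ℝ) : Matrix (Fin 2) (Fin 2) ℂ :=
  let A : ℂ := -Complex.I * ζ ^ 2 + Complex.I / 2 * (‖φ x‖ : ℂ) ^ 2 + Complex.I / 2 * (ω : ℂ)
  let B : ℂ := ζ * φ x + Complex.I / 2 * deriv φ x
  let C : ℂ := -ζ * starRingEnd ℂ (φ x) + Complex.I / 2 * starRingEnd ℂ (deriv φ x)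
  !![A, B; C, -A]

/-- The Lax spectrum of a stationary potential: the `ζ` for which the Lax pair
`χ_x = laxX χ`, `χ_t = laxT χ` has a solution `χ(x, t) = e^{Ω t} v(x)` with `v` nontrivial and
bounded on the whole line. -/
def laxSpectrum (φ : ℝ → ℂ) (ω : ℝ) : Set ℂ :=
  {ζ | ∃ (Ω : ℂ) (v : ℝ → Fin 2 → ℂ), v ≠ 0 ∧ (∃ M : ℝ, ∀ x, ‖v x‖ ≤ M) ∧
    (∀ x, HasDerivAt v ((laxX φ ζ x).mulVec (v x)) x) ∧
    (∀ x, (laxT φ ω ζ x).mulVec (v x) = Ω • v x)}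

/-- The polynomial `Ω²(ζ) = A² + B C` of the elliptic solution with parameters `k, b, c`. -/
def omegaSq (k b c : ℝ) (ζ : ℂ) : ℂ :=
  -ζ ^ 4 + (freq k b : ℂ) * ζ ^ 2 + (c : ℂ) * ζ
    - 1 / 16 * (4 * (freq k b : ℂ) * (b : ℂ) + 3 * (b : ℂ) ^ 2 + (1 - (k : ℂ) ^ 2) ^ 2)

/-- The roots of `Ω`. -/
def omegaRoots (k b c : ℝ) : Set ℂ := {ζ | omegaSq k b c ζ = 0}

/-- `S` is a band connecting `p` and `q`: a simple (non-self-intersecting) compact arc with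
endpoints `p` and `q`. Injectivity forces `p ≠ q`. -/
def IsBand (S : Set ℂ) (p q : ℂ) : Prop :=
  ∃ γ : Path p q, Function.Injective γ ∧ Set.range γ = S

/-- The real line in the complex plane. -/
def realLine : Set ℂ := Set.range ((↑) : ℝ → ℂ)

theorem ellipticF_aux {k : ℝ} (hk0 : 0 ≤ k) (hk1 : k < 1) (y : ℝ) :
    0 < 1 - k ^ 2 * Real.sin y ^ 2 := by
  have h1 : Real.sin y ^ 2 ≤ 1 := Real.sin_sq_le_one y
  nlinarith [sq_nonneg k, sq_nonneg (Real.sin y)]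

theorem hasDerivAt_ellipticF {k : ℝ} (hk0 : 0 ≤ k) (hk1 : k < 1) (p : ℝ) :
    HasDerivAt (ellipticF k) (1 / √(1 - k ^ 2 * Real.sin p ^ 2)) p := by
  have hc : Continuous fun y : ℝ => 1 / √(1 - k ^ 2 * Real.sin y ^ 2) := by
    refine Continuous.div continuous_const (by fun_prop) fun y => ?_
    exact (Real.sqrt_pos.2 (ellipticF_aux hk0 hk1 y)).ne'
  exact intervalIntegral.integral_hasDerivAt_right (hc.intervalIntegrable _ _)
    hc.stronglyMeasurable.stronglyMeasurableAtFilter hc.continuousAt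

theorem ellipticF_bijective {k : ℝ} (hk0 : 0 ≤ k) (hk1 : k < 1) :
    Function.Bijective (ellipticF k) := by
  have hd := hasDerivAt_ellipticF hk0 hk1
  have hcont : Continuous (ellipticF k) :=
    continuous_iff_continuousAt.2 fun p => (hd p).continuousAt
  have hge : ∀ p, 1 ≤ deriv (ellipticF k) p := fun p => by
    rw [(hd p).deriv, le_div_iff₀ (Real.sqrt_pos.2 (ellipticF_aux hk0 hk1 p)), one_mul]
    exact Real.sqrt_le_one.2 (by nlinarith [sq_nonneg (k * Real.sin p)])
  have hmono : StrictMono (ellipticF k) :=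
    strictMono_of_deriv_pos fun p => lt_of_lt_of_le one_pos (hge p)
  have hdiff : Differentiable ℝ (ellipticF k) := fun p => (hd p).differentiableAt
  have h0 : ellipticF k 0 = 0 := by simp [ellipticF]
  have key : ∀ x y, x ≤ y → y - x ≤ ellipticF k y - ellipticF k x := fun x y h => by
    simpa using mul_sub_le_image_sub_of_le_deriv hdiff hge h
  refine ⟨hmono.injective, hcont.surjective ?_ ?_⟩
  · refine Filter.tendsto_atTop_mono' _ ?_ Filter.tendsto_id
    filter_upwards [Filter.eventually_ge_atTop 0] with x hx
    have := key 0 x hx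
    simp only [id]; linarith
  · refine Filter.tendsto_atBot_mono' _ ?_ Filter.tendsto_id
    filter_upwards [Filter.eventually_le_atBot 0] with x hx
    have := key x 0 hx
    simp only [id]; linarith

theorem ellipticF_jacobiAm {k : ℝ} (hk0 : 0 ≤ k) (hk1 : k < 1) (x : ℝ) :
    ellipticF k (jacobiAm k x) = x :=
  Function.rightInverse_invFun (ellipticF_bijective hk0 hk1).surjective x

end

/-! The temporal Lax matrix `M` maps solutions of the `x`-equation to solutions. For `Ω ≠ 0` its
`Ω`-eigenspace is a line, so a joint solution returns to a multiple `m(ζ, Ω)` of itself after the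
period `T` of `R²`, once the phase factor `u` of `φ` is absorbed. It is bounded exactly when `|m| =
1`. Real `ζ` always qualify because the `x`-equation is then skew-Hermitian. Nonreal roots of `Ω`
qualify by a separate argument (`bounded_of_root`). Conjugation is a symmetry, so only the open
upper half plane is left.

A Wronskian computation (`hasDerivAt_floquetMul`) differentiates `m`. With `Ω = iY`, `P = -Ω² = Y²`
and `C = (ω + mean of R²) / 2` it gives `d log m = i T (ζ² - C) dζ / Y`. The condition `|m| = 1` is
then made explicit by separating variables. Put `g = Re Y / Im ζ` and `τ = g² + 4 (Re ζ)²`. An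
explicit `V` satisfies `V² = (τ - (1 - b)) (τ + b) (τ + b - k²)`, the resolvent cubic of the
quartic, so `τ = q² + 1 - b` for a real `q`. Along any curve `q` moves autonomously, and `log |m|² =
T (g - F(q))` with `F = bandIntegral` an elliptic integral. There is no additive constant: at the
real axis `|m| = 1`, `g → ±∞`, and `F(q) - √τ → 0` as `q → ∞`.

So the spectrum above the axis is `g = F(q)`. This forces `4 (Re ζ)² = τ - F²`, and for `τ > 0` a
linear relation determines `Im ζ`. For `b < 1` the points are therefore parametrised by `q ≥ 0` with
`F(q) ≤ √τ` and by the sign of the real part, and `q = 0` gives the roots `α + iβ₁`, `-α + iβ₂`.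

The derivative of `F - √τ` has the sign of a quadratic `D(τ)` with leading coefficient `4C`. If `C ≥
0`, then `F < √τ` for all `q`, both arcs run down to `±√C` on the real axis, and each together with
its mirror image is a band joining conjugate roots. If `C < 0` and `b < 1`, then `F ≤ √τ` exactly on
some `[0, q₀]`, and the two arcs meet on the imaginary axis and form one band in the upper half
plane. If `b = 1`, only `q = 0` survives and the band is a vertical segment between the two
imaginary roots. -/

/-! ### Jacobi elliptic functions: derivatives, periods and reflection symmetry. -/

theorem strictMono_ellipticF {k : ℝ} (hk0 : 0 ≤ k) (hk1 : k < 1) : StrictMono (ellipticF k) :=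
  strictMono_of_deriv_pos fun p => by
    rw [(hasDerivAt_ellipticF hk0 hk1 p).deriv]
    exact one_div_pos.2 (Real.sqrt_pos.2 (ellipticF_aux hk0 hk1 p))

theorem jacobiAm_ellipticF {k : ℝ} (hk0 : 0 ≤ k) (hk1 : k < 1) (p : ℝ) :
    jacobiAm k (ellipticF k p) = p :=
  Function.leftInverse_invFun (ellipticF_bijective hk0 hk1).injective p

theorem continuous_jacobiAm {k : ℝ} (hk0 : 0 ≤ k) (hk1 : k < 1) : Continuous (jacobiAm k) := by
  have hm := strictMono_ellipticF hk0 hk1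
  have hs := (ellipticF_bijective hk0 hk1).surjective
  have : jacobiAm k = (hm.orderIsoOfSurjective _ hs).symm := by
    funext x
    apply hm.injective
    rw [ellipticF_jacobiAm hk0 hk1]
    exact ((hm.orderIsoOfSurjective _ hs).apply_symm_apply x).symm
  rw [this]
  exact OrderIso.continuous _

/-- The Jacobi function `dn(x, k)`. -/
noncomputable def jacobiDn (k x : ℝ) : ℝ := √(1 - k ^ 2 * jacobiSn k x ^ 2)

theorem jacobiDn_pos {k : ℝ} (hk0 : 0 ≤ k) (hk1 : k < 1) (x : ℝ) : 0 < jacobiDn k x :=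
  Real.sqrt_pos.2 (ellipticF_aux hk0 hk1 _)

theorem jacobiDn_sq {k : ℝ} (hk0 : 0 ≤ k) (hk1 : k < 1) (x : ℝ) :
    jacobiDn k x ^ 2 = 1 - k ^ 2 * jacobiSn k x ^ 2 :=
  Real.sq_sqrt (ellipticF_aux hk0 hk1 _).le

theorem jacobiCn_sq (k x : ℝ) : jacobiCn k x ^ 2 = 1 - jacobiSn k x ^ 2 :=
  Real.cos_sq' _

theorem hasDerivAt_jacobiAm {k : ℝ} (hk0 : 0 ≤ k) (hk1 : k < 1) (x : ℝ) :
    HasDerivAt (jacobiAm k) (jacobiDn k x) x := by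
  have h := HasDerivAt.of_local_left_inverse (continuous_jacobiAm hk0 hk1).continuousAt
    (hasDerivAt_ellipticF hk0 hk1 (jacobiAm k x))
    (one_div_pos.2 (Real.sqrt_pos.2 (ellipticF_aux hk0 hk1 _))).ne'
    (Filter.Eventually.of_forall (ellipticF_jacobiAm hk0 hk1))
  simpa [jacobiDn, jacobiSn] using h

theorem hasDerivAt_jacobiSn {k : ℝ} (hk0 : 0 ≤ k) (hk1 : k < 1) (x : ℝ) :
    HasDerivAt (jacobiSn k) (jacobiCn k x * jacobiDn k x) x :=
  (hasDerivAt_jacobiAm hk0 hk1 x).sin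

theorem hasDerivAt_jacobiCn {k : ℝ} (hk0 : 0 ≤ k) (hk1 : k < 1) (x : ℝ) :
    HasDerivAt (jacobiCn k) (-jacobiSn k x * jacobiDn k x) x :=
  (hasDerivAt_jacobiAm hk0 hk1 x).cos

theorem hasDerivAt_jacobiDn {k : ℝ} (hk0 : 0 ≤ k) (hk1 : k < 1) (x : ℝ) :
    HasDerivAt (jacobiDn k) (-k ^ 2 * jacobiSn k x * jacobiCn k x) x := by
  have h : HasDerivAt (jacobiDn k) _ x :=
    ((((hasDerivAt_jacobiSn hk0 hk1 x).pow 2).const_mul (k ^ 2)).const_sub 1).sqrt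
      (ellipticF_aux hk0 hk1 (jacobiAm k x)).ne'
  refine h.congr_deriv ?_
  have h0 : √(1 - k ^ 2 * jacobiSn k x ^ 2) ≠ 0 := (jacobiDn_pos hk0 hk1 x).ne'
  simp only [jacobiDn, Pi.pow_apply]
  field_simp
  push_cast
  ring

theorem hasDerivAt_ampSq {k : ℝ} (hk0 : 0 ≤ k) (hk1 : k < 1) (b x : ℝ) :
    HasDerivAt (ampSq k b) (-2 * k ^ 2 * jacobiSn k x * jacobiCn k x * jacobiDn k x) x := by
  have h : HasDerivAt (ampSq k b) _ x :=
    (((hasDerivAt_jacobiSn hk0 hk1 x).pow 2).const_mul (k ^ 2)).const_sub b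
  refine h.congr_deriv ?_
  push_cast
  ring

theorem continuous_ampSq {k : ℝ} (hk0 : 0 ≤ k) (hk1 : k < 1) (b : ℝ) : Continuous (ampSq k b) :=
  continuous_iff_continuousAt.2 fun x => (hasDerivAt_ampSq hk0 hk1 b x).continuousAt

/-- The period `2K(k)` of `sn²`. -/
noncomputable def jacobiPeriod (k : ℝ) : ℝ := ellipticF k Real.pi

theorem ellipticF_zero (k : ℝ) : ellipticF k 0 = 0 := by simp [ellipticF]

theorem jacobiPeriod_pos {k : ℝ} (hk0 : 0 ≤ k) (hk1 : k < 1) : 0 < jacobiPeriod k := by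
  simpa [ellipticF_zero, jacobiPeriod] using strictMono_ellipticF hk0 hk1 Real.pi_pos

theorem intervalIntegrable_ellipticF {k : ℝ} (hk0 : 0 ≤ k) (hk1 : k < 1) (p q : ℝ) :
    IntervalIntegrable (fun y : ℝ => 1 / √(1 - k ^ 2 * Real.sin y ^ 2)) MeasureTheory.volume p q := by
  apply Continuous.intervalIntegrable
  refine Continuous.div continuous_const (by fun_prop) fun y => ?_
  exact (Real.sqrt_pos.2 (ellipticF_aux hk0 hk1 y)).ne'

theorem ellipticF_add_pi {k : ℝ} (hk0 : 0 ≤ k) (hk1 : k < 1) (p : ℝ) :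
    ellipticF k (p + Real.pi) = ellipticF k p + jacobiPeriod k := by
  have hper : Function.Periodic (fun y : ℝ => 1 / √(1 - k ^ 2 * Real.sin y ^ 2)) Real.pi := fun y => by
    simp [Real.sin_add_pi]
  have h := hper.intervalIntegral_add_eq p 0
  simp only [zero_add] at h
  rw [ellipticF, ellipticF, jacobiPeriod, ellipticF, ← h]
  exact (intervalIntegral.integral_add_adjacent_intervals
    (intervalIntegrable_ellipticF hk0 hk1 _ _) (intervalIntegrable_ellipticF hk0 hk1 _ _)).symm

theorem ellipticF_neg (k p : ℝ) : ellipticF k (-p) = -ellipticF k p := by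
  rw [ellipticF, ellipticF, ← intervalIntegral.integral_symm]
  have := intervalIntegral.integral_comp_neg (a := p) (b := 0)
    (fun y : ℝ => 1 / √(1 - k ^ 2 * Real.sin y ^ 2))
  simp only [Real.sin_neg, neg_sq, neg_zero] at this
  exact this.symm

theorem jacobiAm_add_period {k : ℝ} (hk0 : 0 ≤ k) (hk1 : k < 1) (x : ℝ) :
    jacobiAm k (x + jacobiPeriod k) = jacobiAm k x + Real.pi := by
  apply (ellipticF_bijective hk0 hk1).injective
  rw [ellipticF_add_pi hk0 hk1, ellipticF_jacobiAm hk0 hk1, ellipticF_jacobiAm hk0 hk1]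

theorem jacobiAm_period_sub {k : ℝ} (hk0 : 0 ≤ k) (hk1 : k < 1) (x : ℝ) :
    jacobiAm k (jacobiPeriod k - x) = Real.pi - jacobiAm k x := by
  apply (ellipticF_bijective hk0 hk1).injective
  rw [sub_eq_neg_add Real.pi, ellipticF_add_pi hk0 hk1, ellipticF_jacobiAm hk0 hk1, ellipticF_neg,
    ellipticF_jacobiAm hk0 hk1]
  ring

theorem ellipticF_pi_div_two {k : ℝ} (hk0 : 0 ≤ k) (hk1 : k < 1) :
    ellipticF k (Real.pi / 2) = jacobiPeriod k / 2 := by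
  have h := ellipticF_add_pi hk0 hk1 (-(Real.pi / 2))
  rw [ellipticF_neg, show -(Real.pi / 2) + Real.pi = Real.pi / 2 by ring] at h
  linarith

theorem ampSq_add_period {k : ℝ} (hk0 : 0 ≤ k) (hk1 : k < 1) (b x : ℝ) :
    ampSq k b (x + jacobiPeriod k) = ampSq k b x := by
  simp [ampSq, jacobiSn, jacobiAm_add_period hk0 hk1, Real.sin_add_pi]

theorem ampSq_period_sub {k : ℝ} (hk0 : 0 ≤ k) (hk1 : k < 1) (b x : ℝ) :
    ampSq k b (jacobiPeriod k - x) = ampSq k b x := by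
  simp [ampSq, jacobiSn, jacobiAm_period_sub hk0 hk1]

/-- The mean value of `R²` over a period. -/
noncomputable def ampSqMean (k b : ℝ) : ℝ :=
  (∫ x in (0 : ℝ)..jacobiPeriod k, ampSq k b x) / jacobiPeriod k

theorem integral_ampSq {k : ℝ} (hk0 : 0 ≤ k) (hk1 : k < 1) (b : ℝ) :
    ∫ x in (0 : ℝ)..jacobiPeriod k, ampSq k b x = jacobiPeriod k * ampSqMean k b := by
  have := (jacobiPeriod_pos hk0 hk1).ne'
  rw [ampSqMean]; field_simp

/-- The reflection `x ↦ 2K - x` exchanges the two halves of a period, so each carries half of the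
vanishing full integral. This fixes the integration constant in `bandIntegral_eq`. -/
theorem integral_ampSq_half {k : ℝ} (hk0 : 0 ≤ k) (hk1 : k < 1) (b : ℝ) :
    ∫ x in (0 : ℝ)..jacobiPeriod k / 2, (ampSq k b x - ampSqMean k b) = 0 := by
  have hc := continuous_ampSq hk0 hk1 b
  have hc' : Continuous fun x => ampSq k b x - ampSqMean k b := hc.sub continuous_const
  have h1 := intervalIntegral.integral_comp_sub_left (a := 0) (b := jacobiPeriod k / 2)
    (fun x => ampSq k b x - ampSqMean k b) (jacobiPeriod k)
  simp only [ampSq_period_sub hk0 hk1] at h1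
  rw [sub_zero, sub_half] at h1
  have h2 := intervalIntegral.integral_add_adjacent_intervals
    (hc'.intervalIntegrable (μ := MeasureTheory.volume) 0 (jacobiPeriod k / 2))
    (hc'.intervalIntegrable (jacobiPeriod k / 2) (jacobiPeriod k))
  rw [← h1, intervalIntegral.integral_sub (hc.intervalIntegrable _ _) (by simp),
    intervalIntegral.integral_sub (hc.intervalIntegrable _ _) (by simp),
    integral_ampSq hk0 hk1] at h2
  rw [intervalIntegral.integral_sub (hc.intervalIntegrable _ _) (by simp)]
  simp at h2 ⊢
  linarith

/-! ### The elliptic solutions as quasi-periodic stationary solutions of NLS. -/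

open scoped ComplexConjugate

/-- The properties of a stationary NLS solution `φ` with derivative `ψ` and squared modulus `w`
used for the Lax spectrum: the equation, its first integrals, and quasi-periodicity. -/
structure IsStationaryNLS (φ ψ : ℝ → ℂ) (w : ℝ → ℝ) (ω c E T : ℝ) (u : ℂ) : Prop where
  hasDerivAt : ∀ x, HasDerivAt φ (ψ x) x
  hasDerivAt_deriv : ∀ x, HasDerivAt ψ (-2 * ((w x : ℂ) + ω) * φ x) x
  mul_conj : ∀ x, φ x * conj (φ x) = w x
  momentum : ∀ x, φ x * conj (ψ x) - ψ x * conj (φ x) = -2 * Complex.I * c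
  energy : ∀ x, ψ x * conj (ψ x) = (E : ℂ) - ((w x : ℂ) + ω) ^ 2
  continuous_sq : Continuous w
  sq_le_one : ∀ x, w x ≤ 1
  shift : ∀ x, φ (x + T) = u * φ x
  norm_shift : ‖u‖ = 1
  pos : 0 < T

theorem ampSq_le_one {b : ℝ} (k : ℝ) (hb1 : b ≤ 1) (x : ℝ) : ampSq k b x ≤ 1 := by
  have := mul_nonneg (sq_nonneg k) (sq_nonneg (jacobiSn k x))
  rw [ampSq]; linarith

/-- Here `R` changes sign, so the polar form of the case `b > k²` is not available. Over the period
of `sn²` the function `cn` is antiperiodic, whence `u = -1`. -/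
theorem isStationary_cn {k : ℝ} (hk0 : 0 < k) (hk1 : k < 1) :
    ∃ ψ u, IsStationaryNLS (ellipticSol k (k ^ 2) 0) ψ (ampSq k (k ^ 2)) (freq k (k ^ 2)) 0
      ((4 * freq k (k ^ 2) * k ^ 2 + 3 * (k ^ 2) ^ 2 + (1 - k ^ 2) ^ 2) / 4) (jacobiPeriod k) u := by
  have hφ : ellipticSol k (k ^ 2) 0 = fun x => ((k * jacobiCn k x : ℝ) : ℂ) := by
    funext x
    simp [ellipticSol, amp, phase]
  have hd2 := jacobiDn_sq hk0.le hk1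
  have hc2 := jacobiCn_sq k
  refine ⟨fun x => ((k * (-jacobiSn k x * jacobiDn k x) : ℝ) : ℂ), -1, ?_⟩
  rw [hφ]
  constructor
  · exact fun x => ((hasDerivAt_jacobiCn hk0.le hk1 x).const_mul k).ofReal_comp
  · intro x
    have h := ((((hasDerivAt_jacobiSn hk0.le hk1 x).neg).mul
      (hasDerivAt_jacobiDn hk0.le hk1 x)).const_mul k).ofReal_comp
    refine h.congr_deriv ?_
    have e : k * (-(jacobiCn k x * jacobiDn k x) * jacobiDn k x
        + -jacobiSn k x * (-k ^ 2 * jacobiSn k x * jacobiCn k x))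
        = -2 * (ampSq k (k ^ 2) x + freq k (k ^ 2)) * (k * jacobiCn k x) := by
      rw [ampSq, freq]
      linear_combination (-k * jacobiCn k x) * hd2 x
    exact_mod_cast e
  · intro x
    rw [Complex.conj_ofReal, ← Complex.ofReal_mul, ampSq]
    norm_cast
    linear_combination k ^ 2 * hc2 x
  · intro x
    simp only [Complex.conj_ofReal]
    push_cast; ring
  · intro x
    rw [Complex.conj_ofReal, ← Complex.ofReal_mul]
    norm_cast
    rw [ampSq, freq]
    linear_combination k ^ 2 * jacobiSn k x ^ 2 * hd2 x
  · exact continuous_ampSq hk0.le hk1 _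
  · exact ampSq_le_one k (by nlinarith)
  · intro x
    simp [jacobiCn, jacobiAm_add_period hk0.le hk1, Real.cos_add_pi]
  · simp
  · exact jacobiPeriod_pos hk0.le hk1

theorem ampSq_pos {k b : ℝ} (hb : k ^ 2 < b) (x : ℝ) : 0 < ampSq k b x := by
  have := mul_le_mul_of_nonneg_left (Real.sin_sq_le_one (jacobiAm k x)) (sq_nonneg k)
  rw [ampSq, jacobiSn]; linarith

theorem hasDerivAt_phase {k b : ℝ} (hk0 : 0 ≤ k) (hk1 : k < 1) (hb : k ^ 2 < b) (c x : ℝ) :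
    HasDerivAt (phase k b c) (c * (1 / ampSq k b x)) x := by
  have hc : Continuous fun y => 1 / ampSq k b y :=
    continuous_const.div (continuous_ampSq hk0 hk1 b) fun y => (ampSq_pos hb y).ne'
  exact (intervalIntegral.integral_hasDerivAt_right (hc.intervalIntegrable _ _)
    hc.stronglyMeasurable.stronglyMeasurableAtFilter hc.continuousAt).const_mul c

theorem phase_add_period {k b : ℝ} (hk0 : 0 ≤ k) (hk1 : k < 1) (hb : k ^ 2 < b) (c x : ℝ) :
    phase k b c (x + jacobiPeriod k) = phase k b c x + phase k b c (jacobiPeriod k) := by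
  have hc : Continuous fun y => 1 / ampSq k b y :=
    continuous_const.div (continuous_ampSq hk0 hk1 b) fun y => (ampSq_pos hb y).ne'
  have hper : Function.Periodic (fun y => 1 / ampSq k b y) (jacobiPeriod k) := fun y => by
    simp only [ampSq_add_period hk0 hk1]
  have h := hper.intervalIntegral_add_eq x 0
  simp only [zero_add] at h
  rw [phase, phase, phase, ← h, ← mul_add]
  congr 1
  exact (intervalIntegral.integral_add_adjacent_intervals
    (hc.intervalIntegrable _ _) (hc.intervalIntegrable _ _)).symm

theorem hasDerivAt_exp_phase {k b : ℝ} (hk0 : 0 ≤ k) (hk1 : k < 1) (hb : k ^ 2 < b) (c x : ℝ) :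
    HasDerivAt (fun x => Complex.exp (Complex.I * (phase k b c x : ℂ)))
      (Complex.exp (Complex.I * (phase k b c x : ℂ)) * (Complex.I * (c / ampSq k b x : ℝ))) x := by
  have h := ((hasDerivAt_phase hk0 hk1 hb c x).ofReal_comp.const_mul Complex.I).cexp
  refine h.congr_deriv ?_
  rw [mul_one_div]

theorem exp_I_mul_conj (t : ℝ) :
    Complex.exp (Complex.I * t) * conj (Complex.exp (Complex.I * t)) = 1 := by
  rw [← Complex.exp_conj, ← Complex.exp_add]
  simp

/-- Since `θ' = c / R²`, the derivative of `φ` is `(R' + i c / R) e^{iθ}`. The phase grows by a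
fixed amount over each period of `R²`, so `u = e^{iθ(T)}`. -/
theorem isStationary_of_lt {k b c : ℝ} (hk0 : 0 < k) (hk1 : k < 1) (hb : k ^ 2 < b) (hb1 : b ≤ 1)
    (hc : c ^ 2 = b * (1 - b) * (b - k ^ 2)) :
    ∃ ψ u, IsStationaryNLS (ellipticSol k b c) ψ (ampSq k b) (freq k b) c
      ((4 * freq k b * b + 3 * b ^ 2 + (1 - k ^ 2) ^ 2) / 4) (jacobiPeriod k) u := by
  set R : ℝ → ℝ := fun x => √(ampSq k b x) with hR
  have hRpos : ∀ x, 0 < R x := fun x => Real.sqrt_pos.2 (ampSq_pos hb x)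
  have hR2 : ∀ x, ampSq k b x = R x ^ 2 := fun x => (Real.sq_sqrt (ampSq_pos hb x).le).symm
  set e : ℝ → ℂ := fun x => Complex.exp (Complex.I * (phase k b c x : ℂ)) with he
  have hφ : ellipticSol k b c = fun x => (R x : ℂ) * e x := by
    funext x
    simp [ellipticSol, amp, hb.ne', R, e]
  have hd2 := jacobiDn_sq hk0.le hk1
  have hc2 := jacobiCn_sq k
  set w₁ : ℝ → ℝ := fun x => -2 * k ^ 2 * jacobiSn k x * jacobiCn k x * jacobiDn k x with hw₁
  have hw : ∀ x, HasDerivAt (ampSq k b) (w₁ x) x := hasDerivAt_ampSq hk0.le hk1 b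
  have hRd : ∀ x, HasDerivAt R (w₁ x / (2 * R x)) x := fun x => (hw x).sqrt (ampSq_pos hb x).ne'
  have hw1d : ∀ x, HasDerivAt w₁ (-2 * k ^ 2 * (jacobiCn k x ^ 2 * jacobiDn k x ^ 2
      - jacobiSn k x ^ 2 * jacobiDn k x ^ 2 - k ^ 2 * jacobiSn k x ^ 2 * jacobiCn k x ^ 2)) x := by
    intro x
    have h : HasDerivAt w₁ _ x := (((hasDerivAt_jacobiSn hk0.le hk1 x).const_mul (-2 * k ^ 2)).mul
      (hasDerivAt_jacobiCn hk0.le hk1 x)).mul (hasDerivAt_jacobiDn hk0.le hk1 x)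
    refine h.congr_deriv ?_
    simp only [Pi.mul_apply]
    ring
  have hed : ∀ x, HasDerivAt e (e x * (Complex.I * (c / R x ^ 2 : ℝ))) x := fun x => by
    rw [← hR2 x]; exact hasDerivAt_exp_phase hk0.le hk1 hb c x
  have hee : ∀ x, e x * conj (e x) = 1 := fun x => exp_I_mul_conj _
  set s := jacobiSn k
  have hRs : ∀ x, R x ^ 2 = b - k ^ 2 * s x ^ 2 := fun x => (hR2 x).symm
  have hw1sq : ∀ x, w₁ x ^ 2 = 4 * k ^ 4 * s x ^ 2 * (1 - s x ^ 2) * (1 - k ^ 2 * s x ^ 2) := by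
    intro x
    simp only [hw₁]
    rw [mul_pow, mul_pow, hd2 x, hc2 x]; ring
  refine ⟨fun x => ((w₁ x / (2 * R x) : ℝ) + Complex.I * (c / R x : ℝ)) * e x,
    e (jacobiPeriod k), ?_⟩
  rw [hφ]
  constructor
  · intro x
    refine ((hRd x).ofReal_comp.mul (hed x)).congr_deriv ?_
    have : (R x : ℂ) ≠ 0 := by exact_mod_cast (hRpos x).ne'
    push_cast
    field_simp
  · intro x
    have hR0 := (hRpos x).ne'
    have h1 := ((((hw1d x).div ((hRd x).const_mul 2) (by positivity)).ofReal_comp.add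
      (((hasDerivAt_const x c).div (hRd x) hR0).ofReal_comp.const_mul Complex.I)).mul (hed x))
    refine h1.congr_deriv ?_
    -- The amplitude equation `R'' - c² / R³ = -2 (R² + ω) R`. The remaining terms cancel because
    -- `R² θ'` is constant.
    have hre : ((-2 * k ^ 2 * (jacobiCn k x ^ 2 * jacobiDn k x ^ 2
      - s x ^ 2 * jacobiDn k x ^ 2 - k ^ 2 * s x ^ 2 * jacobiCn k x ^ 2)) * (2 * R x)
        - w₁ x * (2 * (w₁ x / (2 * R x)))) / (2 * R x) ^ 2 - c / R x * (c / R x ^ 2)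
        = -2 * (ampSq k b x + freq k b) * R x := by
      rw [hd2 x, hc2 x, hR2 x, freq]
      field_simp
      rw [hw1sq x, hc]
      have := hRs x
      have h4 : R x ^ 4 = (b - k ^ 2 * s x ^ 2) ^ 2 := by rw [← this]; ring
      have h6 : R x ^ 6 = (b - k ^ 2 * s x ^ 2) ^ 3 := by rw [← this]; ring
      ring_nf
      rw [h6, h4, this]
      ring
    have hreC := congrArg (fun t : ℝ => (t : ℂ)) hre
    push_cast at hreC
    have hR0' : (R x : ℂ) ≠ 0 := by exact_mod_cast hR0
    simp only [Pi.div_apply, Pi.add_apply]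
    push_cast
    rw [← mul_assoc (-2 * ((ampSq k b x : ℂ) + freq k b)), ← hreC]
    field_simp
    ring_nf
    simp only [Complex.I_sq]
    ring
  · intro x
    rw [map_mul, Complex.conj_ofReal, hR2 x]
    push_cast
    linear_combination (R x : ℂ) ^ 2 * hee x
  · intro x
    have hR0' : (R x : ℂ) ≠ 0 := by exact_mod_cast (hRpos x).ne'
    simp only [map_mul, map_add, Complex.conj_ofReal, Complex.conj_I]
    push_cast
    have h1 : ∀ a : ℂ, (R x : ℂ) * (a / R x) = a := fun a => by field_simp
    linear_combination -2 * Complex.I * c * hee x - 2 * Complex.I * e x * conj (e x) * h1 c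
  · intro x
    have hR0 := (hRpos x).ne'
    simp only [map_mul, map_add, Complex.conj_ofReal, Complex.conj_I]
    have hre : (w₁ x / (2 * R x)) ^ 2 + (c / R x) ^ 2 =
        (4 * freq k b * b + 3 * b ^ 2 + (1 - k ^ 2) ^ 2) / 4 - (ampSq k b x + freq k b) ^ 2 := by
      rw [hR2 x, freq]
      field_simp
      rw [hw1sq x, hc, hRs x]
      ring
    have hreC := congrArg (fun t : ℝ => (t : ℂ)) hre
    push_cast at hreC ⊢
    rw [← hreC]
    linear_combination ((w₁ x / (2 * R x) : ℂ) ^ 2 + (c / R x : ℂ) ^ 2) * hee x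
      - (c / R x : ℂ) ^ 2 * e x * conj (e x) * Complex.I_sq
  · exact continuous_ampSq hk0.le hk1 _
  · exact ampSq_le_one k hb1
  · intro x
    simp only [R, e]
    rw [ampSq_add_period hk0.le hk1, phase_add_period hk0.le hk1 hb]
    push_cast
    rw [mul_add, Complex.exp_add]
    ring
  · simp only [e]
    rw [mul_comm]; exact Complex.norm_exp_ofReal_mul_I _
  · exact jacobiPeriod_pos hk0.le hk1

theorem isStationary_ellipticSol {k b c : ℝ} (hk0 : 0 < k) (hk1 : k < 1) (hkb : k ^ 2 ≤ b)
    (hb1 : b ≤ 1) (hc : c ^ 2 = b * (1 - b) * (b - k ^ 2)) :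
    ∃ ψ u, IsStationaryNLS (ellipticSol k b c) ψ (ampSq k b) (freq k b) c
      ((4 * freq k b * b + 3 * b ^ 2 + (1 - k ^ 2) ^ 2) / 4) (jacobiPeriod k) u := by
  rcases hkb.eq_or_lt with rfl | h
  · obtain rfl : c = 0 := by
      rw [sub_self, mul_zero] at hc
      exact pow_eq_zero_iff (two_ne_zero) |>.1 hc
    exact isStationary_cn hk0 hk1
  · exact isStationary_of_lt hk0 hk1 h hb1 hc

/-! ### The spatial Lax equation: Picard series, Wronskians and uniqueness. -/

/-- The matrix of the spatial Lax equation as an operator on `ℂ × ℂ`. -/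
noncomputable def laxOp (φ : ℝ → ℂ) (ζ : ℂ) (x : ℝ) : ℂ × ℂ →L[ℂ] ℂ × ℂ :=
  ((-Complex.I * ζ) • ContinuousLinearMap.fst ℂ ℂ ℂ + φ x • ContinuousLinearMap.snd ℂ ℂ ℂ).prod
    ((-conj (φ x)) • ContinuousLinearMap.fst ℂ ℂ ℂ
      + (Complex.I * ζ) • ContinuousLinearMap.snd ℂ ℂ ℂ)

theorem laxOp_apply (φ : ℝ → ℂ) (ζ : ℂ) (x : ℝ) (p : ℂ × ℂ) :
    laxOp φ ζ x p = (-Complex.I * ζ * p.1 + φ x * p.2,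
      -conj (φ x) * p.1 + Complex.I * ζ * p.2) := rfl

theorem norm_laxOp_apply_le {φ : ℝ → ℂ} (hφ : ∀ x, ‖φ x‖ ≤ 1) (ζ : ℂ) (x : ℝ) (p : ℂ × ℂ) :
    ‖laxOp φ ζ x p‖ ≤ (‖ζ‖ + 1) * ‖p‖ := by
  have h1 : ‖p.1‖ ≤ ‖p‖ := norm_fst_le p
  have h2 : ‖p.2‖ ≤ ‖p‖ := norm_snd_le p
  have h0 := norm_nonneg p
  have e1 : ‖ζ‖ * ‖p.1‖ ≤ ‖ζ‖ * ‖p‖ := by gcongr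
  have e2 : ‖ζ‖ * ‖p.2‖ ≤ ‖ζ‖ * ‖p‖ := by gcongr
  have e3 : ‖φ x‖ * ‖p.2‖ ≤ 1 * ‖p‖ := mul_le_mul (hφ x) h2 (norm_nonneg _) zero_le_one
  have e4 : ‖φ x‖ * ‖p.1‖ ≤ 1 * ‖p‖ := mul_le_mul (hφ x) h1 (norm_nonneg _) zero_le_one
  rw [laxOp_apply, Prod.norm_mk, max_le_iff]
  constructor
  · refine (norm_add_le _ _).trans ?_
    simp only [norm_mul, norm_neg, Complex.norm_I, one_mul]
    linarith
  · refine (norm_add_le _ _).trans ?_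
    simp only [norm_mul, norm_neg, Complex.norm_I, one_mul, RCLike.norm_conj]
    linarith

/-- The terms of the Picard series of the spatial Lax equation with initial value `p`. -/
noncomputable def laxTerm (φ : ℝ → ℂ) (p : ℂ × ℂ) : ℕ → ℂ × ℝ → ℂ × ℂ
  | 0 => fun _ => p
  | n + 1 => fun z => ∫ t in (0 : ℝ)..z.2, laxOp φ z.1 t (laxTerm φ p n (z.1, t))

theorem continuous_laxTerm {φ : ℝ → ℂ} (hc : Continuous φ) (p : ℂ × ℂ) (n : ℕ) :
    Continuous (laxTerm φ p n) := by
  induction n with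
  | zero => exact continuous_const
  | succ n ih =>
    refine intervalIntegral.continuous_parametric_intervalIntegral_of_continuous ?_ continuous_snd
    simp only [Function.uncurry_def, laxOp_apply]
    have : Continuous fun z : (ℂ × ℝ) × ℝ => laxTerm φ p n (z.1.1, z.2) := ih.comp (by fun_prop)
    have h2 : Continuous fun z : (ℂ × ℝ) × ℝ => conj (φ z.2) :=
      Complex.continuous_conj.comp (by fun_prop)
    fun_prop

theorem continuous_laxOp_laxTerm {φ : ℝ → ℂ} (hc : Continuous φ) (p : ℂ × ℂ) (n : ℕ) (ζ : ℂ) :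
    Continuous fun t : ℝ => laxOp φ ζ t (laxTerm φ p n (ζ, t)) := by
  simp only [laxOp_apply]
  have : Continuous fun t : ℝ => laxTerm φ p n (ζ, t) :=
    (continuous_laxTerm hc p n).comp (by fun_prop)
  have h2 : Continuous fun t : ℝ => conj (φ t) := Complex.continuous_conj.comp hc
  fun_prop

/-- As `|φ| ≤ 1`, each iterated integral gains a factor `(‖ζ‖ + 1)|x| / n`. The resulting factorial
bound makes the series converge locally uniformly in `(ζ, x)`. -/
theorem norm_laxTerm_le {φ : ℝ → ℂ} (hφ : ∀ x, ‖φ x‖ ≤ 1) (hc : Continuous φ) (p : ℂ × ℂ)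
    (n : ℕ) (z : ℂ × ℝ) :
    ‖laxTerm φ p n z‖ ≤ ‖p‖ * (((‖z.1‖ + 1) * |z.2|) ^ n / n.factorial) := by
  induction n generalizing z with
  | zero => simp [laxTerm]
  | succ n ih =>
    have hb : ∀ t, ‖laxOp φ z.1 t (laxTerm φ p n (z.1, t))‖ ≤
        ‖p‖ * (‖z.1‖ + 1) ^ (n + 1) / n.factorial * |t - 0| ^ n := fun t => by
      refine (norm_laxOp_apply_le hφ _ _ _).trans ?_
      refine (mul_le_mul_of_nonneg_left (ih (z.1, t)) (by positivity)).trans_eq ?_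
      rw [mul_pow, sub_zero]
      ring
    have hi : Continuous fun t : ℝ => ‖laxOp φ z.1 t (laxTerm φ p n (z.1, t))‖ :=
      (continuous_laxOp_laxTerm hc p n z.1).norm
    rw [laxTerm]
    refine intervalIntegral.norm_integral_le_integral_norm_uIoc.trans ?_
    refine (MeasureTheory.integral_mono (hi.integrableOn_uIoc)
      (Continuous.integrableOn_uIoc (by fun_prop)) hb).trans_eq ?_
    rw [MeasureTheory.integral_const_mul, integral_pow_abs_sub_uIoc, sub_zero, Nat.factorial_succ]
    push_cast
    rw [mul_pow]
    field_simp

theorem summable_laxBound (R C : ℝ) : Summable fun n : ℕ => C * (R ^ n / n.factorial) :=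
  (Real.summable_pow_div_factorial R).mul_left C

/-- The solution of the spatial Lax equation with initial value `p`, as a function of the spectral
parameter and the position. -/
noncomputable def laxFlow (φ : ℝ → ℂ) (p : ℂ × ℂ) (z : ℂ × ℝ) : ℂ × ℂ := ∑' n, laxTerm φ p n z

theorem laxFlow_zero (φ : ℝ → ℂ) (p : ℂ × ℂ) (ζ : ℂ) : laxFlow φ p (ζ, 0) = p := by
  rw [laxFlow, tsum_eq_single 0]
  · rfl
  · intro n hn
    obtain ⟨m, rfl⟩ := Nat.exists_eq_succ_of_ne_zero hn
    simp [laxTerm]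

/-- Joint continuity in the spectral parameter and the position is all the parameter regularity that
differentiating the Floquet multiplier requires. -/
theorem continuous_laxFlow {φ : ℝ → ℂ} (hφ : ∀ x, ‖φ x‖ ≤ 1) (hc : Continuous φ) (p : ℂ × ℂ) :
    Continuous (laxFlow φ p) := by
  rw [continuous_iff_continuousAt]
  intro z
  have hs : IsOpen {y : ℂ × ℝ | (‖y.1‖ + 1) * |y.2| < (‖z.1‖ + 1) * |z.2| + 1} :=
    isOpen_lt (by fun_prop) continuous_const
  have hon : ContinuousOn (laxFlow φ p)
      {y : ℂ × ℝ | (‖y.1‖ + 1) * |y.2| < (‖z.1‖ + 1) * |z.2| + 1} := by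
    refine continuousOn_tsum (fun n => (continuous_laxTerm hc p n).continuousOn)
      (summable_laxBound ((‖z.1‖ + 1) * |z.2| + 1) ‖p‖) fun n y hy => ?_
    refine (norm_laxTerm_le hφ hc p n y).trans ?_
    have : (‖y.1‖ + 1) * |y.2| ≤ (‖z.1‖ + 1) * |z.2| + 1 := le_of_lt hy
    gcongr
  exact hon.continuousAt (hs.mem_nhds (by simp))

theorem hasDerivAt_laxFlow {φ : ℝ → ℂ} (hφ : ∀ x, ‖φ x‖ ≤ 1) (hc : Continuous φ) (p : ℂ × ℂ)
    (ζ : ℂ) (x : ℝ) :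
    HasDerivAt (fun t => laxFlow φ p (ζ, t)) (laxOp φ ζ x (laxFlow φ p (ζ, x))) x := by
  have hsum : ∀ t : ℝ, Summable fun n => laxTerm φ p n (ζ, t) := fun t =>
    Summable.of_norm_bounded (summable_laxBound ((‖ζ‖ + 1) * |t|) ‖p‖)
      fun n => norm_laxTerm_le hφ hc p n (ζ, t)
  have hd : ∀ (n : ℕ) (t : ℝ), HasDerivAt (fun t => laxTerm φ p (n + 1) (ζ, t))
      (laxOp φ ζ t (laxTerm φ p n (ζ, t))) t := fun n t => by
    have hcont := continuous_laxOp_laxTerm hc p n ζ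
    exact intervalIntegral.integral_hasDerivAt_right (hcont.intervalIntegrable _ _)
      hcont.stronglyMeasurable.stronglyMeasurableAtFilter hcont.continuousAt
  have hmain : HasDerivAt (fun t => ∑' n, laxTerm φ p (n + 1) (ζ, t))
      (∑' n, laxOp φ ζ x (laxTerm φ p n (ζ, x))) x := by
    refine hasDerivAt_tsum_of_isPreconnected (t := Metric.ball (0 : ℝ) (|x| + 1)) (y₀ := x)
      ((summable_laxBound ((‖ζ‖ + 1) * (|x| + 1)) ‖p‖).mul_left (‖ζ‖ + 1)) Metric.isOpen_ball
      (convex_ball _ _).isPreconnected (fun n t _ => hd n t) ?_ (by simp)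
      ((summable_nat_add_iff 1).2 (hsum x)) (by simp)
    intro n t ht
    have ht' : |t| ≤ |x| + 1 := by simpa using (Metric.mem_ball.1 ht).le
    refine (norm_laxOp_apply_le hφ _ _ _).trans ?_
    refine mul_le_mul_of_nonneg_left ((norm_laxTerm_le hφ hc p n (ζ, t)).trans ?_) (by positivity)
    gcongr
  have hfun : (fun t => laxFlow φ p (ζ, t)) = fun t => p + ∑' n, laxTerm φ p (n + 1) (ζ, t) := by
    funext t
    rw [laxFlow, (hsum t).tsum_eq_zero_add]
    rfl
  rw [hfun]
  refine (hmain.const_add p).congr_deriv ?_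
  rw [← ContinuousLinearMap.map_tsum _ (hsum x)]
  congr 1

/-- Solutions of the spatial Lax equation. -/
def IsLaxSol (φ : ℝ → ℂ) (ζ : ℂ) (v : ℝ → ℂ × ℂ) : Prop :=
  ∀ x, HasDerivAt v (laxOp φ ζ x (v x)) x

/-- The determinant of two vectors of `ℂ²`. -/
def wronskian (p q : ℂ × ℂ) : ℂ := p.1 * q.2 - p.2 * q.1

theorem IsLaxSol.fst {φ : ℝ → ℂ} {ζ : ℂ} {v : ℝ → ℂ × ℂ} (hv : IsLaxSol φ ζ v) (x : ℝ) :
    HasDerivAt (fun t => (v t).1) (-Complex.I * ζ * (v x).1 + φ x * (v x).2) x :=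
  (ContinuousLinearMap.fst ℝ ℂ ℂ).hasFDerivAt.comp_hasDerivAt x (hv x)

theorem IsLaxSol.snd {φ : ℝ → ℂ} {ζ : ℂ} {v : ℝ → ℂ × ℂ} (hv : IsLaxSol φ ζ v) (x : ℝ) :
    HasDerivAt (fun t => (v t).2) (-conj (φ x) * (v x).1 + Complex.I * ζ * (v x).2) x :=
  (ContinuousLinearMap.snd ℝ ℂ ℂ).hasFDerivAt.comp_hasDerivAt x (hv x)

theorem isLaxSol_mk {φ : ℝ → ℂ} {ζ : ℂ} {f g : ℝ → ℂ}
    (hf : ∀ x, HasDerivAt f (-Complex.I * ζ * f x + φ x * g x) x)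
    (hg : ∀ x, HasDerivAt g (-conj (φ x) * f x + Complex.I * ζ * g x) x) :
    IsLaxSol φ ζ fun x => (f x, g x) := fun x => (hf x).prodMk (hg x)

theorem IsLaxSol.continuous {φ : ℝ → ℂ} {ζ : ℂ} {v : ℝ → ℂ × ℂ} (hv : IsLaxSol φ ζ v) :
    Continuous v := continuous_iff_continuousAt.2 fun x => (hv x).continuousAt

/-- The two solutions may have different spectral parameters. Equal ones give a constant Wronskian;
unequal ones give the derivative of the multiplier. -/
theorem hasDerivAt_wronskian {φ : ℝ → ℂ} {ζ η : ℂ} {v z : ℝ → ℂ × ℂ} (hv : IsLaxSol φ ζ v)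
    (hz : IsLaxSol φ η z) (x : ℝ) :
    HasDerivAt (fun t => wronskian (v t) (z t))
      (Complex.I * (η - ζ) * ((v x).1 * (z x).2 + (v x).2 * (z x).1)) x := by
  refine (((hv.fst x).mul (hz.snd x)).sub ((hv.snd x).mul (hz.fst x))).congr_deriv ?_
  ring

theorem wronskian_eq_zero_eq {φ : ℝ → ℂ} {ζ : ℂ} {v z : ℝ → ℂ × ℂ} (hv : IsLaxSol φ ζ v)
    (hz : IsLaxSol φ ζ z) (x : ℝ) : wronskian (v x) (z x) = wronskian (v 0) (z 0) := by
  have h : ∀ t, HasDerivAt (fun t => wronskian (v t) (z t)) 0 t := fun t =>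
    (hasDerivAt_wronskian hv hz t).congr_deriv (by rw [sub_self, mul_zero, zero_mul])
  exact is_const_of_deriv_eq_zero (fun t => (h t).differentiableAt) (fun t => (h t).deriv) x 0

theorem IsLaxSol.smul {φ : ℝ → ℂ} {ζ : ℂ} {v : ℝ → ℂ × ℂ} (hv : IsLaxSol φ ζ v) (a : ℂ) :
    IsLaxSol φ ζ fun x => a • v x := fun x =>
  ((hv x).const_smul a).congr_deriv (by rw [map_smul])

theorem IsLaxSol.add {φ : ℝ → ℂ} {ζ : ℂ} {v z : ℝ → ℂ × ℂ} (hv : IsLaxSol φ ζ v)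
    (hz : IsLaxSol φ ζ z) : IsLaxSol φ ζ fun x => v x + z x := fun x =>
  ((hv x).add (hz x)).congr_deriv (by rw [map_add])

theorem isLaxSol_laxFlow {φ : ℝ → ℂ} (hφ : ∀ x, ‖φ x‖ ≤ 1) (hc : Continuous φ) (p : ℂ × ℂ)
    (ζ : ℂ) : IsLaxSol φ ζ fun x => laxFlow φ p (ζ, x) := hasDerivAt_laxFlow hφ hc p ζ

/-- Uniqueness by Cramer's rule: the Wronskian of the two basic solutions is `1`, and the
coefficients of `v` in this basis are Wronskians, hence constant. -/
theorem IsLaxSol.eq_flow {φ : ℝ → ℂ} (hφ : ∀ x, ‖φ x‖ ≤ 1) (hc : Continuous φ) {ζ : ℂ}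
    {v : ℝ → ℂ × ℂ} (hv : IsLaxSol φ ζ v) (x : ℝ) :
    v x = (v 0).1 • laxFlow φ (1, 0) (ζ, x) + (v 0).2 • laxFlow φ (0, 1) (ζ, x) := by
  have hf := isLaxSol_laxFlow hφ hc (1, 0) ζ
  have hg := isLaxSol_laxFlow hφ hc (0, 1) ζ
  have h1 := wronskian_eq_zero_eq hf hg x
  have h2 := wronskian_eq_zero_eq hv hg x
  have h3 := wronskian_eq_zero_eq hf hv x
  simp only [laxFlow_zero, wronskian] at h1 h2 h3
  ext
  · simp only [Prod.fst_add, Prod.smul_fst, smul_eq_mul]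
    linear_combination -(v x).1 * h1 + (laxFlow φ (1, 0) (ζ, x)).1 * h2
      + (laxFlow φ (0, 1) (ζ, x)).1 * h3
  · simp only [Prod.snd_add, Prod.smul_snd, smul_eq_mul]
    linear_combination -(v x).2 * h1 + (laxFlow φ (1, 0) (ζ, x)).2 * h2
      + (laxFlow φ (0, 1) (ζ, x)).2 * h3

theorem IsLaxSol.eq_of_zero {φ : ℝ → ℂ} (hφ : ∀ x, ‖φ x‖ ≤ 1) (hc : Continuous φ) {ζ : ℂ}
    {v z : ℝ → ℂ × ℂ} (hv : IsLaxSol φ ζ v) (hz : IsLaxSol φ ζ z) (h : v 0 = z 0) (x : ℝ) :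
    v x = z x := by
  rw [hv.eq_flow hφ hc, hz.eq_flow hφ hc, h]

/-! ### The temporal Lax matrix and its eigenvectors. -/

/-- The entry `A` of the temporal Lax matrix. -/
noncomputable def laxA (w : ℝ → ℝ) (ω : ℝ) (ζ : ℂ) (x : ℝ) : ℂ :=
  -Complex.I * ζ ^ 2 + Complex.I / 2 * (w x : ℂ) + Complex.I / 2 * (ω : ℂ)

/-- The entry `B` of the temporal Lax matrix. -/
noncomputable def laxB (φ ψ : ℝ → ℂ) (ζ : ℂ) (x : ℝ) : ℂ := ζ * φ x + Complex.I / 2 * ψ x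

/-- The entry `C` of the temporal Lax matrix. -/
noncomputable def laxC (φ ψ : ℝ → ℂ) (ζ : ℂ) (x : ℝ) : ℂ :=
  -ζ * conj (φ x) + Complex.I / 2 * conj (ψ x)

/-- `p` lies in the kernel of the temporal Lax matrix minus `Ω` at the point `x`. -/
def IsLaxEig (φ ψ : ℝ → ℂ) (w : ℝ → ℝ) (ω : ℝ) (ζ Ω : ℂ) (x : ℝ) (p : ℂ × ℂ) : Prop :=
  laxA w ω ζ x * p.1 + laxB φ ψ ζ x * p.2 = Ω * p.1 ∧
    laxC φ ψ ζ x * p.1 - laxA w ω ζ x * p.2 = Ω * p.2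

/-- The characteristic polynomial `Ω²(ζ)` in terms of the first integrals. -/
noncomputable def laxQ (ω c E : ℝ) (ζ : ℂ) : ℂ := -ζ ^ 4 + ω * ζ ^ 2 + c * ζ - E / 4

/-- By Cayley–Hamilton the columns of `M + Ω` lie in the kernel of `M - Ω`. If both vanish, then `Ω
= 0` and `M = 0`, and any vector serves. -/
theorem exists_eigenvector {A B C Ω : ℂ} (h : Ω ^ 2 = A ^ 2 + B * C) :
    ∃ p : ℂ × ℂ, p ≠ 0 ∧ A * p.1 + B * p.2 = Ω * p.1 ∧ C * p.1 - A * p.2 = Ω * p.2 := by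
  by_cases h1 : ((A + Ω, C) : ℂ × ℂ) = 0
  · by_cases h2 : ((B, Ω - A) : ℂ × ℂ) = 0
    · obtain ⟨h3, h4⟩ := Prod.mk_eq_zero.1 h1
      obtain ⟨h5, h6⟩ := Prod.mk_eq_zero.1 h2
      exact ⟨(1, 0), by simp, by linear_combination -h6, by linear_combination h4⟩
    · exact ⟨_, h2, by ring, by linear_combination -h⟩
  · exact ⟨_, h1, by linear_combination -h, by ring⟩

theorem wronskian_eq_zero_of_eig {A B C Ω : ℂ} (hΩ : Ω ≠ 0) {p q : ℂ × ℂ}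
    (hp1 : A * p.1 + B * p.2 = Ω * p.1) (hp2 : C * p.1 - A * p.2 = Ω * p.2)
    (hq1 : A * q.1 + B * q.2 = Ω * q.1) (hq2 : C * q.1 - A * q.2 = Ω * q.2) :
    wronskian p q = 0 := by
  have : 2 * Ω * wronskian p q = 0 := by
    rw [wronskian]
    linear_combination -q.2 * hp1 + p.2 * hq1 + q.1 * hp2 - p.1 * hq2
  exact (mul_eq_zero.1 this).resolve_left (mul_ne_zero two_ne_zero hΩ)

theorem exists_smul_of_wronskian_eq_zero {p q : ℂ × ℂ} (hp : p ≠ 0) (h : wronskian p q = 0) :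
    ∃ m : ℂ, q = m • p := by
  rw [wronskian] at h
  by_cases h1 : p.1 = 0
  · have h2 : p.2 ≠ 0 := fun h2 => hp (Prod.ext h1 h2)
    refine ⟨q.2 / p.2, Prod.ext ?_ ?_⟩
    · have : q.1 = 0 := by
        rw [h1, zero_mul, zero_sub, neg_eq_zero] at h
        exact (mul_eq_zero.1 h).resolve_left h2
      simp [h1, this]
    · simp [h2]
  · refine ⟨q.1 / p.1, Prod.ext ?_ ?_⟩
    · simp [h1]
    · simp only [Prod.smul_snd, smul_eq_mul]
      field_simp
      linear_combination h

namespace IsStationaryNLS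

variable {φ ψ : ℝ → ℂ} {w : ℝ → ℝ} {ω c E T : ℝ} {u : ℂ}

theorem norm_sq (h : IsStationaryNLS φ ψ w ω c E T u) (x : ℝ) : ‖φ x‖ ^ 2 = w x := by
  have := h.mul_conj x
  rw [Complex.mul_conj, Complex.normSq_eq_norm_sq] at this
  exact_mod_cast this

theorem norm_le_one (h : IsStationaryNLS φ ψ w ω c E T u) (x : ℝ) : ‖φ x‖ ≤ 1 := by
  have := h.norm_sq x
  nlinarith [h.sq_le_one x, norm_nonneg (φ x)]

theorem continuous (h : IsStationaryNLS φ ψ w ω c E T u) : Continuous φ :=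
  continuous_iff_continuousAt.2 fun x => (h.hasDerivAt x).continuousAt

theorem laxA_sq_add (h : IsStationaryNLS φ ψ w ω c E T u) (ζ : ℂ) (x : ℝ) :
    laxA w ω ζ x ^ 2 + laxB φ ψ ζ x * laxC φ ψ ζ x = laxQ ω c E ζ := by
  have h1 := h.mul_conj x
  have h2 := h.momentum x
  have h3 := h.energy x
  rw [laxA, laxB, laxC, laxQ]
  linear_combination -ζ ^ 2 * h1 + Complex.I / 2 * ζ * h2 + Complex.I ^ 2 / 4 * h3 +
    (-c * ζ + (E - (w x + ω) ^ 2) / 4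
      + (-ζ ^ 2 + w x / 2 + ω / 2) ^ 2) * Complex.I_sq

theorem hasDerivAt_conj (h : IsStationaryNLS φ ψ w ω c E T u) (x : ℝ) :
    HasDerivAt (fun t => conj (φ t)) (conj (ψ x)) x :=
  Complex.conjCLE.toContinuousLinearMap.hasFDerivAt.comp_hasDerivAt x (h.hasDerivAt x)

theorem hasDerivAt_conj_deriv (h : IsStationaryNLS φ ψ w ω c E T u) (x : ℝ) :
    HasDerivAt (fun t => conj (ψ t)) (-2 * ((w x : ℂ) + ω) * conj (φ x)) x := by
  refine (Complex.conjCLE.toContinuousLinearMap.hasFDerivAt.comp_hasDerivAt x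
    (h.hasDerivAt_deriv x)).congr_deriv ?_
  simp [Complex.conj_ofNat]

theorem hasDerivAt_laxA (h : IsStationaryNLS φ ψ w ω c E T u) (ζ : ℂ) (x : ℝ) :
    HasDerivAt (laxA w ω ζ) (φ x * laxC φ ψ ζ x + laxB φ ψ ζ x * conj (φ x)) x := by
  have h1 : HasDerivAt (fun t => (w t : ℂ)) (ψ x * conj (φ x) + φ x * conj (ψ x)) x := by
    have := (h.hasDerivAt x).mul (h.hasDerivAt_conj x)
    refine this.congr_of_eventuallyEq (Filter.Eventually.of_forall fun t => ?_)
    exact (h.mul_conj t).symm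
  refine (((h1.const_mul (Complex.I / 2)).const_add (-Complex.I * ζ ^ 2)).add_const
    (Complex.I / 2 * (ω : ℂ))).congr_deriv ?_
  rw [laxB, laxC]; ring

theorem hasDerivAt_laxB (h : IsStationaryNLS φ ψ w ω c E T u) (ζ : ℂ) (x : ℝ) :
    HasDerivAt (laxB φ ψ ζ)
      (-2 * Complex.I * ζ * laxB φ ψ ζ x - 2 * φ x * laxA w ω ζ x) x := by
  refine (((h.hasDerivAt x).const_mul ζ).add
    ((h.hasDerivAt_deriv x).const_mul (Complex.I / 2))).congr_deriv ?_
  rw [laxA, laxB]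
  linear_combination (ζ * ψ x) * Complex.I_sq

theorem hasDerivAt_laxC (h : IsStationaryNLS φ ψ w ω c E T u) (ζ : ℂ) (x : ℝ) :
    HasDerivAt (laxC φ ψ ζ)
      (2 * Complex.I * ζ * laxC φ ψ ζ x - 2 * conj (φ x) * laxA w ω ζ x) x := by
  refine (((h.hasDerivAt_conj x).const_mul (-ζ)).add
    ((h.hasDerivAt_conj_deriv x).const_mul (Complex.I / 2))).congr_deriv ?_
  rw [laxA, laxC]
  linear_combination (-ζ * conj (ψ x)) * Complex.I_sq

/-- The three preceding derivatives are the entries of the zero-curvature equation `M' = [U, M]`,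
`U` being the spatial matrix, so `M` sends solutions to solutions. Being an eigenvector at `x = 0`
therefore propagates to all `x`. -/
theorem isLaxSol_temporal (h : IsStationaryNLS φ ψ w ω c E T u) {ζ : ℂ} {v : ℝ → ℂ × ℂ}
    (hv : IsLaxSol φ ζ v) :
    IsLaxSol φ ζ fun x => (laxA w ω ζ x * (v x).1 + laxB φ ψ ζ x * (v x).2,
      laxC φ ψ ζ x * (v x).1 - laxA w ω ζ x * (v x).2) := by
  apply isLaxSol_mk
  · intro x
    refine (((h.hasDerivAt_laxA ζ x).mul (hv.fst x)).add
      ((h.hasDerivAt_laxB ζ x).mul (hv.snd x))).congr_deriv ?_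
    ring
  · intro x
    refine (((h.hasDerivAt_laxC ζ x).mul (hv.fst x)).sub
      ((h.hasDerivAt_laxA ζ x).mul (hv.snd x))).congr_deriv ?_
    ring

theorem isLaxEig_of_zero (h : IsStationaryNLS φ ψ w ω c E T u) {ζ Ω : ℂ} {v : ℝ → ℂ × ℂ}
    (hv : IsLaxSol φ ζ v) (h0 : IsLaxEig φ ψ w ω ζ Ω 0 (v 0)) (x : ℝ) :
    IsLaxEig φ ψ w ω ζ Ω x (v x) := by
  have := (h.isLaxSol_temporal hv).eq_of_zero h.norm_le_one h.continuous (hv.smul Ω)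
    (Prod.ext h0.1 h0.2) x
  exact ⟨congrArg Prod.fst this, congrArg Prod.snd this⟩

theorem exists_sol (h : IsStationaryNLS φ ψ w ω c E T u) {ζ Ω : ℂ}
    (hΩ : Ω ^ 2 = laxQ ω c E ζ) :
    ∃ v, IsLaxSol φ ζ v ∧ v 0 ≠ 0 ∧ ∀ x, IsLaxEig φ ψ w ω ζ Ω x (v x) := by
  obtain ⟨p, hp0, hp⟩ := exists_eigenvector (hΩ.trans (h.laxA_sq_add ζ 0).symm)
  have hv := isLaxSol_laxFlow h.norm_le_one h.continuous p ζ
  refine ⟨_, hv, by rwa [laxFlow_zero], h.isLaxEig_of_zero hv ?_⟩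
  rw [laxFlow_zero]
  exact hp

theorem ne_zero_of_ne_zero (h : IsStationaryNLS φ ψ w ω c E T u) {ζ : ℂ} {v : ℝ → ℂ × ℂ}
    (hv : IsLaxSol φ ζ v) {x : ℝ} (hx : v x ≠ 0) : v 0 ≠ 0 := fun h0 => hx <| by
  rw [hv.eq_flow h.norm_le_one h.continuous, h0]; simp

theorem sq_eq_of_isLaxEig (h : IsStationaryNLS φ ψ w ω c E T u) {ζ Ω : ℂ} {x : ℝ} {p : ℂ × ℂ}
    (hp0 : p ≠ 0) (hp : IsLaxEig φ ψ w ω ζ Ω x p) : Ω ^ 2 = laxQ ω c E ζ := by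
  rw [← h.laxA_sq_add ζ x]
  obtain ⟨h1, h2⟩ := hp
  set A := laxA w ω ζ x
  set B := laxB φ ψ ζ x
  set C := laxC φ ψ ζ x
  have e1 : (Ω ^ 2 - (A ^ 2 + B * C)) * p.1 = 0 := by linear_combination -(A + Ω) * h1 - B * h2
  have e2 : (Ω ^ 2 - (A ^ 2 + B * C)) * p.2 = 0 := by linear_combination (A - Ω) * h2 - C * h1
  by_contra hne
  have hne' := sub_ne_zero.2 hne
  exact hp0 (Prod.ext ((mul_eq_zero.1 e1).resolve_left hne') ((mul_eq_zero.1 e2).resolve_left hne'))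

theorem deriv_shift (h : IsStationaryNLS φ ψ w ω c E T u) (x : ℝ) : ψ (x + T) = u * ψ x := by
  have h1 : HasDerivAt (fun t => φ (t + T)) (ψ (x + T)) x :=
    (h.hasDerivAt (x + T)).comp_add_const x T
  have h2 : HasDerivAt (fun t => φ (t + T)) (u * ψ x) x := by
    simp only [h.shift]
    exact (h.hasDerivAt x).const_mul u
  exact h1.unique h2

theorem mul_conj_shift (h : IsStationaryNLS φ ψ w ω c E T u) : u * conj u = 1 := by
  rw [Complex.mul_conj, Complex.normSq_eq_norm_sq, h.norm_shift]; simp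

theorem sq_shift (h : IsStationaryNLS φ ψ w ω c E T u) (x : ℝ) : w (x + T) = w x := by
  rw [← h.norm_sq, ← h.norm_sq, h.shift, norm_mul, h.norm_shift, one_mul]

/-- Translation by a period, corrected by the Floquet factor of `φ`, preserves the Lax equation. -/
theorem isLaxSol_shift (h : IsStationaryNLS φ ψ w ω c E T u) {ζ : ℂ} {v : ℝ → ℂ × ℂ}
    (hv : IsLaxSol φ ζ v) : IsLaxSol φ ζ fun x => ((v (x + T)).1, u * (v (x + T)).2) := by
  apply isLaxSol_mk
  · intro x
    refine ((hv.fst (x + T)).comp_add_const x T).congr_deriv ?_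
    rw [h.shift]; ring
  · intro x
    refine (((hv.snd (x + T)).comp_add_const x T).const_mul u).congr_deriv ?_
    rw [h.shift, map_mul]
    linear_combination -conj (φ x) * (v (x + T)).1 * h.mul_conj_shift

theorem isLaxEig_shift (h : IsStationaryNLS φ ψ w ω c E T u) {ζ Ω : ℂ} {x : ℝ} {p : ℂ × ℂ}
    (hp : IsLaxEig φ ψ w ω ζ Ω (x + T) p) : IsLaxEig φ ψ w ω ζ Ω x (p.1, u * p.2) := by
  obtain ⟨h1, h2⟩ := hp
  rw [laxA, laxB, h.shift, h.deriv_shift, h.sq_shift] at h1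
  rw [laxA, laxC, h.shift, h.deriv_shift, h.sq_shift, map_mul, map_mul] at h2
  constructor
  · simp only [laxA, laxB]
    linear_combination h1
  · simp only [laxA, laxC]
    linear_combination u * h2 + (ζ * conj (φ x) - Complex.I / 2 * conj (ψ x)) * p.1 *
      h.mul_conj_shift

end IsStationaryNLS

/-! ### Floquet multipliers of joint solutions and boundedness. -/

/-- `m` is the Floquet multiplier of the joint solutions of the Lax pair with parameters `ζ, Ω`. -/
def IsFloquetMul (φ ψ : ℝ → ℂ) (w : ℝ → ℝ) (ω T : ℝ) (u ζ Ω m : ℂ) : Prop :=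
  ∃ v, IsLaxSol φ ζ v ∧ v 0 ≠ 0 ∧ (∀ x, IsLaxEig φ ψ w ω ζ Ω x (v x)) ∧
    ∀ x, ((v (x + T)).1, u * (v (x + T)).2) = m • v x

namespace IsStationaryNLS

variable {φ ψ : ℝ → ℂ} {w : ℝ → ℝ} {ω c E T : ℝ} {u : ℂ}

/-- For `Ω ≠ 0` the eigenvalues `±Ω` of the traceless matrix are distinct, so the `Ω`-eigenspace is
a line and the corrected translate of `v` is proportional to `v`. -/
theorem exists_multiplier (h : IsStationaryNLS φ ψ w ω c E T u) {ζ Ω : ℂ} (hΩ : Ω ≠ 0)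
    {v : ℝ → ℂ × ℂ} (hv : IsLaxSol φ ζ v) (h0 : v 0 ≠ 0)
    (he : ∀ x, IsLaxEig φ ψ w ω ζ Ω x (v x)) :
    ∃ m : ℂ, ∀ x, ((v (x + T)).1, u * (v (x + T)).2) = m • v x := by
  have e2 := h.isLaxEig_shift (he (0 + T))
  obtain ⟨m, hm⟩ := exists_smul_of_wronskian_eq_zero h0
    (wronskian_eq_zero_of_eig hΩ (he 0).1 (he 0).2 e2.1 e2.2)
  exact ⟨m, (h.isLaxSol_shift hv).eq_of_zero h.norm_le_one h.continuous (hv.smul m) hm⟩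

theorem exists_isFloquetMul (h : IsStationaryNLS φ ψ w ω c E T u) {ζ Ω : ℂ} (hΩ : Ω ≠ 0)
    (hQ : Ω ^ 2 = laxQ ω c E ζ) : ∃ m, IsFloquetMul φ ψ w ω T u ζ Ω m := by
  obtain ⟨v, hv, h0, he⟩ := h.exists_sol hQ
  obtain ⟨m, hm⟩ := h.exists_multiplier hΩ hv h0 he
  exact ⟨m, v, hv, h0, he, hm⟩

theorem wronskian_ne_zero {ζ Ω : ℂ} (hΩ : Ω ≠ 0) {x : ℝ}
    {p q : ℂ × ℂ} (hp0 : p ≠ 0) (hq0 : q ≠ 0) (hp : IsLaxEig φ ψ w ω ζ Ω x p)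
    (hq : IsLaxEig φ ψ w ω ζ (-Ω) x q) : wronskian p q ≠ 0 := by
  intro hw
  obtain ⟨m, rfl⟩ := exists_smul_of_wronskian_eq_zero hp0 hw
  obtain ⟨h1, h2⟩ := hp
  obtain ⟨h3, h4⟩ := hq
  simp only [Prod.smul_fst, Prod.smul_snd, smul_eq_mul] at h3 h4
  have e1 : 2 * Ω * (m * p.1) = 0 := by linear_combination h3 - m * h1
  have e2 : 2 * Ω * (m * p.2) = 0 := by linear_combination h4 - m * h2
  have h2Ω := mul_ne_zero two_ne_zero hΩ
  exact hq0 (Prod.ext ((mul_eq_zero.1 e1).resolve_left h2Ω) ((mul_eq_zero.1 e2).resolve_left h2Ω))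

/-- The Wronskian of the two solutions is constant and nonzero, while the corrected translation acts
through `diag(1, u)`, of determinant `u`. -/
theorem mul_floquetMul {ζ Ω m n : ℂ} (hΩ : Ω ≠ 0)
    (hm : IsFloquetMul φ ψ w ω T u ζ Ω m) (hn : IsFloquetMul φ ψ w ω T u ζ (-Ω) n) :
    m * n = u := by
  obtain ⟨v, hv, hv0, hve, hvm⟩ := hm
  obtain ⟨z, hz, hz0, hze, hzm⟩ := hn
  have hW := wronskian_ne_zero hΩ hv0 hz0 (hve 0) (hze 0)
  have h1 := wronskian_eq_zero_eq hv hz (0 + T)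
  have h2 := hvm 0
  have h3 := hzm 0
  have a1 := congrArg Prod.fst h2
  have a2 := congrArg Prod.snd h2
  have b1 := congrArg Prod.fst h3
  have b2 := congrArg Prod.snd h3
  simp only [Prod.smul_fst, Prod.smul_snd, smul_eq_mul] at a1 a2 b1 b2
  apply mul_right_cancel₀ hW
  rw [wronskian, wronskian] at h1
  rw [wronskian]
  linear_combination u * h1 - m * (v 0).1 * b2 + m * (v 0).2 * b1 - u * (z (0 + T)).2 * a1
    + (z (0 + T)).1 * a2

theorem norm_shift_sol (h : IsStationaryNLS φ ψ w ω c E T u) {m : ℂ} {v : ℝ → ℂ × ℂ}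
    (hm : ∀ x, ((v (x + T)).1, u * (v (x + T)).2) = m • v x) (x : ℝ) :
    ‖v (x + T)‖ = ‖m‖ * ‖v x‖ := by
  rw [← norm_smul, ← hm, Prod.norm_def, Prod.norm_mk, norm_mul, h.norm_shift, one_mul]

/-- If `‖m‖ ≠ 1`, then `‖v‖` grows geometrically along multiples of the period, to the left if `‖m‖
< 1` and to the right if `‖m‖ > 1`. -/
theorem norm_eq_one_of_bounded (h : IsStationaryNLS φ ψ w ω c E T u) {m : ℂ} {v : ℝ → ℂ × ℂ}
    (h0 : v 0 ≠ 0) (hm : ∀ x, ((v (x + T)).1, u * (v (x + T)).2) = m • v x) {M : ℝ}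
    (hM : ∀ x, ‖v x‖ ≤ M) : ‖m‖ = 1 := by
  have hn := h.norm_shift_sol hm
  have h0' := norm_pos_iff.2 h0
  rcases lt_trichotomy ‖m‖ 1 with h1 | h1 | h1
  · have hk : ∀ n : ℕ, ‖v 0‖ = ‖m‖ ^ n * ‖v (-(n * T))‖ := fun n => by
      induction n with
      | zero => simp
      | succ n ih =>
        rw [ih, pow_succ, mul_assoc, ← hn]
        congr 3
        push_cast; ring
    have hlim : Filter.Tendsto (fun n : ℕ => ‖m‖ ^ n * M) Filter.atTop (nhds (0 * M)) :=
      (tendsto_pow_atTop_nhds_zero_of_lt_one (norm_nonneg _) h1).mul_const M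
    rw [zero_mul] at hlim
    have : ‖v 0‖ ≤ 0 := ge_of_tendsto' hlim fun n => by
      rw [hk n]
      exact mul_le_mul_of_nonneg_left (hM _) (by positivity)
    linarith
  · exact h1
  · have hk : ∀ n : ℕ, ‖v (n * T)‖ = ‖m‖ ^ n * ‖v 0‖ := fun n => by
      induction n with
      | zero => simp
      | succ n ih =>
        rw [show ((n + 1 : ℕ) : ℝ) * T = n * T + T by push_cast; ring, hn, ih]
        ring
    obtain ⟨n, hn'⟩ := pow_unbounded_of_one_lt (M / ‖v 0‖) h1
    rw [div_lt_iff₀ h0', ← hk] at hn'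
    exact absurd (hM _) (not_le.2 hn')

theorem bounded_of_norm_eq_one (h : IsStationaryNLS φ ψ w ω c E T u) {m : ℂ} {v : ℝ → ℂ × ℂ}
    (hc : Continuous v) (hm : ∀ x, ((v (x + T)).1, u * (v (x + T)).2) = m • v x)
    (h1 : ‖m‖ = 1) : ∃ M, ∀ x, ‖v x‖ ≤ M := by
  have hper : Function.Periodic (fun x => ‖v x‖) T := fun x => by
    simp only [h.norm_shift_sol hm, h1, one_mul]
  obtain ⟨M, hM⟩ := (isCompact_Icc (a := 0) (b := T)).exists_bound_of_continuousOn
    hc.continuousOn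
  refine ⟨M, fun x => ?_⟩
  obtain ⟨y, hy, hxy⟩ := hper.exists_mem_Ico₀ h.pos x
  rw [show ‖v x‖ = ‖v y‖ from hxy]
  exact hM y ⟨hy.1, hy.2.le⟩

end IsStationaryNLS

/-- The Floquet multiplier of the Lax pair with parameters `ζ, Ω`. -/
noncomputable def floquetMul (φ ψ : ℝ → ℂ) (w : ℝ → ℝ) (ω T : ℝ) (u ζ Ω : ℂ) : ℂ :=
  Classical.epsilon (IsFloquetMul φ ψ w ω T u ζ Ω)

/-- Where `f` vanishes the product rule needs only continuity of `g`, so no differentiability of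
solutions in the spectral parameter is required. -/
theorem HasDerivAt.mul_of_zero {f g : ℝ → ℂ} {f' : ℂ} {x : ℝ} (hf : HasDerivAt f f' x)
    (h0 : f x = 0) (hg : ContinuousAt g x) : HasDerivAt (fun t => f t * g t) (f' * g x) x := by
  rw [hasDerivAt_iff_tendsto_slope] at hf ⊢
  refine (hf.mul (hg.tendsto.mono_left nhdsWithin_le_nhds)).congr fun t => ?_
  simp only [slope, vsub_eq_sub, h0, zero_mul, sub_zero, smul_mul_assoc]

namespace IsStationaryNLS

variable {φ ψ : ℝ → ℂ} {w : ℝ → ℝ} {ω c E T : ℝ} {u : ℂ}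

theorem isFloquetMul (h : IsStationaryNLS φ ψ w ω c E T u) {ζ Ω : ℂ} (hΩ : Ω ≠ 0)
    (hQ : Ω ^ 2 = laxQ ω c E ζ) :
    IsFloquetMul φ ψ w ω T u ζ Ω (floquetMul φ ψ w ω T u ζ Ω) :=
  Classical.epsilon_spec (h.exists_isFloquetMul hΩ hQ)

theorem shift_ne_zero (h : IsStationaryNLS φ ψ w ω c E T u) : u ≠ 0 := by
  have := h.norm_shift
  rintro rfl
  simp at this

theorem floquetMul_mul_neg (h : IsStationaryNLS φ ψ w ω c E T u) {ζ Ω : ℂ} (hΩ : Ω ≠ 0)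
    (hQ : Ω ^ 2 = laxQ ω c E ζ) :
    floquetMul φ ψ w ω T u ζ Ω * floquetMul φ ψ w ω T u ζ (-Ω) = u :=
  mul_floquetMul hΩ (h.isFloquetMul hΩ hQ)
    (h.isFloquetMul (neg_ne_zero.2 hΩ) (by rw [neg_sq, hQ]))

theorem floquetMul_ne_zero (h : IsStationaryNLS φ ψ w ω c E T u) {ζ Ω : ℂ} (hΩ : Ω ≠ 0)
    (hQ : Ω ^ 2 = laxQ ω c E ζ) : floquetMul φ ψ w ω T u ζ Ω ≠ 0 := fun h0 => h.shift_ne_zero <| by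
  rw [← h.floquetMul_mul_neg hΩ hQ, h0, zero_mul]

theorem floquetMul_unique (h : IsStationaryNLS φ ψ w ω c E T u) {ζ Ω m : ℂ} (hΩ : Ω ≠ 0)
    (hQ : Ω ^ 2 = laxQ ω c E ζ) (hm : IsFloquetMul φ ψ w ω T u ζ Ω m) :
    m = floquetMul φ ψ w ω T u ζ Ω := by
  have h1 := h.isFloquetMul (neg_ne_zero.2 hΩ) (by rw [neg_sq, hQ])
  have h2 := mul_floquetMul hΩ hm h1
  exact mul_right_cancel₀ (h.floquetMul_ne_zero (neg_ne_zero.2 hΩ) (by rw [neg_sq, hQ]))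
    (h2.trans (h.floquetMul_mul_neg hΩ hQ).symm)

theorem continuousAt_laxFlow_integral (h : IsStationaryNLS φ ψ w ω c E T u) {v : ℝ → ℂ × ℂ}
    (hv : Continuous v) (p : ℂ × ℂ) :
    Continuous fun ζ => ∫ x in (0 : ℝ)..T, ((v x).1 * (laxFlow φ p (ζ, x)).2
      + (v x).2 * (laxFlow φ p (ζ, x)).1) := by
  apply intervalIntegral.continuous_parametric_intervalIntegral_of_continuous _ continuous_const
  have h1 : Continuous fun z : ℂ × ℝ => laxFlow φ p (z.1, z.2) :=
    continuous_laxFlow h.norm_le_one h.continuous p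
  have h2 : Continuous fun z : ℂ × ℝ => v z.2 := hv.comp continuous_snd
  simp only [Function.uncurry_def]
  fun_prop

/-- The logarithmic derivative of the Floquet multiplier along a curve of spectral parameters. -/
theorem hasDerivAt_floquetMul (h : IsStationaryNLS φ ψ w ω c E T u) {ζ Ω : ℝ → ℂ} {ζ' : ℂ} {s₀ : ℝ}
    (hζ : HasDerivAt ζ ζ' s₀) (hΩc : ContinuousAt Ω s₀) (hΩ0 : Ω s₀ ≠ 0)
    (hQ : ∀ s, Ω s ^ 2 = laxQ ω c E (ζ s)) :
    HasDerivAt (fun s => floquetMul φ ψ w ω T u (ζ s) (Ω s))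
      (floquetMul φ ψ w ω T u (ζ s₀) (Ω s₀) *
        (-Complex.I * ζ' / Ω s₀ * ∫ x in (0 : ℝ)..T, laxA w ω (ζ s₀) x)) s₀ := by
  have hQ' : ∀ s, (-Ω s) ^ 2 = laxQ ω c E (ζ s) := fun s => by rw [neg_sq, hQ]
  set m : ℝ → ℂ := fun s => floquetMul φ ψ w ω T u (ζ s) (Ω s) with hm
  obtain ⟨v, hv, hv0, hve, hvm⟩ := h.isFloquetMul (neg_ne_zero.2 hΩ0) (hQ' s₀)
  set n := floquetMul φ ψ w ω T u (ζ s₀) (-Ω s₀) with hn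
  -- `M + Ω` has trace `2Ω ≠ 0` at `s₀`, so it is nonzero there. Applying it to a fixed vector `a`
  -- gives an eigenvector depending continuously on `s`.
  obtain ⟨a, ha⟩ : ∃ a : ℂ × ℂ, ((laxA w ω (ζ s₀) 0 + Ω s₀) * a.1 + laxB φ ψ (ζ s₀) 0 * a.2,
      laxC φ ψ (ζ s₀) 0 * a.1 + (Ω s₀ - laxA w ω (ζ s₀) 0) * a.2) ≠ ((0, 0) : ℂ × ℂ) := by
    by_contra hcon
    push Not at hcon
    have h1 := congrArg Prod.fst (hcon (1, 0))
    have h2 := congrArg Prod.snd (hcon (0, 1))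
    simp only [mul_one, mul_zero, add_zero, zero_add] at h1 h2
    have : 2 * Ω s₀ = 0 := by linear_combination h1 + h2
    exact (mul_ne_zero two_ne_zero hΩ0) this
  set p : ℝ → ℂ × ℂ := fun s => ((laxA w ω (ζ s) 0 + Ω s) * a.1 + laxB φ ψ (ζ s) 0 * a.2,
      laxC φ ψ (ζ s) 0 * a.1 + (Ω s - laxA w ω (ζ s) 0) * a.2) with hp
  have hζc := hζ.continuousAt
  have hpc : ContinuousAt p s₀ := by
    simp only [hp, laxA, laxB, laxC]
    fun_prop
  have hpe : ∀ s, IsLaxEig φ ψ w ω (ζ s) (Ω s) 0 (p s) := fun s => by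
    have := (hQ s).trans (h.laxA_sq_add (ζ s) 0).symm
    constructor
    · simp only [hp]; linear_combination -a.1 * this
    · simp only [hp]; linear_combination -a.2 * this
  set f : ℝ → ℝ → ℂ × ℂ := fun s x => laxFlow φ (1, 0) (ζ s, x) with hf
  set g : ℝ → ℝ → ℂ × ℂ := fun s x => laxFlow φ (0, 1) (ζ s, x) with hg
  set z : ℝ → ℝ → ℂ × ℂ := fun s x => (p s).1 • f s x + (p s).2 • g s x with hz
  have hfs : ∀ s, IsLaxSol φ (ζ s) (f s) := fun s =>
    isLaxSol_laxFlow h.norm_le_one h.continuous (1, 0) (ζ s)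
  have hgs : ∀ s, IsLaxSol φ (ζ s) (g s) := fun s =>
    isLaxSol_laxFlow h.norm_le_one h.continuous (0, 1) (ζ s)
  have hzs : ∀ s, IsLaxSol φ (ζ s) (z s) := fun s => ((hfs s).smul _).add ((hgs s).smul _)
  have hz0 : ∀ s, z s 0 = p s := fun s => by
    simp only [hz, hf, hg, laxFlow_zero]
    ext <;> simp
  have hze : ∀ s x, IsLaxEig φ ψ w ω (ζ s) (Ω s) x (z s x) := fun s =>
    h.isLaxEig_of_zero (hzs s) (by rw [hz0]; exact hpe s)
  have hpne : ∀ᶠ s in nhds s₀, p s ≠ 0 := hpc.eventually_ne ha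
  have hΩne : ∀ᶠ s in nhds s₀, Ω s ≠ 0 := hΩc.eventually_ne hΩ0
  have hzm : ∀ s, p s ≠ 0 → Ω s ≠ 0 → ∀ x, (((z s (x + T)).1, u * (z s (x + T)).2) : ℂ × ℂ)
      = m s • z s x := fun s hs hs' => by
    obtain ⟨μ, hμ⟩ := h.exists_multiplier hs' (hzs s) (by rwa [hz0]) (hze s)
    have : μ = m s := h.floquetMul_unique hs' (hQ s) ⟨z s, hzs s, by rwa [hz0], hze s, hμ⟩
    rwa [this] at hμ
  set K : ℝ → ℂ := fun s => ∫ x in (0 : ℝ)..T, ((v x).1 * (z s x).2 + (v x).2 * (z s x).1) with hK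
  have hfl : ∀ q : ℂ × ℂ, ∀ s, Continuous fun x : ℝ => laxFlow φ q (ζ s, x) := fun q s =>
    (continuous_laxFlow h.norm_le_one h.continuous q).comp (by fun_prop)
  have hvc := hv.continuous
  have hKc : ContinuousAt K s₀ := by
    have h1 := (h.continuousAt_laxFlow_integral hv.continuous (1, 0)).continuousAt.comp hζc
    have h2 := (h.continuousAt_laxFlow_integral hv.continuous (0, 1)).continuousAt.comp hζc
    refine ((hpc.fst.mul h1).add (hpc.snd.mul h2)).congr (Filter.Eventually.of_forall fun s => ?_)
    have c1 := hfl (1, 0) s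
    have c2 := hfl (0, 1) s
    simp only [hK, Pi.add_apply, Pi.mul_apply, Function.comp_apply]
    rw [← intervalIntegral.integral_const_mul, ← intervalIntegral.integral_const_mul,
      ← intervalIntegral.integral_add]
    · congr 1
      funext x
      simp only [hz, hf, hg, Prod.fst_add, Prod.snd_add, Prod.smul_fst, Prod.smul_snd, smul_eq_mul]
      ring
    · exact Continuous.intervalIntegrable (by fun_prop) _ _
    · exact Continuous.intervalIntegrable (by fun_prop) _ _
  have hW0 : wronskian (v 0) (p s₀) ≠ 0 := by
    have := wronskian_ne_zero hΩ0 ha hv0 (hpe s₀) (hve 0)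
    intro h0
    apply this
    rw [wronskian] at h0 ⊢
    linear_combination -h0
  have hWc : ContinuousAt (fun s => wronskian (v 0) (p s)) s₀ := by
    unfold wronskian
    fun_prop
  -- Pair the fixed solution `v` for `(ζ s₀, -Ω s₀)` with the moving one for `(ζ s, Ω s)` and
  -- integrate the derivative of their Wronskian over a period.
  have hinc : ∀ s, wronskian (v T) (z s T) - wronskian (v 0) (p s)
      = Complex.I * (ζ s - ζ s₀) * K s := fun s => by
    have hcz := (hzs s).continuous
    rw [hK, ← intervalIntegral.integral_const_mul, ← hz0 s]
    refine (intervalIntegral.integral_eq_sub_of_hasDerivAt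
      (fun x _ => hasDerivAt_wronskian hv (hzs s) x) ?_).symm
    exact Continuous.intervalIntegrable (by fun_prop) _ _
  have hnm : n * m s₀ = u := by
    rw [mul_comm]
    exact h.floquetMul_mul_neg hΩ0 (hQ s₀)
  have hm0 : m s₀ ≠ 0 := h.floquetMul_ne_zero hΩ0 (hQ s₀)
  -- An exact difference formula: `u` times the Wronskian at `T` is `n m(s)` times that at `0`, and
  -- `n m(s₀) = u`.
  have hformula : ∀ᶠ s in nhds s₀, m s = m s₀ + m s₀ * ((Complex.I * (ζ s - ζ s₀)) *
      (K s / wronskian (v 0) (p s))) := by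
    filter_upwards [hpne, hΩne, hWc.eventually_ne hW0] with s h1 h2 h3
    have h4 := hinc s
    have a0 := hvm 0
    have b0 := hzm s h1 h2 0
    rw [zero_add] at a0 b0
    have a1 := congrArg Prod.fst a0
    have a2 := congrArg Prod.snd a0
    have b1 := congrArg Prod.fst b0
    have b2 := congrArg Prod.snd b0
    simp only [hz0, Prod.smul_fst, Prod.smul_snd, smul_eq_mul] at a1 a2 b1 b2
    have key : u * wronskian (v T) (z s T) = n * m s * wronskian (v 0) (p s) := by
      rw [wronskian, wronskian]
      linear_combination n * (v 0).1 * b2 - n * (v 0).2 * b1 + u * (z s T).2 * a1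
        - (z s T).1 * a2
    have hn0 : n ≠ 0 := by
      rintro h0
      rw [h0, zero_mul] at hnm
      exact h.shift_ne_zero hnm.symm
    field_simp
    apply mul_left_cancel₀ hn0
    linear_combination -key + u * h4 - (wronskian (v 0) (p s)
      + (Complex.I * (ζ s - ζ s₀)) * K s) * hnm
  -- At `s₀` the eigenvalue equations for `-Ω` and `Ω` combine to `v₁ z₂ + v₂ z₁ = -A W / Ω`, where
  -- the Wronskian `W` is constant in `x`.
  have hK0 : K s₀ = -(wronskian (v 0) (p s₀) / Ω s₀ * ∫ x in (0 : ℝ)..T, laxA w ω (ζ s₀) x) := by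
    rw [hK, ← intervalIntegral.integral_const_mul, ← intervalIntegral.integral_neg]
    refine intervalIntegral.integral_congr fun x _ => ?_
    obtain ⟨e1, e2⟩ := hve x
    obtain ⟨e3, e4⟩ := hze s₀ x
    have e5 := wronskian_eq_zero_eq hv (hzs s₀) x
    rw [hz0] at e5
    simp only [← e5]
    rw [wronskian]
    field_simp
    linear_combination (z s₀ x).2 * e1 - (v x).2 * e3
  have hd : HasDerivAt (fun s => Complex.I * (ζ s - ζ s₀)) (Complex.I * ζ') s₀ :=
    (hζ.sub_const _).const_mul _
  have hd2 := (hd.mul_of_zero (by simp) (hKc.div hWc hW0)).const_mul (m s₀) |>.const_add (m s₀)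
  refine (hd2.congr_of_eventuallyEq hformula).congr_deriv ?_
  simp only [Pi.div_apply]
  rw [hK0]
  simp only [hm]
  field_simp

/-- For real spectral parameter the spatial matrix is skew-Hermitian, so `|v₁|² + |v₂|²` is
conserved. -/
theorem bounded_of_real (x₀ : ℝ) {v : ℝ → ℂ × ℂ} (hv : IsLaxSol φ x₀ v) :
    ∃ M, ∀ x, ‖v x‖ ≤ M := by
  have hd : ∀ x, HasDerivAt (fun x => (v x).1 * conj (v x).1 + (v x).2 * conj (v x).2) 0 x := by
    intro x
    have c1 : HasDerivAt (fun t => conj (v t).1) _ x :=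
      Complex.conjCLE.toContinuousLinearMap.hasFDerivAt.comp_hasDerivAt x (hv.fst x)
    have c2 : HasDerivAt (fun t => conj (v t).2) _ x :=
      Complex.conjCLE.toContinuousLinearMap.hasFDerivAt.comp_hasDerivAt x (hv.snd x)
    refine (((hv.fst x).mul c1).add ((hv.snd x).mul c2)).congr_deriv ?_
    simp
    ring
  have hconst : ∀ x, (v x).1 * conj (v x).1 + (v x).2 * conj (v x).2
      = (v 0).1 * conj (v 0).1 + (v 0).2 * conj (v 0).2 := fun x =>
    is_const_of_deriv_eq_zero (fun t => (hd t).differentiableAt) (fun t => (hd t).deriv) x 0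
  simp only [Complex.mul_conj, Complex.normSq_eq_norm_sq] at hconst
  refine ⟨1 + (‖(v 0).1‖ ^ 2 + ‖(v 0).2‖ ^ 2), fun x => ?_⟩
  have hx : ‖(v x).1‖ ^ 2 + ‖(v x).2‖ ^ 2 = ‖(v 0).1‖ ^ 2 + ‖(v 0).2‖ ^ 2 := by
    exact_mod_cast hconst x
  rw [Prod.norm_def, max_le_iff, ← hx]
  constructor <;> nlinarith [norm_nonneg (v x).1, norm_nonneg (v x).2,
    sq_nonneg (‖(v x).1‖ - 1), sq_nonneg (‖(v x).2‖ - 1)]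

theorem norm_floquetMul_real (h : IsStationaryNLS φ ψ w ω c E T u) (x₀ : ℝ) {Ω : ℂ} (hΩ : Ω ≠ 0)
    (hQ : Ω ^ 2 = laxQ ω c E x₀) : ‖floquetMul φ ψ w ω T u x₀ Ω‖ = 1 := by
  obtain ⟨v, hv, h0, -, hm⟩ := h.isFloquetMul hΩ hQ
  obtain ⟨M, hM⟩ := bounded_of_real x₀ hv
  exact h.norm_eq_one_of_bounded h0 hm hM

/-- At a nonreal zero of `Ω`, the joint solution of the Lax pair is bounded. -/
theorem bounded_of_root (h : IsStationaryNLS φ ψ w ω c E T u) (hw0 : w 0 ≠ 0) {ζ : ℂ}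
    (hζ : ζ.im ≠ 0) (hQ : laxQ ω c E ζ = 0) {v : ℝ → ℂ × ℂ} (hv : IsLaxSol φ ζ v) (h0 : v 0 ≠ 0)
    (he : ∀ x, IsLaxEig φ ψ w ω ζ 0 x (v x)) : ∃ M, ∀ x, ‖v x‖ ≤ M := by
  obtain ⟨p, hp⟩ : ∃ p : ℂ × ℂ, wronskian (v 0) p = 1 := by
    by_cases h1 : (v 0).1 = 0
    · have h2 : (v 0).2 ≠ 0 := fun h2 => h0 (Prod.ext h1 h2)
      exact ⟨(-1 / (v 0).2, 0), by simp [wronskian]; field_simp⟩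
    · exact ⟨(0, 1 / (v 0).1), by simp [wronskian, h1]⟩
  set f : ℝ → ℂ × ℂ := fun x => laxFlow φ p (ζ, x) with hf
  have hfs : IsLaxSol φ ζ f := isLaxSol_laxFlow h.norm_le_one h.continuous p ζ
  have hW : ∀ x, wronskian (v x) (f x) = 1 := fun x => by
    rw [wronskian_eq_zero_eq hv hfs x, hf]
    simp only [laxFlow_zero, hp]
  have hT := h.isLaxSol_temporal hfs
  set A := laxA w ω ζ
  set B := laxB φ ψ ζ
  set C := laxC φ ψ ζ
  set g : ℝ → ℂ × ℂ := fun x => (A x * (f x).1 + B x * (f x).2, C x * (f x).1 - A x * (f x).2)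
  have hnil : ∀ x, A x ^ 2 + B x * C x = 0 := fun x => (h.laxA_sq_add ζ x).trans hQ
  -- `M` is nilpotent with `v` in its kernel, so it maps the complementary solution `f` to a
  -- multiple `l v`. Hence `B = l v₁²` and `C = -l v₂²`, and the boundedness of `B` and `C` passes
  -- to `v`, provided `l ≠ 0`.
  obtain ⟨l, hl⟩ : ∃ l : ℂ, g 0 = l • v 0 := by
    refine exists_smul_of_wronskian_eq_zero h0 ?_
    obtain ⟨e1, e2⟩ := he 0
    rw [zero_mul] at e1 e2
    simp only [wronskian, g]
    linear_combination (-(f 0).2) * e1 + (f 0).1 * e2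
  have hg : ∀ x, g x = l • v x :=
    hT.eq_of_zero h.norm_le_one h.continuous (hv.smul l) hl
  have hB : ∀ x, B x = l * (v x).1 ^ 2 := fun x => by
    have e1 := congrArg Prod.fst (hg x)
    have e3 := hW x
    obtain ⟨e4, e5⟩ := he x
    simp only [g, Prod.smul_fst, smul_eq_mul] at e1
    rw [wronskian] at e3
    linear_combination -B x * e3 + (v x).1 * e1 - (f x).1 * e4
  have hC : ∀ x, C x = -l * (v x).2 ^ 2 := fun x => by
    have e1 := congrArg Prod.snd (hg x)
    have e3 := hW x
    obtain ⟨e4, e5⟩ := he x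
    simp only [g, Prod.smul_snd, smul_eq_mul] at e1
    rw [wronskian] at e3
    linear_combination -C x * e3 - (v x).2 * e1 + (f x).2 * e5
  -- If `l = 0`, then `B` and `C` vanish at `0`; combining `B` with the conjugate of `C` gives `(ζ -
  -- conj ζ) φ(0) = 0`, which is impossible here.
  have hlne : l ≠ 0 := by
    rintro rfl
    have b0 : ζ * φ 0 + Complex.I / 2 * ψ 0 = 0 := (hB 0).trans (by simp)
    have c0 : -ζ * conj (φ 0) + Complex.I / 2 * conj (ψ 0) = 0 := (hC 0).trans (by simp)
    have c1 := congrArg conj c0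
    simp only [map_add, map_mul, map_neg, Complex.conj_conj, map_div₀, Complex.conj_I,
      Complex.conj_ofNat, map_zero] at c1
    have e : (ζ - conj ζ) * φ 0 = 0 := by linear_combination b0 + c1
    have hne : ζ - conj ζ ≠ 0 := by
      rw [Complex.sub_conj]
      simp [hζ]
    have hφ0 := (mul_eq_zero.1 e).resolve_left hne
    have := h.norm_sq 0
    rw [hφ0] at this
    simp at this
    exact hw0 this.symm
  have hBb : ∃ M, ∀ x, ‖φ x‖ ≤ M ∧ ‖ψ x‖ ≤ M := by
    refine ⟨1 + (|E| + 1), fun x => ⟨(h.norm_le_one x).trans (by linarith [abs_nonneg E]), ?_⟩⟩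
    have := h.energy x
    rw [Complex.mul_conj, Complex.normSq_eq_norm_sq] at this
    have this' : ‖ψ x‖ ^ 2 = E - (w x + ω) ^ 2 := by exact_mod_cast this
    nlinarith [sq_nonneg (w x + ω), sq_nonneg (‖ψ x‖ - 1), le_abs_self E, norm_nonneg (ψ x)]
  obtain ⟨M, hM⟩ := hBb
  have hM0 : 0 ≤ M := (norm_nonneg _).trans (hM 0).1
  have hlpos := norm_pos_iff.2 hlne
  have hbd : ∀ y : ℂ, ‖l‖ * ‖y‖ ^ 2 ≤ (‖ζ‖ + 1) * M → ‖y‖ ≤ 1 + (‖ζ‖ + 1) * M / ‖l‖ := by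
    intro y hy
    have : ‖y‖ ^ 2 ≤ (‖ζ‖ + 1) * M / ‖l‖ := by
      rw [le_div_iff₀ hlpos]; linarith
    nlinarith [sq_nonneg (‖y‖ - 1), norm_nonneg y]
  refine ⟨1 + (‖ζ‖ + 1) * M / ‖l‖, fun x => ?_⟩
  obtain ⟨m1, m2⟩ := hM x
  have hI : ‖Complex.I / 2‖ = 1 / 2 := by simp
  rw [Prod.norm_def, max_le_iff]
  constructor
  · apply hbd
    rw [← norm_pow, ← norm_mul, ← hB x]
    refine (norm_add_le _ _).trans ?_
    rw [norm_mul, norm_mul, hI]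
    nlinarith [mul_le_mul_of_nonneg_left m1 (norm_nonneg ζ), norm_nonneg (ψ x)]
  · apply hbd
    rw [← norm_pow, ← norm_mul, ← norm_neg, ← neg_mul, ← hC x]
    refine (norm_add_le _ _).trans ?_
    rw [norm_mul, norm_mul, hI, norm_neg, RCLike.norm_conj, RCLike.norm_conj]
    nlinarith [mul_le_mul_of_nonneg_left m1 (norm_nonneg ζ), norm_nonneg (ψ x)]

end IsStationaryNLS

/-! ### The Lax spectrum in terms of Floquet multipliers, and its conjugation symmetry. -/

namespace IsStationaryNLS

variable {φ ψ : ℝ → ℂ} {w : ℝ → ℝ} {ω c E T : ℝ} {u : ℂ}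

theorem laxT_eq (h : IsStationaryNLS φ ψ w ω c E T u) (ζ : ℂ) (x : ℝ) :
    laxT φ ω ζ x = !![laxA w ω ζ x, laxB φ ψ ζ x; laxC φ ψ ζ x, -laxA w ω ζ x] := by
  have h1 : ((‖φ x‖ : ℂ)) ^ 2 = (w x : ℂ) := by exact_mod_cast h.norm_sq x
  simp only [laxT, laxA, laxB, laxC, (h.hasDerivAt x).deriv, h1]

theorem mem_laxSpectrum_iff (h : IsStationaryNLS φ ψ w ω c E T u) (ζ : ℂ) :
    ζ ∈ laxSpectrum φ ω ↔ ∃ (Ω : ℂ) (v : ℝ → ℂ × ℂ), v 0 ≠ 0 ∧ (∃ M, ∀ x, ‖v x‖ ≤ M) ∧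
      IsLaxSol φ ζ v ∧ ∀ x, IsLaxEig φ ψ w ω ζ Ω x (v x) := by
  constructor
  · rintro ⟨Ω, v, hv0, ⟨M, hM⟩, hd, he⟩
    have hsol : IsLaxSol φ ζ fun x => (v x 0, v x 1) := by
      apply isLaxSol_mk
      · intro x
        refine (hasDerivAt_pi.1 (hd x) 0).congr_deriv ?_
        simp [laxX, Matrix.mulVec, dotProduct, Fin.sum_univ_two]
      · intro x
        refine (hasDerivAt_pi.1 (hd x) 1).congr_deriv ?_
        simp [laxX, Matrix.mulVec, dotProduct, Fin.sum_univ_two]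
    obtain ⟨x, hx⟩ := Function.ne_iff.1 hv0
    refine ⟨Ω, _, h.ne_zero_of_ne_zero hsol (x := x) ?_, ⟨M, fun x => ?_⟩, hsol, fun x => ?_⟩
    · intro h0
      obtain ⟨h1, h2⟩ := Prod.mk_eq_zero.1 h0
      apply hx
      funext i
      fin_cases i
      · exact h1
      · exact h2
    · rw [Prod.norm_mk]
      exact max_le ((norm_le_pi_norm (v x) 0).trans (hM x)) ((norm_le_pi_norm (v x) 1).trans (hM x))
    · have := he x
      rw [h.laxT_eq] at this
      have h1 := congrFun this 0
      have h2 := congrFun this 1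
      simp [Matrix.mulVec, dotProduct, Fin.sum_univ_two] at h1 h2
      exact ⟨h1, by rw [← h2]; ring⟩
  · rintro ⟨Ω, v, hv0, ⟨M, hM⟩, hsol, he⟩
    refine ⟨Ω, fun x => ![(v x).1, (v x).2], ?_, ⟨M, fun x => ?_⟩, fun x => ?_, fun x => ?_⟩
    · intro h0
      have h1 := congrFun h0 0
      have h2 := congrFun h1 0
      have h3 := congrFun h1 1
      exact hv0 (Prod.ext (by simpa using h2) (by simpa using h3))
    · have hM0 : 0 ≤ M := (norm_nonneg _).trans (hM x)
      rw [pi_norm_le_iff_of_nonneg hM0]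
      intro i
      fin_cases i
      · exact (norm_fst_le (v x)).trans (hM x)
      · exact (norm_snd_le (v x)).trans (hM x)
    · rw [hasDerivAt_pi]
      intro i
      fin_cases i
      · refine (hsol.fst x).congr_deriv ?_
        simp [laxX, Matrix.mulVec, dotProduct, Fin.sum_univ_two]
      · refine (hsol.snd x).congr_deriv ?_
        simp [laxX, Matrix.mulVec, dotProduct, Fin.sum_univ_two]
    · rw [h.laxT_eq]
      obtain ⟨e1, e2⟩ := he x
      funext i
      fin_cases i
      · simpa [Matrix.mulVec, dotProduct, Fin.sum_univ_two] using e1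
      · simp [Matrix.mulVec, dotProduct, Fin.sum_univ_two]
        rw [← e2]; ring

theorem real_mem_laxSpectrum (h : IsStationaryNLS φ ψ w ω c E T u) (x₀ : ℝ) :
    (x₀ : ℂ) ∈ laxSpectrum φ ω := by
  obtain ⟨Ω, hΩ⟩ := IsAlgClosed.exists_pow_nat_eq (laxQ ω c E x₀) two_pos
  obtain ⟨v, hv, h0, he⟩ := h.exists_sol hΩ
  exact (h.mem_laxSpectrum_iff _).2 ⟨Ω, v, h0, bounded_of_real x₀ hv, hv, he⟩

theorem root_mem_laxSpectrum (h : IsStationaryNLS φ ψ w ω c E T u) (hw0 : w 0 ≠ 0) {ζ : ℂ}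
    (hζ : ζ.im ≠ 0) (hQ : laxQ ω c E ζ = 0) : ζ ∈ laxSpectrum φ ω := by
  obtain ⟨v, hv, h0, he⟩ := h.exists_sol (ζ := ζ) (Ω := 0) (by rw [hQ]; ring)
  exact (h.mem_laxSpectrum_iff _).2 ⟨0, v, h0, h.bounded_of_root hw0 hζ hQ hv h0 he, hv, he⟩

theorem mem_laxSpectrum_of_norm_eq_one (h : IsStationaryNLS φ ψ w ω c E T u) {ζ Ω : ℂ}
    (hΩ : Ω ≠ 0) (hQ : Ω ^ 2 = laxQ ω c E ζ) (h1 : ‖floquetMul φ ψ w ω T u ζ Ω‖ = 1) :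
    ζ ∈ laxSpectrum φ ω := by
  obtain ⟨v, hv, h0, he, hm⟩ := h.isFloquetMul hΩ hQ
  exact (h.mem_laxSpectrum_iff _).2
    ⟨Ω, v, h0, h.bounded_of_norm_eq_one hv.continuous hm h1, hv, he⟩

theorem exists_norm_eq_one_of_mem (h : IsStationaryNLS φ ψ w ω c E T u) {ζ : ℂ}
    (hζ : ζ ∈ laxSpectrum φ ω) : ∃ Ω : ℂ, Ω ^ 2 = laxQ ω c E ζ ∧
      (Ω ≠ 0 → ‖floquetMul φ ψ w ω T u ζ Ω‖ = 1) := by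
  obtain ⟨Ω, v, h0, ⟨M, hM⟩, hv, he⟩ := (h.mem_laxSpectrum_iff _).1 hζ
  have hQ := h.sq_eq_of_isLaxEig h0 (he 0)
  refine ⟨Ω, hQ, fun hΩ => ?_⟩
  obtain ⟨m, hm⟩ := h.exists_multiplier hΩ hv h0 he
  rw [← h.floquetMul_unique hΩ hQ ⟨v, hv, h0, he, hm⟩]
  exact h.norm_eq_one_of_bounded h0 hm hM

/-- The map `(v₁, v₂) ↦ (conj v₂, -conj v₁)` carries joint solutions for `(ζ, Ω)` to joint solutions
for the conjugate pair and preserves boundedness. -/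
theorem conj_mem_laxSpectrum (h : IsStationaryNLS φ ψ w ω c E T u) {ζ : ℂ}
    (hζ : ζ ∈ laxSpectrum φ ω) : conj ζ ∈ laxSpectrum φ ω := by
  rw [h.mem_laxSpectrum_iff] at hζ ⊢
  obtain ⟨Ω, v, h0, ⟨M, hM⟩, hv, he⟩ := hζ
  refine ⟨conj Ω, fun x => (conj (v x).2, -conj (v x).1), ?_, ⟨M, fun x => ?_⟩, ?_, fun x => ?_⟩
  · intro hz
    obtain ⟨h1, h2⟩ := Prod.mk_eq_zero.1 hz
    exact h0 (Prod.ext (by simpa using h2) (by simpa using h1))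
  · rw [Prod.norm_mk, norm_neg, RCLike.norm_conj, RCLike.norm_conj]
    exact max_le ((norm_snd_le (v x)).trans (hM x)) ((norm_fst_le (v x)).trans (hM x))
  · apply isLaxSol_mk
    · intro x
      refine (Complex.conjCLE.toContinuousLinearMap.hasFDerivAt.comp_hasDerivAt x
        (hv.snd x)).congr_deriv ?_
      simp
      ring
    · intro x
      refine (Complex.conjCLE.toContinuousLinearMap.hasFDerivAt.comp_hasDerivAt x
        (hv.fst x)).neg.congr_deriv ?_
      simp
  · obtain ⟨e1, e2⟩ := he x
    have c1 := congrArg conj e1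
    have c2 := congrArg conj e2
    simp only [map_add, map_sub, map_mul, map_neg, map_pow, map_div₀, Complex.conj_conj,
      Complex.conj_I, Complex.conj_ofNat, Complex.conj_ofReal, laxA, laxB, laxC] at c1 c2
    constructor
    · simp only [laxA, laxB]
      linear_combination c2
    · simp only [laxA, laxC]
      linear_combination -c1

end IsStationaryNLS
-- The elliptic integral `F` and its behaviour at infinity.
open Filter Topology

/-- The weight `(1 + s²)(1 + s² - k²)` in the elliptic integral `bandIntegral`. -/
def bandWeight (k s : ℝ) : ℝ := (1 + s ^ 2) * (1 + s ^ 2 - k ^ 2)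

/-- The elliptic integral describing the imaginary part of the quasi-momentum on the bands. -/
noncomputable def bandIntegral (k b q : ℝ) : ℝ :=
  ∫ s in (0 : ℝ)..q, (s ^ 2 + 1 - b + ampSqMean k b) / √(bandWeight k s)

theorem sub_sq_pos {k : ℝ} (hk0 : 0 < k) (hk1 : k < 1) (s : ℝ) : 0 < 1 + s ^ 2 - k ^ 2 := by
  nlinarith [sq_nonneg s]

theorem bandWeight_pos {k : ℝ} (hk0 : 0 < k) (hk1 : k < 1) (s : ℝ) : 0 < bandWeight k s :=
  mul_pos (by positivity) (sub_sq_pos hk0 hk1 s)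

theorem continuous_bandIntegrand {k : ℝ} (hk0 : 0 < k) (hk1 : k < 1) (b : ℝ) :
    Continuous fun s : ℝ => (s ^ 2 + 1 - b + ampSqMean k b) / √(bandWeight k s) := by
  refine Continuous.div (by fun_prop) ?_ fun s => (Real.sqrt_pos.2 (bandWeight_pos hk0 hk1 s)).ne'
  unfold bandWeight
  fun_prop

theorem hasDerivAt_bandIntegral {k : ℝ} (hk0 : 0 < k) (hk1 : k < 1) (b q : ℝ) :
    HasDerivAt (bandIntegral k b) ((q ^ 2 + 1 - b + ampSqMean k b) / √(bandWeight k q)) q := by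
  have hc := continuous_bandIntegrand hk0 hk1 b
  exact intervalIntegral.integral_hasDerivAt_right (hc.intervalIntegrable _ _)
    hc.stronglyMeasurable.stronglyMeasurableAtFilter hc.continuousAt

theorem continuous_bandIntegral {k : ℝ} (hk0 : 0 < k) (hk1 : k < 1) (b : ℝ) :
    Continuous (bandIntegral k b) :=
  continuous_iff_continuousAt.2 fun q => (hasDerivAt_bandIntegral hk0 hk1 b q).continuousAt

theorem bandIntegral_zero (k b : ℝ) : bandIntegral k b 0 = 0 := intervalIntegral.integral_same

theorem bandIntegral_neg (k b q : ℝ) : bandIntegral k b (-q) = -bandIntegral k b q := by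
  rw [bandIntegral, bandIntegral, ← intervalIntegral.integral_symm]
  have := intervalIntegral.integral_comp_neg (a := q) (b := 0)
    (fun s : ℝ => (s ^ 2 + 1 - b + ampSqMean k b) / √(bandWeight k s))
  simp only [bandWeight, neg_sq, neg_zero] at this
  exact this.symm

theorem ampSqMean_nonneg {k b : ℝ} (hk0 : 0 < k) (hk1 : k < 1) (hkb : k ^ 2 ≤ b) :
    0 ≤ ampSqMean k b := by
  have hT := jacobiPeriod_pos hk0.le hk1
  refine div_nonneg (intervalIntegral.integral_nonneg hT.le fun x _ => ?_) hT.le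
  have := mul_le_mul_of_nonneg_left (Real.sin_sq_le_one (jacobiAm k x)) (sq_nonneg k)
  rw [ampSq, jacobiSn]; linarith

theorem bandIntegral_nonneg {k b q : ℝ} (hk0 : 0 < k) (hk1 : k < 1) (hkb : k ^ 2 ≤ b) (hb1 : b ≤ 1)
    (hq : 0 ≤ q) : 0 ≤ bandIntegral k b q := by
  refine intervalIntegral.integral_nonneg hq fun s _ => div_nonneg ?_ (Real.sqrt_nonneg _)
  nlinarith [ampSqMean_nonneg hk0 hk1 hkb, sq_nonneg s]

theorem sqrt_bandWeight {k : ℝ} (q : ℝ) :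
    √(bandWeight k q) = (1 + q ^ 2) * √(1 - k ^ 2 * (1 / (1 + q ^ 2))) := by
  have h1 : (0 : ℝ) < 1 + q ^ 2 := by positivity
  have : bandWeight k q = (1 + q ^ 2) ^ 2 * (1 - k ^ 2 * (1 / (1 + q ^ 2))) := by
    rw [bandWeight]; field_simp
  rw [this, Real.sqrt_mul (by positivity), Real.sqrt_sq h1.le]

/-- The elliptic integral `bandIntegral` in terms of the Jacobi zeta function. -/
theorem bandIntegral_eq {k : ℝ} (hk0 : 0 < k) (hk1 : k < 1) (b q : ℝ) :
    bandIntegral k b q = q * √(1 - k ^ 2 * (1 / (1 + q ^ 2)))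
      + ∫ x in (0 : ℝ)..ellipticF k (Real.pi / 2 - Real.arctan q),
        (ampSq k b x - ampSqMean k b) := by
  have hcw : Continuous fun x => ampSq k b x - ampSqMean k b :=
    (continuous_ampSq hk0.le hk1 b).sub continuous_const
  have hm : ∀ q : ℝ, 0 < 1 - k ^ 2 * (1 / (1 + q ^ 2)) := fun q => by
    have h1 : (0 : ℝ) < 1 + q ^ 2 := by positivity
    have : 1 - k ^ 2 * (1 / (1 + q ^ 2)) = (1 + q ^ 2 - k ^ 2) / (1 + q ^ 2) := by field_simp
    rw [this]
    exact div_pos (sub_sq_pos hk0 hk1 q) h1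
  have hd : ∀ q, HasDerivAt (fun q => q * √(1 - k ^ 2 * (1 / (1 + q ^ 2)))
      + ∫ x in (0 : ℝ)..ellipticF k (Real.pi / 2 - Real.arctan q), (ampSq k b x - ampSqMean k b))
      ((q ^ 2 + 1 - b + ampSqMean k b) / √(bandWeight k q)) q := by
    intro q
    have h1 : (0 : ℝ) < 1 + q ^ 2 := by positivity
    have hs := hm q
    have hs' := Real.sqrt_pos.2 hs
    have d1 : HasDerivAt (fun q : ℝ => 1 - k ^ 2 * (1 / (1 + q ^ 2)))
        (k ^ 2 * (2 * q) / (1 + q ^ 2) ^ 2) q := by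
      have := (((hasDerivAt_const q (1 : ℝ)).div (((hasDerivAt_id q).pow 2).const_add 1)
        (by simpa using h1.ne')).const_mul (k ^ 2)).const_sub 1
      refine this.congr_deriv ?_
      simp
      ring
    have d2 := (hasDerivAt_id q).mul (d1.sqrt hs.ne')
    -- This is the substitution `sn² = 1 / (1 + q²)`: at amplitude `π / 2 - arctan q` the sine is
    -- `cos (arctan q)`.
    have d3 : HasDerivAt (fun q => ellipticF k (Real.pi / 2 - Real.arctan q))
        (-(1 / √(bandWeight k q))) q := by
      have := (hasDerivAt_ellipticF hk0.le hk1 (Real.pi / 2 - Real.arctan q)).comp q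
        ((Real.hasDerivAt_arctan q).const_sub (Real.pi / 2))
      refine this.congr_deriv ?_
      rw [Real.sin_pi_div_two_sub, Real.cos_sq_arctan, sqrt_bandWeight]
      field_simp
    have d4 := (intervalIntegral.integral_hasDerivAt_right (hcw.intervalIntegrable 0 _)
      hcw.stronglyMeasurable.stronglyMeasurableAtFilter
      (hcw.continuousAt (x := ellipticF k (Real.pi / 2 - Real.arctan q)))).comp q d3
    refine (d2.add d4).congr_deriv ?_
    have hw : ampSq k b (ellipticF k (Real.pi / 2 - Real.arctan q))
        = b - k ^ 2 * (1 / (1 + q ^ 2)) := by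
      rw [ampSq, jacobiSn, jacobiAm_ellipticF hk0.le hk1, Real.sin_pi_div_two_sub,
        Real.cos_sq_arctan]
    rw [hw, sqrt_bandWeight]
    have hsq := Real.sq_sqrt hs.le
    set m := √(1 - k ^ 2 * (1 / (1 + q ^ 2))) with hmdef
    have hk2 : k ^ 2 * (1 / (1 + q ^ 2)) = 1 - m ^ 2 := by rw [hsq]; ring
    have hk3 : k ^ 2 = (1 - m ^ 2) * (1 + q ^ 2) := by rw [← hk2]; field_simp
    rw [hk2, hk3]
    simp only [id, one_mul]
    field_simp
    ring
  have hdiff : ∀ q, HasDerivAt (fun q => bandIntegral k b q - (q * √(1 - k ^ 2 * (1 / (1 + q ^ 2)))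
      + ∫ x in (0 : ℝ)..ellipticF k (Real.pi / 2 - Real.arctan q),
        (ampSq k b x - ampSqMean k b))) 0 q := fun q =>
    ((hasDerivAt_bandIntegral hk0 hk1 b q).sub (hd q)).congr_deriv (sub_self _)
  -- At `q = 0` the upper limit is half a period, where the integral of `R²` minus its mean
  -- vanishes; so the constant is zero.
  have := is_const_of_deriv_eq_zero (fun t => (hdiff t).differentiableAt)
    (fun t => (hdiff t).deriv) q 0
  simp only [bandIntegral_zero, Real.arctan_zero, sub_zero, zero_mul, zero_add,
    ellipticF_pi_div_two hk0.le hk1, integral_ampSq_half hk0.le hk1] at this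
  linarith

/-- In the form `bandIntegral_eq` the upper limit tends to `0` as `q → ∞`, and the algebraic term
differs from `√τ` by `O(1/q)`. The vanishing limit removes the additive constant from `log |m|²`. -/
theorem tendsto_bandIntegral_sub {k b : ℝ} (hk0 : 0 < k) (hk1 : k < 1) (hkb : k ^ 2 ≤ b)
    (hb1 : b ≤ 1) :
    Tendsto (fun q => bandIntegral k b q - √(q ^ 2 + 1 - b)) atTop (𝓝 0) := by
  have hcw : Continuous fun x => ampSq k b x - ampSqMean k b :=
    (continuous_ampSq hk0.le hk1 b).sub continuous_const
  have h1 : Tendsto (fun q => ∫ x in (0 : ℝ)..ellipticF k (Real.pi / 2 - Real.arctan q),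
      (ampSq k b x - ampSqMean k b)) atTop (𝓝 0) := by
    have ha : Tendsto Real.arctan atTop (𝓝 (Real.pi / 2)) :=
      Real.tendsto_arctan_atTop.mono_right nhdsWithin_le_nhds
    have hF : ContinuousAt (ellipticF k) 0 := (hasDerivAt_ellipticF hk0.le hk1 0).continuousAt
    have hx : Tendsto (fun q => ellipticF k (Real.pi / 2 - Real.arctan q)) atTop (𝓝 0) := by
      have := hF.tendsto.comp (f := fun q => Real.pi / 2 - Real.arctan q)
        (by simpa using ha.const_sub (Real.pi / 2))
      rwa [ellipticF_zero] at this
    have hp : Continuous fun y => ∫ x in (0 : ℝ)..y, (ampSq k b x - ampSqMean k b) :=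
      intervalIntegral.continuous_primitive (fun _ _ => hcw.intervalIntegrable _ _) 0
    simpa [Function.comp_def] using (hp.tendsto 0).comp hx
  have h2 : Tendsto (fun q : ℝ => q * √(1 - k ^ 2 * (1 / (1 + q ^ 2))) - √(q ^ 2 + 1 - b)) atTop
      (𝓝 0) := by
    have hlim : Tendsto (fun q : ℝ => 2 / q) atTop (𝓝 0) := tendsto_const_nhds.div_atTop tendsto_id
    refine squeeze_zero_norm' ?_ hlim
    filter_upwards [eventually_ge_atTop 1] with q hq
    have ha : (0 : ℝ) < 1 + q ^ 2 := by positivity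
    have hm : 0 ≤ 1 - k ^ 2 * (1 / (1 + q ^ 2)) := by
      have : 1 - k ^ 2 * (1 / (1 + q ^ 2)) = (1 + q ^ 2 - k ^ 2) / (1 + q ^ 2) := by field_simp
      rw [this]
      exact (div_pos (sub_sq_pos hk0 hk1 q) ha).le
    have e1 := Real.sq_sqrt hm
    have e2 := Real.sq_sqrt (show 0 ≤ q ^ 2 + 1 - b by nlinarith)
    have e3 : q ≤ √(q ^ 2 + 1 - b) := Real.le_sqrt_of_sq_le (by linarith)
    have e4 := Real.sqrt_nonneg (1 - k ^ 2 * (1 / (1 + q ^ 2)))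
    set m := √(1 - k ^ 2 * (1 / (1 + q ^ 2)))
    set r := √(q ^ 2 + 1 - b)
    have e5 : q ^ 2 * (1 / (1 + q ^ 2)) ≤ 1 := by
      rw [mul_one_div, div_le_one ha]; linarith
    have e6 : 0 ≤ q ^ 2 * (1 / (1 + q ^ 2)) := by positivity
    have hk2 : k ^ 2 ≤ 1 := by nlinarith
    have e7 : (q * m - r) * (q * m + r) = -(k ^ 2 * (q ^ 2 * (1 / (1 + q ^ 2)))) - (1 - b) := by
      linear_combination q ^ 2 * e1 - e2
    have e8 : 0 ≤ k ^ 2 * (q ^ 2 * (1 / (1 + q ^ 2))) := by positivity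
    have e9 : k ^ 2 * (q ^ 2 * (1 / (1 + q ^ 2))) ≤ 1 :=
      mul_le_one₀ hk2 e6 e5
    have e10 : 0 ≤ q * m := by positivity
    have hb0 : 0 ≤ b := (sq_nonneg k).trans hkb
    rw [Real.norm_eq_abs, le_div_iff₀ (by linarith)]
    have e11 : |q * m - r| * (q * m + r) ≤ 2 := by
      rw [← abs_of_nonneg (show 0 ≤ q * m + r by linarith), ← abs_mul, e7, abs_le]
      constructor <;> linarith
    exact (mul_le_mul_of_nonneg_left (by linarith) (abs_nonneg _)).trans e11
  have := h1.add h2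
  rw [add_zero] at this
  refine this.congr fun q => ?_
  rw [bandIntegral_eq hk0 hk1]
  ring

/-! ### The resolvent cubic and the comparison of `F` with `√τ`. -/

/-- The constant coefficient of `-Ω²`. -/
noncomputable def omegaConst (k b : ℝ) : ℝ :=
  (4 * freq k b * b + 3 * b ^ 2 + (1 - k ^ 2) ^ 2) / 16

/-- The constant `C` for which `(ζ² - C) dζ / Ω` is the quasi-momentum differential. -/
noncomputable def quasiConst (k b : ℝ) : ℝ := (freq k b + ampSqMean k b) / 2

/-- The square of the parameter `√τ` at the position `q` on a band. -/
def bandTau (b q : ℝ) : ℝ := q ^ 2 + 1 - b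

theorem bandTau_nonneg {b : ℝ} (hb1 : b ≤ 1) (q : ℝ) : 0 ≤ bandTau b q := by
  rw [bandTau]; nlinarith [sq_nonneg q]

/-- The resolvent cubic of `Ω²`. -/
theorem resolvent_eq {k b c : ℝ} (hc : c ^ 2 = b * (1 - b) * (b - k ^ 2)) (q : ℝ) :
    q ^ 2 * bandWeight k q = bandTau b q * (bandTau b q - freq k b) ^ 2
      - 4 * omegaConst k b * bandTau b q - c ^ 2 := by
  rw [hc, bandWeight, bandTau, omegaConst, freq]
  ring

/-- The polynomial whose sign is that of the derivative of `bandIntegral - √τ`. -/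
noncomputable def bandDisc (k b c t : ℝ) : ℝ :=
  4 * quasiConst k b * t ^ 2 +
    4 * (quasiConst k b ^ 2 - freq k b * quasiConst k b + omegaConst k b) * t + c ^ 2

theorem bandDisc_eq {k b c : ℝ} (hc : c ^ 2 = b * (1 - b) * (b - k ^ 2)) (q : ℝ) :
    bandTau b q * (bandTau b q + ampSqMean k b) ^ 2 - q ^ 2 * bandWeight k q
      = bandDisc k b c (bandTau b q) := by
  rw [resolvent_eq hc, bandDisc, quasiConst]
  ring

theorem continuous_bandTau (b : ℝ) : Continuous (bandTau b) := by
  unfold bandTau; fun_prop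

theorem hasDerivAt_sqrt_bandTau {b q : ℝ} (h : 0 < bandTau b q) :
    HasDerivAt (fun q => √(bandTau b q)) (q / √(bandTau b q)) q := by
  have h1 : HasDerivAt (bandTau b) (2 * q) q := by
    refine ((((hasDerivAt_id q).pow 2).add_const 1).sub_const b).congr_deriv ?_
    simp
  refine (h1.sqrt h.ne').congr_deriv ?_
  have := Real.sqrt_pos.2 h
  field_simp

theorem hasDerivAt_bandIntegral_sub {k b c : ℝ} (hk0 : 0 < k) (hk1 : k < 1) (hkb : k ^ 2 ≤ b)
    (hb1 : b ≤ 1) (hc : c ^ 2 = b * (1 - b) * (b - k ^ 2)) {q : ℝ} (hq : 0 < q) :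
    HasDerivAt (fun q => bandIntegral k b q - √(bandTau b q))
      (bandDisc k b c (bandTau b q) / (√(bandWeight k q) * √(bandTau b q) *
        (√(bandTau b q) * (bandTau b q + ampSqMean k b) + q * √(bandWeight k q)))) q := by
  have ht : 0 < bandTau b q := by rw [bandTau]; nlinarith
  refine ((hasDerivAt_bandIntegral hk0 hk1 b q).sub (hasDerivAt_sqrt_bandTau ht)).congr_deriv ?_
  have hN := Real.sqrt_pos.2 (bandWeight_pos hk0 hk1 q)
  have hr := Real.sqrt_pos.2 ht
  have hW := ampSqMean_nonneg hk0 hk1 hkb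
  have hd : 0 < √(bandTau b q) * (bandTau b q + ampSqMean k b) + q * √(bandWeight k q) := by
    positivity
  have e1 := Real.sq_sqrt ht.le
  have e2 := Real.sq_sqrt (bandWeight_pos hk0 hk1 q).le
  rw [← bandDisc_eq hc, show q ^ 2 + 1 - b = bandTau b q from rfl]
  set r := √(bandTau b q)
  set n := √(bandWeight k q)
  rw [div_sub_div _ _ hN.ne' hr.ne', div_eq_div_iff (by positivity) (by positivity), ← e1, ← e2]
  ring

theorem bandDenom_pos {k b : ℝ} (hk0 : 0 < k) (hk1 : k < 1) (hkb : k ^ 2 ≤ b)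
    (hb1 : b ≤ 1) {q : ℝ} (hq : 0 < q) : 0 < √(bandWeight k q) * √(bandTau b q) *
        (√(bandTau b q) * (bandTau b q + ampSqMean k b) + q * √(bandWeight k q)) := by
  have ht : 0 < bandTau b q := by rw [bandTau]; nlinarith
  have hN := Real.sqrt_pos.2 (bandWeight_pos hk0 hk1 q)
  have hr := Real.sqrt_pos.2 ht
  have hW := ampSqMean_nonneg hk0 hk1 hkb
  positivity

theorem continuous_bandIntegral_sub {k : ℝ} (hk0 : 0 < k) (hk1 : k < 1) (b : ℝ) :
    Continuous fun q => bandIntegral k b q - √(bandTau b q) :=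
  (continuous_bandIntegral hk0 hk1 b).sub (continuous_bandTau b).sqrt

/-- For `C < 0`, `D(t) / t = 4 C t + e + c² / t` is strictly decreasing on `t > 0`. -/
theorem bandDisc_neg_of_le {k b c t₁ t₂ : ℝ} (hC : quasiConst k b < 0) (h1 : 0 < t₁)
    (h12 : t₁ < t₂) (h : bandDisc k b c t₁ ≤ 0) : bandDisc k b c t₂ < 0 := by
  rw [bandDisc] at h ⊢
  set e := 4 * (quasiConst k b ^ 2 - freq k b * quasiConst k b + omegaConst k b)
  have h2 : 0 < t₁ * t₂ * (t₂ - t₁) := mul_pos (mul_pos h1 (h1.trans h12)) (sub_pos.2 h12)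
  have h3 : t₁ * (4 * quasiConst k b * t₂ ^ 2 + e * t₂ + c ^ 2)
      = t₂ * (4 * quasiConst k b * t₁ ^ 2 + e * t₁ + c ^ 2)
        + 4 * quasiConst k b * (t₁ * t₂ * (t₂ - t₁)) - c ^ 2 * (t₂ - t₁) := by ring
  have h4 : t₂ * (4 * quasiConst k b * t₁ ^ 2 + e * t₁ + c ^ 2) ≤ 0 :=
    mul_nonpos_of_nonneg_of_nonpos (h1.trans h12).le h
  have h5 : quasiConst k b * (t₁ * t₂ * (t₂ - t₁)) < 0 := mul_neg_of_neg_of_pos hC h2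
  have h6 : 0 ≤ c ^ 2 * (t₂ - t₁) := mul_nonneg (sq_nonneg c) (sub_pos.2 h12).le
  by_contra hcon
  have := mul_nonneg h1.le (not_lt.1 hcon)
  linarith

/-- If the derivative of `F - √τ` is nonpositive somewhere, then `F > √τ` from there on. -/
theorem sqrt_lt_bandIntegral_of_disc {k b c : ℝ} (hk0 : 0 < k) (hk1 : k < 1) (hkb : k ^ 2 ≤ b)
    (hb1 : b ≤ 1) (hc : c ^ 2 = b * (1 - b) * (b - k ^ 2)) (hC : quasiConst k b < 0) {ξ : ℝ}
    (hξ : 0 < ξ) (hD : bandDisc k b c (bandTau b ξ) ≤ 0) {q : ℝ} (hq : ξ ≤ q) :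
    √(bandTau b q) < bandIntegral k b q := by
  have hanti : StrictAntiOn (fun q => bandIntegral k b q - √(bandTau b q)) (Set.Ici ξ) := by
    refine strictAntiOn_of_deriv_neg (convex_Ici ξ)
      (continuous_bandIntegral_sub hk0 hk1 b).continuousOn fun x hx => ?_
    rw [interior_Ici, Set.mem_Ioi] at hx
    rw [(hasDerivAt_bandIntegral_sub hk0 hk1 hkb hb1 hc (hξ.trans hx)).deriv]
    refine div_neg_of_neg_of_pos (bandDisc_neg_of_le hC (t₁ := bandTau b ξ) ?_ ?_ hD)
      (bandDenom_pos hk0 hk1 hkb hb1 (hξ.trans hx))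
    · rw [bandTau]; nlinarith
    · rw [bandTau, bandTau]; nlinarith
  have h1 : bandIntegral k b (q + 1) - √(bandTau b (q + 1))
      < bandIntegral k b q - √(bandTau b q) :=
    hanti hq (hq.trans (by linarith) : ξ ≤ q + 1) (by linarith)
  -- From `ξ` on, `F - √τ` decreases strictly to its limit `0`. It is therefore nonnegative at `q +
  -- 1` and strictly positive at `q`.
  have h2 : 0 ≤ bandIntegral k b (q + 1) - √(bandTau b (q + 1)) := by
    refine le_of_tendsto (tendsto_bandIntegral_sub hk0 hk1 hkb hb1) ?_
    filter_upwards [eventually_gt_atTop (q + 1)] with x hx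
    exact (hanti (hq.trans (by linarith) : ξ ≤ q + 1)
      (hq.trans (by linarith) : ξ ≤ x) hx).le
  linarith

/-- Once `F` has reached `√τ` it stays above. A return would produce, by the mean value theorem, an
earlier point with nonpositive derivative, and from such a point on `F > √τ`. -/
theorem sqrt_lt_bandIntegral_of_le {k b c : ℝ} (hk0 : 0 < k) (hk1 : k < 1) (hkb : k ^ 2 ≤ b)
    (hb1 : b ≤ 1) (hc : c ^ 2 = b * (1 - b) * (b - k ^ 2)) (hC : quasiConst k b < 0) {a q : ℝ}
    (ha : 0 ≤ a) (haq : a < q) (h : √(bandTau b a) ≤ bandIntegral k b a) :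
    √(bandTau b q) < bandIntegral k b q := by
  by_contra hcon
  obtain ⟨ξ, hξ, hξd⟩ := exists_deriv_eq_slope (fun q => bandIntegral k b q - √(bandTau b q)) haq
    (continuous_bandIntegral_sub hk0 hk1 b).continuousOn fun x hx =>
      (hasDerivAt_bandIntegral_sub hk0 hk1 hkb hb1 hc
        (ha.trans_lt hx.1)).differentiableAt.differentiableWithinAt
  have hξ0 := ha.trans_lt hξ.1
  rw [(hasDerivAt_bandIntegral_sub hk0 hk1 hkb hb1 hc hξ0).deriv] at hξd
  have hle : bandDisc k b c (bandTau b ξ) / (√(bandWeight k ξ) * √(bandTau b ξ) *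
      (√(bandTau b ξ) * (bandTau b ξ + ampSqMean k b) + ξ * √(bandWeight k ξ))) ≤ 0 := by
    rw [hξd]
    exact div_nonpos_of_nonpos_of_nonneg (by linarith) (sub_pos.2 haq).le
  have hD : bandDisc k b c (bandTau b ξ) ≤ 0 := by
    by_contra hD
    exact absurd hle (not_le.2 (div_pos (not_le.1 hD) (bandDenom_pos hk0 hk1 hkb hb1 hξ0)))
  exact hcon (sqrt_lt_bandIntegral_of_disc hk0 hk1 hkb hb1 hc hC hξ0 hD hξ.2.le)

/-- Here `F - √τ` increases strictly to its limit `0`, so it is negative throughout. -/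
theorem bandIntegral_lt_sqrt_of_disc_pos {k b c : ℝ} (hk0 : 0 < k) (hk1 : k < 1) (hkb : k ^ 2 ≤ b)
    (hb1 : b ≤ 1) (hc : c ^ 2 = b * (1 - b) * (b - k ^ 2)) (hD : ∀ t, 0 < t → 0 < bandDisc k b c t)
    {q : ℝ} (hq : 0 ≤ q) : bandIntegral k b q < √(bandTau b q) := by
  have hmono : StrictMonoOn (fun q => bandIntegral k b q - √(bandTau b q)) (Set.Ici 0) := by
    refine strictMonoOn_of_deriv_pos (convex_Ici 0)
      (continuous_bandIntegral_sub hk0 hk1 b).continuousOn fun x hx => ?_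
    rw [interior_Ici, Set.mem_Ioi] at hx
    rw [(hasDerivAt_bandIntegral_sub hk0 hk1 hkb hb1 hc hx).deriv]
    refine div_pos (hD _ ?_) (bandDenom_pos hk0 hk1 hkb hb1 hx)
    rw [bandTau]; nlinarith
  have h1 : bandIntegral k b q - √(bandTau b q)
      < bandIntegral k b (q + 1) - √(bandTau b (q + 1)) :=
    hmono hq (by simp; linarith : q + 1 ∈ Set.Ici 0) (by linarith)
  have h2 : bandIntegral k b (q + 1) - √(bandTau b (q + 1)) ≤ 0 := by
    refine ge_of_tendsto (tendsto_bandIntegral_sub hk0 hk1 hkb hb1) ?_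
    filter_upwards [eventually_gt_atTop (q + 1)] with x hx
    exact (hmono (by simp; linarith : q + 1 ∈ Set.Ici 0)
      (by simp; linarith : x ∈ Set.Ici 0) hx).le
  linarith

/-- For `C < 0` and `b < 1` the inequality `F ≤ √τ` holds exactly on an interval `[0, q₀]`. -/
theorem exists_bandIntegral_eq_sqrt {k b c : ℝ} (hk0 : 0 < k) (hk1 : k < 1) (hkb : k ^ 2 ≤ b)
    (hb1 : b < 1) (hc : c ^ 2 = b * (1 - b) * (b - k ^ 2)) (hC : quasiConst k b < 0) :
    ∃ q₀, 0 < q₀ ∧ bandIntegral k b q₀ = √(bandTau b q₀) ∧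
      ∀ q, 0 ≤ q → (bandIntegral k b q ≤ √(bandTau b q) ↔ q ≤ q₀) := by
  have hbig : ∃ ξ : ℝ, 0 < ξ ∧ bandDisc k b c (bandTau b ξ) ≤ 0 := by
    set e := 4 * (quasiConst k b ^ 2 - freq k b * quasiConst k b + omegaConst k b) with he
    set C := quasiConst k b with hCdef
    have hC' : 0 < -C := neg_pos.2 hC
    have hX : 0 ≤ (|e| + c ^ 2) / (-C) := div_nonneg (by positivity) hC'.le
    set X := (|e| + c ^ 2) / (-C) with hXdef
    have hXe : X * (-C) = |e| + c ^ 2 := div_mul_cancel₀ _ hC'.ne'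
    -- `X` is chosen so that for `τ ≥ 1 + X` the term `4 C τ²` dominates the two lower terms of the
    -- quadratic.
    refine ⟨1 + X, by linarith, ?_⟩
    have ht : 1 + X ≤ bandTau b (1 + X) := by rw [bandTau]; nlinarith
    set t := bandTau b (1 + X)
    rw [bandDisc, ← he, ← hCdef]
    have h1 : e * t ≤ |e| * t := mul_le_mul_of_nonneg_right (le_abs_self e) (by linarith)
    have h2 : c ^ 2 ≤ c ^ 2 * t := le_mul_of_one_le_right (sq_nonneg c) (by linarith)
    have h3 : |e| + c ^ 2 ≤ -C * t := by nlinarith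
    have h4 : (|e| + c ^ 2) * t ≤ -C * t * t := mul_le_mul_of_nonneg_right h3 (by linarith)
    nlinarith [mul_nonneg hC'.le (sq_nonneg t)]
  obtain ⟨ξ, hξ, hD⟩ := hbig
  have hpos := sqrt_lt_bandIntegral_of_disc hk0 hk1 hkb hb1.le hc hC hξ hD le_rfl
  have h0 : bandIntegral k b 0 - √(bandTau b 0) < 0 := by
    rw [bandIntegral_zero, zero_sub, neg_lt_zero]
    exact Real.sqrt_pos.2 (by rw [bandTau]; linarith)
  obtain ⟨q₀, hq₀, hz⟩ := intermediate_value_Ioo hξ.le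
    (continuous_bandIntegral_sub hk0 hk1 b).continuousOn ⟨h0, sub_pos.2 hpos⟩
  refine ⟨q₀, hq₀.1, sub_eq_zero.1 hz, fun q hq => ⟨fun h => ?_, fun h => ?_⟩⟩
  · by_contra hcon
    exact absurd (sqrt_lt_bandIntegral_of_le hk0 hk1 hkb hb1.le hc hC hq₀.1.le (not_le.1 hcon)
      (sub_eq_zero.1 hz).ge) (not_lt.2 h)
  · rcases h.eq_or_lt with rfl | h
    · exact (sub_eq_zero.1 hz).le
    · by_contra hcon
      exact absurd (sqrt_lt_bandIntegral_of_le hk0 hk1 hkb hb1.le hc hC hq h (not_le.1 hcon).le)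
        (not_lt.2 (sub_eq_zero.1 hz).le)

/-- The roots of `Ω` are `α ± i β₁` and `-α ± i β₂`. -/
theorem exists_root_parameters {k b c : ℝ} (hk0 : 0 < k) (hk1 : k < 1) (hkb : k ^ 2 ≤ b)
    (hb1 : b ≤ 1) (hc : c ^ 2 = b * (1 - b) * (b - k ^ 2)) :
    ∃ α β₁ β₂ : ℝ, 0 ≤ α ∧ 0 < β₁ ∧ 0 < β₂ ∧ (α = 0 → β₁ < β₂) ∧ 4 * α ^ 2 = 1 - b ∧
      freq k b = 2 * α ^ 2 - β₁ ^ 2 - β₂ ^ 2 ∧ c = 2 * α * (β₂ ^ 2 - β₁ ^ 2) ∧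
      omegaConst k b = (α ^ 2 + β₁ ^ 2) * (α ^ 2 + β₂ ^ 2) := by
  have hb0 : 0 < b := (by positivity : 0 < k ^ 2).trans_le hkb
  have ha := Real.sq_sqrt (sub_nonneg.2 hb1)
  have hs := Real.sq_sqrt hb0.le
  have hr := Real.sq_sqrt (sub_nonneg.2 hkb)
  have ha0 := Real.sqrt_nonneg (1 - b)
  have hs0 := Real.sqrt_pos.2 hb0
  have hr0 := Real.sqrt_nonneg (b - k ^ 2)
  have hlt : √(b - k ^ 2) < √b := Real.sqrt_lt_sqrt (sub_nonneg.2 hkb) (by nlinarith)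
  set a := √(1 - b)
  set s := √b
  set r := √(b - k ^ 2)
  have hr1 : b = 1 → 0 < r := fun h => by
    have : 0 < r ^ 2 := by rw [hr]; nlinarith
    exact lt_of_le_of_ne hr0 fun h0 => by rw [← h0] at this; simp at this
  have hc2 : c ^ 2 = (a * s * r) ^ 2 := by
    rw [mul_pow, mul_pow, ha, hs, hr, hc]; ring
  have hk : k ^ 2 = s ^ 2 - r ^ 2 := by rw [hs, hr]; ring
  have hba : b = 1 - a ^ 2 := by rw [ha]; ring
  have hsa : s ^ 2 = 1 - a ^ 2 := by rw [hs, hba]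
  have ham : a = 0 → 0 < r := fun h => hr1 (by rw [hba, h]; ring)
  have hom : omegaConst k b = ((a / 2) ^ 2 + ((s - r) / 2) ^ 2) * ((a / 2) ^ 2 + ((s + r) / 2) ^ 2) := by
    rw [omegaConst, freq, hk, show b = s ^ 2 from hs.symm]
    have ha' : a ^ 2 = 1 - s ^ 2 := by rw [hsa]; ring
    have ha4 : a ^ 4 = (1 - s ^ 2) ^ 2 := by rw [← ha']; ring
    ring_nf
    rw [ha4, ha']
    ring
  have hfr : freq k b = 2 * (a / 2) ^ 2 - ((s - r) / 2) ^ 2 - ((s + r) / 2) ^ 2 := by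
    rw [freq, hk, hba]
    linear_combination hsa
  -- The imaginary parts are `(√b ∓ √(b - k²)) / 2`, and the sign of `c` decides which goes with
  -- `+α`. If `α = 0` then `c = 0`, so the first branch applies, and there `β₁ < β₂` since `b = 1 >
  -- k²`.
  by_cases h : c = a * s * r
  · refine ⟨a / 2, (s - r) / 2, (s + r) / 2, by positivity, by linarith, by linarith,
      fun h => ?_, by rw [hba]; ring, hfr, by rw [h]; ring, hom⟩
    have := ham (by linarith)
    linarith
  · have h' := (sq_eq_sq_iff_eq_or_eq_neg.1 hc2).resolve_left h
    refine ⟨a / 2, (s + r) / 2, (s - r) / 2, by positivity, by linarith, by linarith,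
      fun h0 => absurd ?_ h, by rw [hba]; ring, by rw [hfr]; ring, by rw [h']; ring,
      by rw [hom]; ring⟩
    have : a = 0 := by linarith
    rw [h', this]; ring

/-- The polynomial `-Ω²` on the real line. -/
noncomputable def realPoly (k b c t : ℝ) : ℝ :=
  t ^ 4 - freq k b * t ^ 2 - c * t + omegaConst k b

theorem realPoly_pos {k b c : ℝ} (hk0 : 0 < k) (hk1 : k < 1) (hkb : k ^ 2 ≤ b)
    (hb1 : b ≤ 1) (hc : c ^ 2 = b * (1 - b) * (b - k ^ 2)) (t : ℝ) : 0 < realPoly k b c t := by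
  obtain ⟨α, β₁, β₂, -, h1, h2, -, -, hf, hc', ho⟩ := exists_root_parameters hk0 hk1 hkb hb1 hc
  have : realPoly k b c t = ((t - α) ^ 2 + β₁ ^ 2) * ((t + α) ^ 2 + β₂ ^ 2) := by
    rw [realPoly, hf, hc', ho]; ring
  rw [this]
  positivity

/-- The factor `C² - ω C + p` in the linear coefficient, `p` being the constant term of `P`, is the
mean of the values of `P` at `±√C`, and these are positive because all roots are nonreal. -/
theorem bandDisc_pos {k b c : ℝ} (hk0 : 0 < k) (hk1 : k < 1) (hkb : k ^ 2 ≤ b)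
    (hb1 : b ≤ 1) (hc : c ^ 2 = b * (1 - b) * (b - k ^ 2)) (hC : 0 ≤ quasiConst k b) {t : ℝ}
    (ht : 0 < t) : 0 < bandDisc k b c t := by
  have h1 := realPoly_pos hk0 hk1 hkb hb1 hc (√(quasiConst k b))
  have h2 := realPoly_pos hk0 hk1 hkb hb1 hc (-√(quasiConst k b))
  have hs := Real.sq_sqrt hC
  rw [realPoly] at h1 h2
  rw [bandDisc]
  set C := quasiConst k b
  have h3 : 0 < C ^ 2 - freq k b * C + omegaConst k b := by
    have h4 : √C ^ 4 = C ^ 2 := by linear_combination (√C ^ 2 + C) * hs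
    rw [neg_pow_two] at h2
    rw [h4, hs] at h1
    rw [show (-√C) ^ 4 = √C ^ 4 by ring, h4, hs] at h2
    linarith
  positivity

theorem bandIntegral_lt_sqrt {k b c : ℝ} (hk0 : 0 < k) (hk1 : k < 1) (hkb : k ^ 2 ≤ b)
    (hb1 : b ≤ 1) (hc : c ^ 2 = b * (1 - b) * (b - k ^ 2)) (hC : 0 ≤ quasiConst k b)
    {q : ℝ} (hq : 0 ≤ q) : bandIntegral k b q < √(bandTau b q) :=
  bandIntegral_lt_sqrt_of_disc_pos hk0 hk1 hkb hb1 hc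
    (fun _ ht => bandDisc_pos hk0 hk1 hkb hb1 hc hC ht) hq

/-- For `b = 1` both `F` and `√τ` vanish at `q = 0`, contradicting the strict inequality that `C ≥
0` would give. -/
theorem quasiConst_one_neg {k : ℝ} (hk0 : 0 < k) (hk1 : k < 1) : quasiConst k 1 < 0 := by
  by_contra h
  have := bandIntegral_lt_sqrt (b := 1) (c := 0) hk0 hk1 (by nlinarith) le_rfl (by ring)
    (not_lt.1 h) le_rfl
  simp [bandIntegral_zero, bandTau] at this

theorem tendsto_bandTau_atTop (b : ℝ) : Tendsto (bandTau b) atTop atTop := by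
  have h : Tendsto (fun q : ℝ => q ^ 2 + (1 - b)) atTop atTop :=
    tendsto_atTop_add_const_right _ _ (tendsto_pow_atTop two_ne_zero)
  refine h.congr fun q => ?_
  rw [bandTau]; ring

/-- The real part on the band tends to `√C` at its end on the real axis. -/
theorem tendsto_bandTau_sub_sq {k b c : ℝ} (hk0 : 0 < k) (hk1 : k < 1) (hkb : k ^ 2 ≤ b)
    (hb1 : b ≤ 1) (hc : c ^ 2 = b * (1 - b) * (b - k ^ 2)) :
    Tendsto (fun q => bandTau b q - bandIntegral k b q ^ 2) atTop (𝓝 (4 * quasiConst k b)) := by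
  set C := quasiConst k b with hC
  have hτ := tendsto_bandTau_atTop b
  have hr : Tendsto (fun q => √(bandTau b q)) atTop atTop := Real.tendsto_sqrt_atTop.comp hτ
  have hε : Tendsto (fun q => (bandTau b q)⁻¹) atTop (𝓝 0) := hτ.inv_tendsto_atTop
  have hpos : ∀ q : ℝ, 0 < q → 0 < bandTau b q := fun q hq => by rw [bandTau]; nlinarith
  have hgd : ∀ᶠ q in atTop, HasDerivAt (fun q => (√(bandTau b q))⁻¹)
      (-(q / √(bandTau b q)) / √(bandTau b q) ^ 2) q := by
    filter_upwards [eventually_gt_atTop 0] with q hq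
    exact (hasDerivAt_sqrt_bandTau (hpos q hq)).inv (Real.sqrt_pos.2 (hpos q hq)).ne'
  have hfd : ∀ᶠ q in atTop, HasDerivAt (fun q => bandIntegral k b q - √(bandTau b q))
      (bandDisc k b c (bandTau b q) / (√(bandWeight k q) * √(bandTau b q) *
        (√(bandTau b q) * (bandTau b q + ampSqMean k b) + q * √(bandWeight k q)))) q := by
    filter_upwards [eventually_gt_atTop 0] with q hq
    exact hasDerivAt_bandIntegral_sub hk0 hk1 hkb hb1 hc hq
  have hf0 := tendsto_bandIntegral_sub hk0 hk1 hkb hb1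
  have hlim : Tendsto (fun q => bandDisc k b c (bandTau b q) /
      (√(bandWeight k q) * √(bandTau b q) * (√(bandTau b q) * (bandTau b q + ampSqMean k b)
        + q * √(bandWeight k q))) / (-(q / √(bandTau b q)) / √(bandTau b q) ^ 2)) atTop
      (𝓝 (-(2 * C))) := by
    set e := 4 * (C ^ 2 - freq k b * C + omegaConst k b) with he
    have hfun : Continuous fun ε : ℝ => √((1 - (1 - b) * ε) * (1 + b * ε) *
        (1 + (b - k ^ 2) * ε)) := by fun_prop
    have h1 : Tendsto (fun q => √((1 - (1 - b) * (bandTau b q)⁻¹) * (1 + b * (bandTau b q)⁻¹) *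
        (1 + (b - k ^ 2) * (bandTau b q)⁻¹))) atTop (𝓝 1) := by
      have := (hfun.tendsto 0).comp hε
      simpa [Function.comp_def] using this
    have h2 : Tendsto (fun q => 4 * C + e * (bandTau b q)⁻¹ + c ^ 2 * (bandTau b q)⁻¹ ^ 2) atTop
        (𝓝 (4 * C)) := by
      have hc : Continuous fun ε : ℝ => 4 * C + e * ε + c ^ 2 * ε ^ 2 := by fun_prop
      have := (hc.tendsto 0).comp hε
      simpa [Function.comp_def] using this
    have h3 : Tendsto (fun q => 1 + ampSqMean k b * (bandTau b q)⁻¹) atTop (𝓝 1) := by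
      simpa using (hε.const_mul (ampSqMean k b)).const_add 1
    have h4 := (h2.div (h1.mul (h3.add h1)) (by norm_num)).neg
    have h5 : -(4 * C / (1 * (1 + 1))) = -(2 * C) := by ring
    rw [h5] at h4
    refine h4.congr' ?_
    filter_upwards [eventually_gt_atTop 0] with q hq
    have ht := hpos q hq
    have hrp := Real.sqrt_pos.2 ht
    have hr2 := Real.sq_sqrt ht.le
    have hN := Real.sqrt_pos.2 (bandWeight_pos hk0 hk1 q)
    have hsq : √((1 - (1 - b) * (bandTau b q)⁻¹) * (1 + b * (bandTau b q)⁻¹) *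
        (1 + (b - k ^ 2) * (bandTau b q)⁻¹))
        = q * √(bandWeight k q) / (√(bandTau b q) * bandTau b q) := by
      rw [Real.sqrt_eq_iff_mul_self_eq_of_pos (by positivity)]
      have hN2 := Real.sq_sqrt (bandWeight_pos hk0 hk1 q).le
      have : q * √(bandWeight k q) / (√(bandTau b q) * bandTau b q) *
          (q * √(bandWeight k q) / (√(bandTau b q) * bandTau b q))
          = q ^ 2 * √(bandWeight k q) ^ 2 / (√(bandTau b q) ^ 2 * bandTau b q ^ 2) := by
        field_simp
      rw [this, hN2, hr2]
      field_simp
      rw [bandWeight, bandTau]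
      ring
    have hW := ampSqMean_nonneg hk0 hk1 hkb
    simp only [Pi.div_apply, hsq, bandDisc, ← hC, ← he]
    have hr3 : bandTau b q = √(bandTau b q) ^ 2 := hr2.symm
    set r := √(bandTau b q)
    set n := √(bandWeight k q)
    rw [hr3]
    field_simp
  -- L'Hôpital gives `(F - √τ) √τ → -2C`; multiplying by `(F + √τ) / √τ → 2` yields the limit of `F²
  -- - τ`.
  have hL := HasDerivAt.lhopital_zero_atTop hfd hgd ?_ hf0 hr.inv_tendsto_atTop hlim
  · have h6 : Tendsto (fun q => (bandIntegral k b q - √(bandTau b q)) / (√(bandTau b q))⁻¹ *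
        ((bandIntegral k b q - √(bandTau b q)) * (√(bandTau b q))⁻¹ + 2)) atTop
        (𝓝 (-(2 * C) * (0 * 0 + 2))) := hL.mul ((hf0.mul hr.inv_tendsto_atTop).add_const 2)
    have h7 := h6.neg
    rw [show -(-(2 * C) * (0 * 0 + 2)) = 4 * C by ring] at h7
    refine h7.congr' ?_
    filter_upwards [eventually_gt_atTop 0] with q hq
    have hrp := Real.sqrt_pos.2 (hpos q hq)
    have hr2 := Real.sq_sqrt (hpos q hq).le
    field_simp
    linear_combination hr2
  · filter_upwards [eventually_gt_atTop 0] with q hq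
    have hrp := Real.sqrt_pos.2 (hpos q hq)
    exact div_ne_zero (neg_ne_zero.2 (by positivity)) (by positivity)

/-! ### Separation variables attached to a point of the curve `Y² = P(ζ)`. -/

section Separation

/-- `Re √P / Im ζ`, for `ζ` in the upper half plane and a square root `Y` of `P(ζ) = -Ω²(ζ)`. -/
noncomputable def sepG (ζ Y : ℂ) : ℝ := Y.re / ζ.im

/-- The separation variable `τ`. -/
noncomputable def sepTau (ζ Y : ℂ) : ℝ := sepG ζ Y ^ 2 + 4 * ζ.re ^ 2

/-- The signed square root of the resolvent cubic at `τ`. -/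
noncomputable def sepV (k b : ℝ) (ζ Y : ℂ) : ℝ :=
  sepG ζ Y * (2 * ζ.re ^ 2 - 2 * ζ.im ^ 2 - freq k b + sepTau ζ Y) + 4 * ζ.re * Y.im

/-- The signed square root of `τ - (1 - b)`. -/
noncomputable def sepQ (k b : ℝ) (ζ Y : ℂ) : ℝ :=
  sepV k b ζ Y / √((sepTau ζ Y + b) * (sepTau ζ Y + b - k ^ 2))

variable {k b c : ℝ} {ζ Y : ℂ}

theorem re_sq_root (hY : Y ^ 2 = -omegaSq k b c ζ) :
    Y.re ^ 2 - Y.im ^ 2 = ζ.re ^ 4 - 6 * ζ.re ^ 2 * ζ.im ^ 2 + ζ.im ^ 4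
      - freq k b * (ζ.re ^ 2 - ζ.im ^ 2) - c * ζ.re + omegaConst k b := by
  have h := congrArg Complex.re hY
  have e : -omegaSq k b c ζ
      = ζ ^ 4 - (freq k b : ℂ) * ζ ^ 2 - (c : ℂ) * ζ + (omegaConst k b : ℝ) := by
    rw [omegaSq, omegaConst]; push_cast; ring
  rw [e] at h
  have e4 : ζ ^ 4 = ζ * ζ * (ζ * ζ) := by ring
  rw [e4, sq, sq] at h
  simp at h
  linear_combination h

theorem im_sq_root (hY : Y ^ 2 = -omegaSq k b c ζ) :
    2 * Y.re * Y.im = ζ.im * (4 * ζ.re ^ 3 - 4 * ζ.re * ζ.im ^ 2 - 2 * freq k b * ζ.re - c) := by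
  have h := congrArg Complex.im hY
  have e : -omegaSq k b c ζ
      = ζ ^ 4 - (freq k b : ℂ) * ζ ^ 2 - (c : ℂ) * ζ + (omegaConst k b : ℝ) := by
    rw [omegaSq, omegaConst]; push_cast; ring
  rw [e] at h
  have e4 : ζ ^ 4 = ζ * ζ * (ζ * ζ) := by ring
  rw [e4, sq, sq] at h
  simp at h
  linear_combination h

theorem re_eq_sepG_mul (hy : ζ.im ≠ 0) : Y.re = sepG ζ Y * ζ.im := by
  rw [sepG, div_mul_cancel₀ _ hy]

theorem sepG_mul_im (hy : ζ.im ≠ 0) (hY : Y ^ 2 = -omegaSq k b c ζ) :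
    2 * sepG ζ Y * Y.im = 4 * ζ.re ^ 3 - 4 * ζ.re * ζ.im ^ 2 - 2 * freq k b * ζ.re - c := by
  have h := im_sq_root hY
  rw [re_eq_sepG_mul hy] at h
  apply mul_left_cancel₀ hy
  linear_combination h

/-- The resolvent cubic arises by eliminating `Im Y` and the coordinates of `ζ`, using only the real
and imaginary parts of `Y² = P(ζ)`. -/
theorem sepV_sq (hy : ζ.im ≠ 0) (hY : Y ^ 2 = -omegaSq k b c ζ) :
    sepV k b ζ Y ^ 2 = sepTau ζ Y * (sepTau ζ Y - freq k b) ^ 2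
      - 4 * omegaConst k b * sepTau ζ Y - c ^ 2 := by
  have h1 := sepG_mul_im hy hY
  have h2 := re_sq_root hY
  rw [re_eq_sepG_mul hy] at h2
  rw [sepV, sepTau]
  set g := sepG ζ Y
  set x := ζ.re
  set y := ζ.im
  set Z := Y.im
  linear_combination (4 * x * (6 * x ^ 2 - 2 * y ^ 2 - freq k b + g ^ 2)
    - (2 * g * Z + (4 * x ^ 3 - 4 * x * y ^ 2 - 2 * freq k b * x - c))) * h1
    + (-16 * x ^ 2 - 4 * g ^ 2) * h2

/-- Linear in `|ζ|²`: when `τ ≠ 0`, this recovers `|ζ|²` from `g`, `V`, `τ` and the real part. -/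
theorem sepG_mul_sepV (hy : ζ.im ≠ 0) (hY : Y ^ 2 = -omegaSq k b c ζ) :
    sepG ζ Y * sepV k b ζ Y = sepTau ζ Y * (sepTau ζ Y - freq k b - 2 * (ζ.re ^ 2 + ζ.im ^ 2))
      - 2 * c * ζ.re := by
  have h1 := sepG_mul_im hy hY
  rw [sepV, sepTau]
  linear_combination 2 * ζ.re * h1

theorem resolvent_factor (hc : c ^ 2 = b * (1 - b) * (b - k ^ 2)) (t : ℝ) :
    t * (t - freq k b) ^ 2 - 4 * omegaConst k b * t - c ^ 2
      = (t - (1 - b)) * ((t + b) * (t + b - k ^ 2)) := by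
  rw [hc, omegaConst, freq]; ring

/-- As `τ ≥ 0` and `V² ≥ 0`, the factored cubic forces `τ ≥ 1 - b` unless the weight vanishes, that
is `τ = 0` and `b = k²`. In that case `ζ` and `Y` would be imaginary, while `P` is positive on the
imaginary axis. -/
theorem one_sub_le_sepTau (hk0 : 0 < k) (hkb : k ^ 2 ≤ b)
    (hc : c ^ 2 = b * (1 - b) * (b - k ^ 2)) (hy : ζ.im ≠ 0) (hY : Y ^ 2 = -omegaSq k b c ζ) : 1 - b ≤ sepTau ζ Y := by
  have h1 := sepV_sq hy hY
  rw [resolvent_factor hc] at h1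
  have hg : 0 ≤ sepG ζ Y ^ 2 := sq_nonneg _
  have hx : 0 ≤ ζ.re ^ 2 := sq_nonneg _
  have ht : 0 ≤ sepTau ζ Y := by rw [sepTau]; positivity
  have hkp : 0 < k ^ 2 := by positivity
  by_contra hlt
  have hlt' := not_le.1 hlt
  have h3 : 0 ≤ (sepTau ζ Y + b) * (sepTau ζ Y + b - k ^ 2) :=
    mul_nonneg (by linarith) (by linarith)
  have h4 : (sepTau ζ Y + b) * (sepTau ζ Y + b - k ^ 2) = 0 := by
    nlinarith [sq_nonneg (sepV k b ζ Y)]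
  have h5 : sepTau ζ Y + b - k ^ 2 = 0 :=
    (mul_eq_zero.1 h4).resolve_left (by linarith)
  have ht0 : sepTau ζ Y = 0 := by linarith
  have hbk : b = k ^ 2 := by linarith
  have hx0 : ζ.re = 0 := by
    rw [sepTau] at ht0
    exact pow_eq_zero_iff two_ne_zero |>.1 (by linarith : ζ.re ^ 2 = 0)
  have hg0 : sepG ζ Y = 0 := by
    rw [sepTau] at ht0
    exact pow_eq_zero_iff two_ne_zero |>.1 (by linarith : sepG ζ Y ^ 2 = 0)
  have h6 := re_sq_root hY
  rw [re_eq_sepG_mul hy, hg0, hx0, omegaConst, freq, hbk] at h6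
  have hk2 : k ^ 2 < 1 := by nlinarith
  nlinarith [sq_nonneg Y.im, sq_nonneg (ζ.im ^ 2 + (1 - 2 * k ^ 2) / 4), mul_pos hkp (sub_pos.2 hk2)]

theorem sepWeight_pos (hk0 : 0 < k) (hk1 : k < 1) (hkb : k ^ 2 ≤ b)
    (hc : c ^ 2 = b * (1 - b) * (b - k ^ 2)) (hy : ζ.im ≠ 0)
    (hY : Y ^ 2 = -omegaSq k b c ζ) :
    0 < (sepTau ζ Y + b) * (sepTau ζ Y + b - k ^ 2) := by
  have := one_sub_le_sepTau hk0 hkb hc hy hY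
  have hk2 : k ^ 2 < 1 := by nlinarith
  exact mul_pos (by linarith) (by linarith)

theorem bandTau_sepQ (hk0 : 0 < k) (hk1 : k < 1) (hkb : k ^ 2 ≤ b)
    (hc : c ^ 2 = b * (1 - b) * (b - k ^ 2)) (hy : ζ.im ≠ 0)
    (hY : Y ^ 2 = -omegaSq k b c ζ) : bandTau b (sepQ k b ζ Y) = sepTau ζ Y := by
  have h1 := sepV_sq hy hY
  have h2 := sepWeight_pos hk0 hk1 hkb hc hy hY
  rw [resolvent_factor hc] at h1
  rw [bandTau, sepQ, div_pow, Real.sq_sqrt h2.le, h1, mul_div_assoc, div_self h2.ne']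
  ring

theorem bandWeight_sepQ (hk0 : 0 < k) (hk1 : k < 1) (hkb : k ^ 2 ≤ b)
    (hc : c ^ 2 = b * (1 - b) * (b - k ^ 2)) (hy : ζ.im ≠ 0)
    (hY : Y ^ 2 = -omegaSq k b c ζ) :
    bandWeight k (sepQ k b ζ Y) = (sepTau ζ Y + b) * (sepTau ζ Y + b - k ^ 2) := by
  rw [← bandTau_sepQ hk0 hk1 hkb hc hy hY, bandWeight, bandTau]; ring

theorem sepV_eq (hk0 : 0 < k) (hk1 : k < 1) (hkb : k ^ 2 ≤ b)
    (hc : c ^ 2 = b * (1 - b) * (b - k ^ 2)) (hy : ζ.im ≠ 0)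
    (hY : Y ^ 2 = -omegaSq k b c ζ) :
    sepV k b ζ Y = sepQ k b ζ Y * √(bandWeight k (sepQ k b ζ Y)) := by
  have h2 := sepWeight_pos hk0 hk1 hkb hc hy hY
  rw [bandWeight_sepQ hk0 hk1 hkb hc hy hY, sepQ, div_mul_cancel₀ _ (Real.sqrt_pos.2 h2).ne']

theorem sepG_neg (ζ Y : ℂ) : sepG ζ (-Y) = -sepG ζ Y := by
  simp [sepG, neg_div]

theorem sepTau_neg (ζ Y : ℂ) : sepTau ζ (-Y) = sepTau ζ Y := by
  simp [sepTau, sepG_neg]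

theorem sepQ_neg (k b : ℝ) (ζ Y : ℂ) : sepQ k b ζ (-Y) = -sepQ k b ζ Y := by
  rw [sepQ, sepQ, sepTau_neg, ← neg_div]
  congr 1
  rw [sepV, sepV, sepTau_neg, sepG_neg, Complex.neg_im]
  ring

end Separation

/-! ### The separation variables along a curve `ζ' = κ Y`. -/

section SeparationDeriv

variable {k b c : ℝ} {ζ Y : ℝ → ℂ} {κ : ℂ} {s : ℝ}

theorem hasDerivAt_re {f : ℝ → ℂ} {f' : ℂ} {s : ℝ} (h : HasDerivAt f f' s) :
    HasDerivAt (fun t => (f t).re) f'.re s :=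
  Complex.reCLM.hasFDerivAt.comp_hasDerivAt s h

theorem hasDerivAt_im {f : ℝ → ℂ} {f' : ℂ} {s : ℝ} (h : HasDerivAt f f' s) :
    HasDerivAt (fun t => (f t).im) f'.im s :=
  Complex.imCLM.hasFDerivAt.comp_hasDerivAt s h

/-- Derivative of `Re √P / Im ζ` along a curve with `ζ' = κ Y`. -/
theorem hasDerivAt_sepG (hζ : HasDerivAt ζ (κ * Y s) s)
    (hYd : HasDerivAt Y (κ * (4 * ζ s ^ 3 - 2 * freq k b * ζ s - c) / 2) s)
    (hy : (ζ s).im ≠ 0) (hY : Y s ^ 2 = -omegaSq k b c (ζ s)) :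
    HasDerivAt (fun t => sepG (ζ t) (Y t)) (-4 * (ζ s).re * (ζ s).im * κ.re -
      κ.im * (2 * (ζ s).re ^ 2 - 2 * (ζ s).im ^ 2 - freq k b + sepTau (ζ s) (Y s))) s := by
  refine ((hasDerivAt_re hYd).div (hasDerivAt_im hζ) hy).congr_deriv ?_
  have h1 := im_sq_root hY
  rw [sepTau, sepG]
  have e1 : (κ * (4 * ζ s ^ 3 - 2 * freq k b * ζ s - c) / 2).re
      = (κ.re * (4 * (ζ s).re ^ 3 - 12 * (ζ s).re * (ζ s).im ^ 2 - 2 * freq k b * (ζ s).re - c)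
        - κ.im * (12 * (ζ s).re ^ 2 * (ζ s).im - 4 * (ζ s).im ^ 3 - 2 * freq k b * (ζ s).im)) / 2 := by
    rw [show ζ s ^ 3 = ζ s * ζ s * ζ s by ring]
    simp
    ring
  rw [e1, Complex.mul_im]
  field_simp
  linear_combination -κ.re * h1

theorem hasDerivAt_sepTau (hζ : HasDerivAt ζ (κ * Y s) s)
    (hYd : HasDerivAt Y (κ * (4 * ζ s ^ 3 - 2 * freq k b * ζ s - c) / 2) s)
    (hy : (ζ s).im ≠ 0) (hY : Y s ^ 2 = -omegaSq k b c (ζ s)) :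
    HasDerivAt (fun t => sepTau (ζ t) (Y t)) (-2 * κ.im * sepV k b (ζ s) (Y s)) s := by
  refine (((hasDerivAt_sepG hζ hYd hy hY).pow 2).add
    (((hasDerivAt_re hζ).pow 2).const_mul 4)).congr_deriv ?_
  rw [sepV, Complex.mul_re, re_eq_sepG_mul (ζ := ζ s) (Y := Y s) hy]
  push_cast
  ring

theorem hasDerivAt_sepV (hζ : HasDerivAt ζ (κ * Y s) s)
    (hYd : HasDerivAt Y (κ * (4 * ζ s ^ 3 - 2 * freq k b * ζ s - c) / 2) s)
    (hy : (ζ s).im ≠ 0) (hY : Y s ^ 2 = -omegaSq k b c (ζ s)) :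
    HasDerivAt (fun t => sepV k b (ζ t) (Y t))
      (-κ.im * (3 * sepTau (ζ s) (Y s) ^ 2 - 4 * freq k b * sepTau (ζ s) (Y s) + freq k b ^ 2
        - 4 * omegaConst k b)) s := by
  have hx' := hasDerivAt_re hζ
  have hy' := hasDerivAt_im hζ
  refine (((hasDerivAt_sepG hζ hYd hy hY).mul (((((hx'.pow 2).const_mul 2).sub
    ((hy'.pow 2).const_mul 2)).sub_const (freq k b)).add (hasDerivAt_sepTau hζ hYd hy hY))).add
      ((hx'.const_mul 4).mul (hasDerivAt_im hYd))).congr_deriv ?_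
  have h1 := sepG_mul_im hy hY
  have h2 := re_sq_root hY
  have e1 : (κ * (4 * ζ s ^ 3 - 2 * freq k b * ζ s - c) / 2).im
      = (κ.im * (4 * (ζ s).re ^ 3 - 12 * (ζ s).re * (ζ s).im ^ 2 - 2 * freq k b * (ζ s).re - c)
        + κ.re * (12 * (ζ s).re ^ 2 * (ζ s).im - 4 * (ζ s).im ^ 3 - 2 * freq k b * (ζ s).im)) / 2 := by
    rw [show ζ s ^ 3 = ζ s * ζ s * ζ s by ring]
    simp
    ring
  rw [e1, Complex.mul_re, Complex.mul_im]
  simp only [Pi.add_apply, Pi.sub_apply, Pi.pow_apply]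
  rw [re_eq_sepG_mul (ζ := ζ s) (Y := Y s) hy] at h2 ⊢
  push_cast
  rw [sepV, sepTau]
  set g := sepG (ζ s) (Y s)
  set x := (ζ s).re
  set y := (ζ s).im
  set Z := (Y s).im
  linear_combination (-6 * κ.im * x) * h1 + 4 * κ.im * h2

/-- The velocity of `q` depends on the point only through `q`, so a function of `q` alone can be
subtracted from `g` to match the quasi-momentum differential. That function is `F`. -/
theorem hasDerivAt_sepQ (hk0 : 0 < k) (hk1 : k < 1) (hkb : k ^ 2 ≤ b)
    (hc : c ^ 2 = b * (1 - b) * (b - k ^ 2)) (hζ : HasDerivAt ζ (κ * Y s) s)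
    (hYd : HasDerivAt Y (κ * (4 * ζ s ^ 3 - 2 * freq k b * ζ s - c) / 2) s)
    (hy : (ζ s).im ≠ 0) (hY : Y s ^ 2 = -omegaSq k b c (ζ s)) :
    HasDerivAt (fun t => sepQ k b (ζ t) (Y t))
      (-κ.im * √(bandWeight k (sepQ k b (ζ s) (Y s)))) s := by
  have hN := sepWeight_pos hk0 hk1 hkb hc hy hY
  have hτ := hasDerivAt_sepTau hζ hYd hy hY
  have hN' := Real.sqrt_pos.2 hN
  have hd := (hasDerivAt_sepV hζ hYd hy hY).div
    (((hτ.add_const b).mul ((hτ.add_const b).sub_const (k ^ 2))).sqrt hN.ne') hN'.ne'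
  refine hd.congr_deriv ?_
  have h1 := sepV_sq hy hY
  rw [resolvent_factor hc] at h1
  have h2 := Real.sq_sqrt hN.le
  rw [bandWeight_sepQ hk0 hk1 hkb hc hy hY]
  have e : 3 * sepTau (ζ s) (Y s) ^ 2 - 4 * freq k b * sepTau (ζ s) (Y s) + freq k b ^ 2
        - 4 * omegaConst k b = (sepTau (ζ s) (Y s) + b) * (sepTau (ζ s) (Y s) + b - k ^ 2) +
        (sepTau (ζ s) (Y s) - (1 - b)) * (2 * sepTau (ζ s) (Y s) + 2 * b - k ^ 2) := by
    rw [omegaConst, freq]; ring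
  rw [e]
  simp only [Pi.mul_apply]
  set τ := sepTau (ζ s) (Y s)
  set n := √((τ + b) * (τ + b - k ^ 2))
  set V := sepV k b (ζ s) (Y s)
  rw [← h2] at h1 ⊢
  field_simp
  linear_combination (2 * τ + 2 * b - k ^ 2) * κ.im * h1

/-- The derivative of the logarithm of the Floquet multiplier in separated form. -/
theorem hasDerivAt_sepG_sub (hk0 : 0 < k) (hk1 : k < 1) (hkb : k ^ 2 ≤ b)
    (hc : c ^ 2 = b * (1 - b) * (b - k ^ 2)) (hζ : HasDerivAt ζ (κ * Y s) s)
    (hYd : HasDerivAt Y (κ * (4 * ζ s ^ 3 - 2 * freq k b * ζ s - c) / 2) s)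
    (hy : (ζ s).im ≠ 0) (hY : Y s ^ 2 = -omegaSq k b c (ζ s)) :
    HasDerivAt (fun t => sepG (ζ t) (Y t) - bandIntegral k b (sepQ k b (ζ t) (Y t)))
      (-2 * (κ * (ζ s ^ 2 - quasiConst k b)).im) s := by
  refine ((hasDerivAt_sepG hζ hYd hy hY).sub ((hasDerivAt_bandIntegral hk0 hk1 b _).comp s
    (hasDerivAt_sepQ hk0 hk1 hkb hc hζ hYd hy hY))).congr_deriv ?_
  have hN := Real.sqrt_pos.2 (bandWeight_pos hk0 hk1 (sepQ k b (ζ s) (Y s)))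
  have hq : sepQ k b (ζ s) (Y s) ^ 2 + 1 - b = sepTau (ζ s) (Y s) :=
    bandTau_sepQ hk0 hk1 hkb hc hy hY
  rw [hq, quasiConst, show ζ s ^ 2 = ζ s * ζ s from sq _]
  simp
  field_simp
  ring

end SeparationDeriv

/-! ### Approach to the real axis. -/

section Asymptotics

variable {k b c : ℝ} {ζ Y : ℝ → ℂ}

/-- With `ζ` bounded and `g → ∞`, the sign of `g V` makes `V` positive, so `q → +∞` rather than
`-∞`. Both `g` and `F(q)` are then asymptotic to `√τ`. -/
theorem tendsto_sepG_sub {l : Filter ℝ} (hk0 : 0 < k) (hk1 : k < 1) (hkb : k ^ 2 ≤ b)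
    (hb1 : b ≤ 1) (hc : c ^ 2 = b * (1 - b) * (b - k ^ 2)) {x₀ y₀ : ℝ}
    (hx : Tendsto (fun s => (ζ s).re) l (𝓝 x₀)) (hy : Tendsto (fun s => (ζ s).im) l (𝓝 y₀))
    (hg : Tendsto (fun s => sepG (ζ s) (Y s)) l atTop) (hy0 : ∀ᶠ s in l, (ζ s).im ≠ 0)
    (hY : ∀ s, Y s ^ 2 = -omegaSq k b c (ζ s)) :
    Tendsto (fun s => sepG (ζ s) (Y s) - bandIntegral k b (sepQ k b (ζ s) (Y s))) l (𝓝 0) := by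
  have hpoly : Tendsto (fun s => freq k b + 2 * ((ζ s).re ^ 2 + (ζ s).im ^ 2) + 2 * |c * (ζ s).re|) l
      (𝓝 (freq k b + 2 * (x₀ ^ 2 + y₀ ^ 2) + 2 * |c * x₀|)) :=
    ((((hx.pow 2).add (hy.pow 2)).const_mul 2).const_add _).add ((hx.const_mul c).abs.const_mul 2)
  have hq : Tendsto (fun s => sepQ k b (ζ s) (Y s)) l atTop := by
    refine tendsto_atTop_mono' l ?_ (tendsto_atTop_add_const_right _ (-1) hg)
    filter_upwards [hy0, hpoly.eventually_lt_const (lt_add_one _), hg.eventually_ge_atTop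
      (1 + |freq k b + 2 * (x₀ ^ 2 + y₀ ^ 2) + 2 * |c * x₀| + 1|)] with s hs hM hgs
    set M := freq k b + 2 * (x₀ ^ 2 + y₀ ^ 2) + 2 * |c * x₀| + 1
    have hg1 : 1 ≤ sepG (ζ s) (Y s) := by linarith [abs_nonneg M]
    have hgM : M < sepG (ζ s) (Y s) := by linarith [le_abs_self M]
    have hτ : sepG (ζ s) (Y s) ^ 2 ≤ sepTau (ζ s) (Y s) := by
      rw [sepTau]; linarith [sq_nonneg (ζ s).re]
    have hτg : sepG (ζ s) (Y s) ≤ sepTau (ζ s) (Y s) := by nlinarith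
    have hgV := sepG_mul_sepV hs (hY s)
    have hcx := neg_abs_le (c * (ζ s).re)
    have hcx' := le_abs_self (c * (ζ s).re)
    have hpos : 0 < sepG (ζ s) (Y s) * sepV k b (ζ s) (Y s) := by
      rw [hgV]
      have h0 := abs_nonneg (c * (ζ s).re)
      have h5 := mul_nonneg (by linarith : 0 ≤ sepTau (ζ s) (Y s) - 1) (by linarith :
        0 ≤ sepTau (ζ s) (Y s) - freq k b - 2 * ((ζ s).re ^ 2 + (ζ s).im ^ 2))
      linarith
    have hV := (mul_pos_iff_of_pos_left (by linarith : 0 < sepG (ζ s) (Y s))).1 hpos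
    have hqp : 0 < sepQ k b (ζ s) (Y s) :=
      div_pos hV (Real.sqrt_pos.2 (sepWeight_pos hk0 hk1 hkb hc hs (hY s)))
    have hb := bandTau_sepQ hk0 hk1 hkb hc hs (hY s)
    rw [bandTau] at hb
    have hb0 : 0 < b := (by positivity : 0 < k ^ 2).trans_le hkb
    by_contra hlt
    nlinarith [not_le.1 hlt]
  have h1 := (tendsto_bandIntegral_sub hk0 hk1 hkb hb1).comp hq
  have h2 : Tendsto (fun s => sepG (ζ s) (Y s) - √(sepTau (ζ s) (Y s))) l (𝓝 0) := by
    have h3 : Tendsto (fun s => -(4 * (ζ s).re ^ 2 / sepG (ζ s) (Y s))) l (𝓝 0) := by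
      simpa using (((hx.pow 2).const_mul 4).div_atTop hg).neg
    refine tendsto_of_tendsto_of_tendsto_of_le_of_le' h3 tendsto_const_nhds ?_ ?_
    · filter_upwards [hg.eventually_gt_atTop 0] with s hs
      have h0 : 0 ≤ 4 * (ζ s).re ^ 2 / sepG (ζ s) (Y s) := by positivity
      have h5 : √(sepTau (ζ s) (Y s)) ≤
          sepG (ζ s) (Y s) + 4 * (ζ s).re ^ 2 / sepG (ζ s) (Y s) := by
        refine Real.sqrt_le_iff.2 ⟨by positivity, ?_⟩
        rw [sepTau, add_sq, mul_assoc 2, mul_div_cancel₀ _ hs.ne']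
        nlinarith [sq_nonneg (ζ s).re]
      linarith
    · filter_upwards [hg.eventually_gt_atTop 0] with s hs
      rw [sub_nonpos]
      apply Real.le_sqrt_of_sq_le
      rw [sepTau]; linarith [sq_nonneg (ζ s).re]
  have h4 := h2.sub h1
  rw [sub_zero] at h4
  refine h4.congr' ?_
  filter_upwards [hy0] with s hs
  have hb := bandTau_sepQ hk0 hk1 hkb hc hs (hY s)
  rw [bandTau] at hb
  simp only [Function.comp_apply, hb]
  ring

end Asymptotics

/-! ### Square roots of `P` along lines that avoid the branch points. -/

section Branch

theorem exists_differentiable_sq_eq_sub {z : ℂ} (hz : z.im ≠ 0) :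
    ∃ f : ℝ → ℂ, Differentiable ℝ f ∧ (∀ s : ℝ, f s ^ 2 = s - z) ∧ ∀ s : ℝ, f s ≠ 0 := by
  have hs : ∀ s : ℝ, (s : ℂ) - z ∈ Complex.slitPlane := fun s => by
    rw [Complex.mem_slitPlane_iff]; right; simpa using hz
  refine ⟨fun s => ((s : ℂ) - z) ^ (1 / 2 : ℂ), fun s => ?_, fun s => ?_, fun s => ?_⟩
  · have h1 : HasDerivAt (fun s : ℝ => (s : ℂ) - z) 1 s :=
      (Complex.ofRealCLM.hasDerivAt (x := s)).sub_const z
    exact ((Complex.hasStrictDerivAt_cpow_const (c := 1 / 2) (hs s)).hasDerivAt.comp s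
      h1).differentiableAt
  · rw [← Complex.cpow_nat_mul]; norm_num
  · rw [Ne, Complex.cpow_eq_zero_iff, not_and_or]
    exact Or.inl (Complex.slitPlane_ne_zero (hs s))

theorem neg_omegaSq_eq {k b c α β₁ β₂ : ℝ} (hf : freq k b = 2 * α ^ 2 - β₁ ^ 2 - β₂ ^ 2)
    (hc' : c = 2 * α * (β₂ ^ 2 - β₁ ^ 2)) (ho : omegaConst k b = (α ^ 2 + β₁ ^ 2) * (α ^ 2 + β₂ ^ 2))
    (ζ : ℂ) : -omegaSq k b c ζ = (ζ - (α + β₁ * Complex.I)) * (ζ - (α - β₁ * Complex.I)) *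
      ((ζ - (-α + β₂ * Complex.I)) * (ζ - (-α - β₂ * Complex.I))) := by
  have e : -omegaSq k b c ζ
      = ζ ^ 4 - (freq k b : ℝ) * ζ ^ 2 - (c : ℂ) * ζ + (omegaConst k b : ℝ) := by
    rw [omegaSq, omegaConst]; push_cast; ring
  rw [e, ho, hf, hc']
  push_cast
  have h1 : (ζ - (α + β₁ * Complex.I)) * (ζ - (α - β₁ * Complex.I)) = (ζ - α) ^ 2 + β₁ ^ 2 := by
    linear_combination (-β₁ ^ 2 : ℂ) * Complex.I_sq
  have h2 : (ζ - (-α + β₂ * Complex.I)) * (ζ - (-α - β₂ * Complex.I)) = (ζ + α) ^ 2 + β₂ ^ 2 := by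
    linear_combination (-β₂ ^ 2 : ℂ) * Complex.I_sq
  rw [h1, h2]
  ring

theorem hasDerivAt_neg_omegaSq {k b c : ℝ} {ζ : ℝ → ℂ} {ζ' : ℂ} {s : ℝ} (h : HasDerivAt ζ ζ' s) :
    HasDerivAt (fun t => -omegaSq k b c (ζ t))
      (ζ' * (4 * ζ s ^ 3 - 2 * freq k b * ζ s - c)) s := by
  have h1 := ((((h.pow 4).neg.add ((h.pow 2).const_mul (freq k b : ℂ))).add
    (h.const_mul (c : ℂ))).sub_const
    (1 / 16 * (4 * (freq k b : ℂ) * (b : ℂ) + 3 * (b : ℂ) ^ 2 + (1 - (k : ℂ) ^ 2) ^ 2))).neg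
  refine h1.congr_deriv ?_
  push_cast
  ring

/-- A differentiable square root of `-Ω²` along a line that crosses the real axis at `0` and
ends at a given point. -/
theorem exists_line_branch {k b c : ℝ} (hk0 : 0 < k) (hk1 : k < 1) (hkb : k ^ 2 ≤ b)
    (hb1 : b ≤ 1) (hc : c ^ 2 = b * (1 - b) * (b - k ^ 2)) {z Z : ℂ}
    (hZ : Z ^ 2 = -omegaSq k b c z) (hZ0 : Z ≠ 0) :
    ∃ (ζ Y : ℝ → ℂ) (v : ℂ), (∀ s, HasDerivAt ζ v s) ∧ (∀ s, (ζ s).im = s) ∧ ζ z.im = z ∧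
      Y z.im = Z ∧ (∀ s, Y s ≠ 0) ∧ (∀ s, Y s ^ 2 = -omegaSq k b c (ζ s)) ∧
      ∀ s, HasDerivAt Y (v / Y s * (4 * ζ s ^ 3 - 2 * freq k b * ζ s - c) / 2) s := by
  obtain ⟨α, β₁, β₂, -, h1, h2, -, -, hf, hc', ho⟩ := exists_root_parameters hk0 hk1 hkb hb1 hc
  have hfac := neg_omegaSq_eq hf hc' ho
  -- Only finitely many slopes lead from `z` to a root. If a root has the same imaginary part as
  -- `z`, the junk quotient `0` merely excludes one extra slope.
  obtain ⟨δ, hδ⟩ := Infinite.exists_notMem_finset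
    ({((α : ℂ) + β₁ * Complex.I - z).re / ((α : ℂ) + β₁ * Complex.I - z).im,
      ((α : ℂ) - β₁ * Complex.I - z).re / ((α : ℂ) - β₁ * Complex.I - z).im,
      (-(α : ℂ) + β₂ * Complex.I - z).re / (-(α : ℂ) + β₂ * Complex.I - z).im,
      (-(α : ℂ) - β₂ * Complex.I - z).re / (-(α : ℂ) - β₂ * Complex.I - z).im} : Finset ℝ)
  simp only [Finset.mem_insert, Finset.mem_singleton, not_or] at hδ
  set v : ℂ := δ + Complex.I with hv
  have hvi : v.im = 1 := by simp [hv]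
  have hvr : v.re = δ := by simp [hv]
  have hv0 : v ≠ 0 := fun h => by simp [h] at hvi
  have hroot : ∀ e : ℂ, omegaSq k b c e = 0 → δ ≠ (e - z).re / (e - z).im →
      ((e - z) / v).im ≠ 0 := by
    intro e he hne h0
    obtain ⟨r, hr⟩ : ∃ r : ℝ, (e - z) = r * v :=
      ⟨((e - z) / v).re, by
        rw [← div_eq_iff hv0]; exact Complex.ext (by simp) (by simpa using h0)⟩
    have hr0 : r ≠ 0 := fun h => by
      rw [h] at hr
      simp only [Complex.ofReal_zero, zero_mul] at hr
      rw [sub_eq_zero.1 hr] at he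
      rw [he, neg_zero] at hZ
      exact hZ0 (pow_eq_zero_iff two_ne_zero |>.1 hZ)
    apply hne
    rw [hr, Complex.re_ofReal_mul, Complex.im_ofReal_mul, hvr, hvi]
    field_simp
  have hz : ∀ e, omegaSq k b c e = 0 ↔ -omegaSq k b c e = 0 := fun e => neg_eq_zero.symm
  obtain ⟨f₁, hd₁, hs₁, hn₁⟩ := exists_differentiable_sq_eq_sub
    (hroot (α + β₁ * Complex.I) (by rw [hz, hfac]; simp) hδ.1)
  obtain ⟨f₂, hd₂, hs₂, hn₂⟩ := exists_differentiable_sq_eq_sub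
    (hroot (α - β₁ * Complex.I) (by rw [hz, hfac]; simp) hδ.2.1)
  obtain ⟨f₃, hd₃, hs₃, hn₃⟩ := exists_differentiable_sq_eq_sub
    (hroot (-α + β₂ * Complex.I) (by rw [hz, hfac]; simp) hδ.2.2.1)
  obtain ⟨f₄, hd₄, hs₄, hn₄⟩ := exists_differentiable_sq_eq_sub
    (hroot (-α - β₂ * Complex.I) (by rw [hz, hfac]; simp) hδ.2.2.2)
  set L : ℝ → ℂ := fun s => z + (s - z.im : ℝ) * v with hL
  have hLd : ∀ s, HasDerivAt L v s := fun s => by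
    have h3 := ((((hasDerivAt_id s).sub_const z.im).ofReal_comp).mul_const v).const_add z
    exact h3.congr_deriv (by simp)
  obtain ⟨Y, hYd, hYs, hY0⟩ : ∃ Y : ℝ → ℂ, Differentiable ℝ Y ∧
      (∀ s, Y s ^ 2 = -omegaSq k b c (L s)) ∧ ∀ s, Y s ≠ 0 := by
    have hsub : Differentiable ℝ fun s : ℝ => s - z.im := by fun_prop
    -- Each factor of `P` on the line is `v` times a real number minus a nonreal constant, so it has
    -- a global square root; the four powers of `v` contribute `v²`.
    refine ⟨fun s => v ^ 2 * (f₁ (s - z.im) * f₂ (s - z.im) * (f₃ (s - z.im) * f₄ (s - z.im))),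
      (((hd₁.comp hsub).mul (hd₂.comp hsub)).mul ((hd₃.comp hsub).mul (hd₄.comp hsub))).const_mul _,
      fun s => ?_, fun s => mul_ne_zero (pow_ne_zero _ hv0)
        (mul_ne_zero (mul_ne_zero (hn₁ _) (hn₂ _)) (mul_ne_zero (hn₃ _) (hn₄ _)))⟩
    simp only [mul_pow, hs₁, hs₂, hs₃, hs₄]
    rw [hfac]
    simp only [hL]
    field_simp
    ring
  have hend : L z.im = z := by simp [hL]
  obtain ⟨Y, hYd, hYs, hY0, hYe⟩ : ∃ Y : ℝ → ℂ, Differentiable ℝ Y ∧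
      (∀ s, Y s ^ 2 = -omegaSq k b c (L s)) ∧ (∀ s, Y s ≠ 0) ∧ Y z.im = Z := by
    have := hYs z.im
    rw [hend, ← hZ] at this
    rcases sq_eq_sq_iff_eq_or_eq_neg.1 this with h | h
    · exact ⟨Y, hYd, hYs, hY0, h⟩
    · exact ⟨fun s => -Y s, hYd.neg, fun s => by rw [neg_sq, hYs],
        fun s => neg_ne_zero.2 (hY0 s), by simp [h]⟩
  have him : ∀ s, (L s).im = s := fun s => by
    rw [hL]; simp only [Complex.add_im, Complex.im_ofReal_mul, hvi]; ring
  refine ⟨L, Y, v, hLd, him, hend, hYe, hY0, hYs, fun s => ?_⟩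
  have h3 := ((hYd s).hasDerivAt.pow 2).unique
    ((hasDerivAt_neg_omegaSq (k := k) (b := b) (c := c) (hLd s)).congr_of_eventuallyEq
      (Eventually.of_forall hYs))
  refine (hYd s).hasDerivAt.congr_deriv ?_
  have := hY0 s
  field_simp
  push_cast at h3
  linear_combination h3

end Branch

/-! ### The modulus of the multiplier in separated form. -/

section Floquet

variable {k b c : ℝ}

theorem laxQ_eq_omegaSq (k b c : ℝ) (ζ : ℂ) :
    laxQ (freq k b) c ((4 * freq k b * b + 3 * b ^ 2 + (1 - k ^ 2) ^ 2) / 4) ζ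
      = omegaSq k b c ζ := by
  rw [laxQ, omegaSq]; push_cast; ring

theorem integral_laxA (hk0 : 0 < k) (hk1 : k < 1) (ζ : ℂ) :
    ∫ x in (0 : ℝ)..jacobiPeriod k, laxA (ampSq k b) (freq k b) ζ x
      = -Complex.I * jacobiPeriod k * (ζ ^ 2 - quasiConst k b) := by
  have hw : Continuous fun x => (ampSq k b x : ℂ) :=
    Complex.continuous_ofReal.comp (continuous_ampSq hk0.le hk1 b)
  have h1 : ∀ x, laxA (ampSq k b) (freq k b) ζ x =
      Complex.I / 2 * (ampSq k b x : ℂ) + (-Complex.I * ζ ^ 2 + Complex.I / 2 * (freq k b : ℂ)) :=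
    fun x => by rw [laxA]; ring
  simp only [h1]
  have hw' : Continuous fun x => Complex.I / 2 * (ampSq k b x : ℂ) := continuous_const.mul hw
  rw [intervalIntegral.integral_add (hw'.intervalIntegrable _ _) (by simp), intervalIntegral.integral_const_mul, intervalIntegral.integral_ofReal,
    integral_ampSq hk0.le hk1, intervalIntegral.integral_const, quasiConst, Complex.real_smul]
  push_cast
  ring

/-- Both sides have the same derivative along a line from the real axis to `z`, and both tend to `0`
at the axis: the left because real parameters give unimodular multipliers, the right by
`tendsto_sepG_sub`. -/
theorem log_norm_sq_floquetMul {ψ : ℝ → ℂ} {u : ℂ} (hk0 : 0 < k) (hk1 : k < 1) (hkb : k ^ 2 ≤ b)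
    (hb1 : b ≤ 1) (hc : c ^ 2 = b * (1 - b) * (b - k ^ 2))
    (h : IsStationaryNLS (ellipticSol k b c) ψ (ampSq k b) (freq k b) c
      ((4 * freq k b * b + 3 * b ^ 2 + (1 - k ^ 2) ^ 2) / 4) (jacobiPeriod k) u)
    {z Z : ℂ} (hz : 0 < z.im) (hZ : Z ^ 2 = -omegaSq k b c z) (hZ0 : Z ≠ 0) :
    Real.log (‖floquetMul (ellipticSol k b c) ψ (ampSq k b) (freq k b) (jacobiPeriod k) u z
      (Complex.I * Z)‖ ^ 2) =
      jacobiPeriod k * (sepG z Z - bandIntegral k b (sepQ k b z Z)) := by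
  obtain ⟨ζ, Y, v, hζ, him, hze, hYe, hY0, hY, hYd⟩ := exists_line_branch hk0 hk1 hkb hb1 hc hZ hZ0
  set m : ℝ → ℂ := fun s => floquetMul (ellipticSol k b c) ψ (ampSq k b) (freq k b)
    (jacobiPeriod k) u (ζ s) (Complex.I * Y s) with hm
  set E := (4 * freq k b * b + 3 * b ^ 2 + (1 - k ^ 2) ^ 2) / 4 with hE
  have hQ : ∀ s, (Complex.I * Y s) ^ 2 = laxQ (freq k b) c E (ζ s) := fun s => by
    rw [hE, laxQ_eq_omegaSq, mul_pow, Complex.I_sq, hY]; ring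
  have hIY : ∀ s, Complex.I * Y s ≠ 0 := fun s => mul_ne_zero Complex.I_ne_zero (hY0 s)
  have hm0 : ∀ s, m s ≠ 0 := fun s => h.floquetMul_ne_zero (hIY s) (hQ s)
  have hmd : ∀ s, HasDerivAt (fun t => Real.log (‖m t‖ ^ 2))
      (jacobiPeriod k * (-2 * (v / Y s * (ζ s ^ 2 - quasiConst k b)).im)) s := fun s => by
    have h1 := (h.hasDerivAt_floquetMul (hζ s) ((hYd s).continuousAt.const_mul Complex.I)
      (hIY s) hQ).norm_sq
    refine (h1.log (by have := norm_pos_iff.2 (hm0 s); positivity)).congr_deriv ?_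
    rw [integral_laxA hk0 hk1]
    have e : -Complex.I * v / (Complex.I * Y s) *
        (-Complex.I * jacobiPeriod k * (ζ s ^ 2 - quasiConst k b)) =
        (jacobiPeriod k : ℝ) * (Complex.I * (v / Y s * (ζ s ^ 2 - quasiConst k b))) := by
      have := hY0 s
      have := Complex.I_ne_zero
      field_simp
    rw [e, Complex.inner]
    have hn : ‖m s‖ ≠ 0 := norm_ne_zero_iff.2 (hm0 s)
    have e2 : ∀ (p r : ℂ), (p * r * (starRingEnd ℂ) p).re = ‖p‖ ^ 2 * r.re := fun p r => by
      rw [mul_right_comm, Complex.mul_conj, Complex.normSq_eq_norm_sq, Complex.re_ofReal_mul]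
    change 2 * (m s * _ * (starRingEnd ℂ) (m s)).re / ‖m s‖ ^ 2 = _
    rw [e2, Complex.re_ofReal_mul, Complex.I_mul_re]
    field_simp
  have hGd : ∀ s, 0 < s → HasDerivAt
      (fun t => sepG (ζ t) (Y t) - bandIntegral k b (sepQ k b (ζ t) (Y t)))
      (-2 * (v / Y s * (ζ s ^ 2 - quasiConst k b)).im) s := fun s hs =>
    hasDerivAt_sepG_sub hk0 hk1 hkb hc
      ((hζ s).congr_deriv (by rw [div_mul_cancel₀ _ (hY0 s)])) (hYd s)
      (by rw [him]; exact hs.ne') (hY s)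
  set D : ℝ → ℝ := fun t => Real.log (‖m t‖ ^ 2) - jacobiPeriod k *
    (sepG (ζ t) (Y t) - bandIntegral k b (sepQ k b (ζ t) (Y t))) with hD
  have hDd : ∀ s, 0 < s → HasDerivAt D 0 s := fun s hs =>
    ((hmd s).sub ((hGd s hs).const_mul _)).congr_deriv (sub_self _)
  have hconst : ∀ s, 0 < s → D s = D z.im := fun s hs =>
    isOpen_Ioi.is_const_of_deriv_eq_zero isPreconnected_Ioi
      (fun t ht => (hDd t ht).differentiableAt.differentiableWithinAt)
      (fun t ht => (hDd t ht).deriv) (Set.mem_Ioi.2 hs) (Set.mem_Ioi.2 hz)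
  have hζ0 : ζ 0 = ((ζ 0).re : ℝ) := Complex.ext (by simp) (by simp [him])
  have hm1 : ‖m 0‖ = 1 := by
    have := h.norm_floquetMul_real (ζ 0).re (hIY 0) (by rw [← hζ0]; exact hQ 0)
    rw [← hζ0] at this
    exact this
  have hL : Tendsto (fun t => Real.log (‖m t‖ ^ 2)) (𝓝[>] 0) (𝓝 0) := by
    have := (hmd 0).continuousAt.tendsto
    rw [hm1, one_pow, Real.log_one] at this
    exact this.mono_left nhdsWithin_le_nhds
  have hre : Tendsto (fun s => (ζ s).re) (𝓝[>] 0) (𝓝 (ζ 0).re) :=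
    (Complex.continuous_re.continuousAt.comp (hζ 0).continuousAt).tendsto.mono_left
      nhdsWithin_le_nhds
  have hims : Tendsto (fun s => (ζ s).im) (𝓝[>] 0) (𝓝 0) := by
    simp only [him]; exact tendsto_id.mono_left nhdsWithin_le_nhds
  have hne : ∀ᶠ s in 𝓝[>] (0 : ℝ), (ζ s).im ≠ 0 := by
    filter_upwards [self_mem_nhdsWithin] with s hs
    rw [him]; exact (Set.mem_Ioi.1 hs).ne'
  have hYre : Tendsto (fun s => (Y s).re) (𝓝[>] 0) (𝓝 (Y 0).re) :=
    (Complex.continuous_re.continuousAt.comp (hYd 0).continuousAt).tendsto.mono_left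
      nhdsWithin_le_nhds
  have hY00 : (Y 0).re ≠ 0 := by
    intro h0
    have h1 := re_sq_root (hY 0)
    have h2 := realPoly_pos hk0 hk1 hkb hb1 hc (ζ 0).re
    rw [him, h0] at h1
    rw [realPoly] at h2
    nlinarith [sq_nonneg (Y 0).im]
  have hG : Tendsto (fun t => sepG (ζ t) (Y t) - bandIntegral k b (sepQ k b (ζ t) (Y t)))
      (𝓝[>] 0) (𝓝 0) := by
    -- On the real axis `P > 0`, so `Re Y ≠ 0` and `g → ±∞`. The sign `-` reduces to `+` because
    -- `g`, `q` and `F` are odd under `Y ↦ -Y`.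
    rcases lt_or_gt_of_ne hY00 with hneg | hpos
    · have h1 : Tendsto (fun t => sepG (ζ t) (-Y t)) (𝓝[>] 0) atTop := by
        have := hYre.neg.pos_mul_atTop (by linarith) tendsto_inv_nhdsGT_zero
        refine this.congr fun t => ?_
        rw [sepG, him, Complex.neg_re, div_eq_mul_inv]
      have h2 := tendsto_sepG_sub hk0 hk1 hkb hb1 hc (Y := fun t => -Y t) hre hims h1 hne
        fun s => by rw [neg_sq, hY]
      simp only [sepG_neg, sepQ_neg, bandIntegral_neg] at h2
      have h3 := h2.neg
      rw [neg_zero] at h3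
      exact h3.congr fun t => by ring
    · have h1 : Tendsto (fun t => sepG (ζ t) (Y t)) (𝓝[>] 0) atTop := by
        have := hYre.pos_mul_atTop hpos tendsto_inv_nhdsGT_zero
        refine this.congr fun t => ?_
        rw [sepG, him, div_eq_mul_inv]
      exact tendsto_sepG_sub hk0 hk1 hkb hb1 hc hre hims h1 hne hY
  have hD0 : Tendsto D (𝓝[>] 0) (𝓝 0) := by
    have := hL.sub (hG.const_mul (jacobiPeriod k))
    rw [mul_zero, sub_zero] at this
    exact this
  have hDz : D z.im = 0 := by
    refine tendsto_nhds_unique (tendsto_const_nhds.congr' ?_) hD0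
    filter_upwards [self_mem_nhdsWithin] with s hs
    exact (hconst s hs).symm
  have := sub_eq_zero.1 hDz
  rw [hm] at this
  simpa only [hze, hYe] using this

/-- The Lax spectrum in the upper half plane in separated coordinates. -/
theorem mem_laxSpectrum_iff_sepG (hk0 : 0 < k) (hk1 : k < 1) (hkb : k ^ 2 ≤ b)
    (hb1 : b ≤ 1) (hc : c ^ 2 = b * (1 - b) * (b - k ^ 2)) {z : ℂ} (hz : 0 < z.im) :
    z ∈ laxSpectrum (ellipticSol k b c) (freq k b) ↔
      ∃ Y : ℂ, Y ^ 2 = -omegaSq k b c z ∧ sepG z Y = bandIntegral k b (sepQ k b z Y) := by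
  obtain ⟨ψ, u, h⟩ := isStationary_ellipticSol hk0 hk1 hkb hb1 hc
  have hT := jacobiPeriod_pos hk0.le hk1
  have hb0 : 0 < b := (by positivity : 0 < k ^ 2).trans_le hkb
  constructor
  · intro hmem
    obtain ⟨Ω, hΩ, hn⟩ := h.exists_norm_eq_one_of_mem hmem
    rw [laxQ_eq_omegaSq] at hΩ
    have hY : (-Complex.I * Ω) ^ 2 = -omegaSq k b c z := by
      rw [mul_pow, neg_sq, Complex.I_sq, hΩ]; ring
    refine ⟨-Complex.I * Ω, hY, ?_⟩
    -- At a root of `Ω` no multiplier is available, but `Y = 0` makes `g`, `q` and `F(q)` all zero.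
    by_cases hΩ0 : Ω = 0
    · simp [hΩ0, sepG, sepQ, sepV, bandIntegral_zero]
    · have h1 := log_norm_sq_floquetMul hk0 hk1 hkb hb1 hc h hz hY
        (mul_ne_zero (neg_ne_zero.2 Complex.I_ne_zero) hΩ0)
      rw [show Complex.I * (-Complex.I * Ω) = Ω by
        linear_combination (-Ω) * Complex.I_sq, hn hΩ0, one_pow, Real.log_one] at h1
      exact sub_eq_zero.1 ((mul_eq_zero.1 h1.symm).resolve_left hT.ne')
  · rintro ⟨Y, hY, hG⟩
    by_cases hY0 : Y = 0
    · refine h.root_mem_laxSpectrum ?_ hz.ne' ?_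
      · have h0 : jacobiAm k 0 = 0 := by
          have := jacobiAm_ellipticF hk0.le hk1 0
          rwa [show ellipticF k 0 = 0 by simp [ellipticF]] at this
        simp [ampSq, jacobiSn, h0, hb0.ne']
      · rw [laxQ_eq_omegaSq]
        rw [hY0] at hY
        simpa using hY.symm
    · have h1 := log_norm_sq_floquetMul hk0 hk1 hkb hb1 hc h hz hY hY0
      rw [hG, sub_self, mul_zero] at h1
      have hQ : (Complex.I * Y) ^ 2 = omegaSq k b c z := by
        rw [mul_pow, Complex.I_sq, hY]; ring
      have hQ' := hQ.trans (laxQ_eq_omegaSq k b c z).symm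
      have hIY := mul_ne_zero Complex.I_ne_zero hY0
      refine h.mem_laxSpectrum_of_norm_eq_one hIY hQ' ?_
      have hp := norm_pos_iff.2 (h.floquetMul_ne_zero hIY hQ')
      have := Real.eq_one_of_pos_of_log_eq_zero (by positivity) h1
      exact (pow_eq_one_iff_of_nonneg hp.le two_ne_zero).1 this

end Floquet

/-! ### Reconstruction of `ζ` and `Y` from `q` and the real part. -/

section BandPoint

/-- The squared modulus of the point of the spectrum with real part `x` and separation
variable `q`. -/
noncomputable def bandRho (k b c x q : ℝ) : ℝ :=
  (bandTau b q - freq k b) / 2 - c * x / bandTau b q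
    - bandIntegral k b q * (q * √(bandWeight k q)) / (2 * bandTau b q)

/-- The point of the spectrum with real part `x` and separation variable `q`. -/
noncomputable def bandPoint (k b c x q : ℝ) : ℂ := ⟨x, √(bandRho k b c x q - x ^ 2)⟩

/-- The real part of a point of the spectrum. -/
noncomputable def bandAbs (k b q : ℝ) : ℝ := √(bandTau b q - bandIntegral k b q ^ 2) / 2

/-- The part of the spectrum in the upper half plane, on which `ε = ±1` is the sign of the real
part. -/
noncomputable def bandArc (k b c ε q : ℝ) : ℂ := bandPoint k b c (ε * bandAbs k b q) q

variable {k b c : ℝ}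

theorem four_mul_bandAbs_sq {ε q : ℝ} (hε : ε ^ 2 = 1)
    (hF : bandIntegral k b q ^ 2 ≤ bandTau b q) :
    4 * (ε * bandAbs k b q) ^ 2 = bandTau b q - bandIntegral k b q ^ 2 := by
  rw [mul_pow, hε, bandAbs, div_pow, Real.sq_sqrt (sub_nonneg.2 hF)]; ring

theorem bandRho_vertex_pos (hk0 : 0 < k) (hkb : k ^ 2 ≤ b)
    (hc : c ^ 2 = b * (1 - b) * (b - k ^ 2)) {τ x : ℝ} (hτ : 0 < τ) (hbτ : 1 - b ≤ τ)
    (hx : 4 * x ^ 2 ≤ τ) : 0 < τ * (τ - freq k b) - 2 * c * x - 2 * τ * x ^ 2 := by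
  have hk2 : 0 < k ^ 2 := by positivity
  have hb0 : 0 < b := hk2.trans_le hkb
  have h1 : (2 * c * x) ^ 2 < (τ * (b - k ^ 2 / 2)) ^ 2 := by
    have h3 : c ^ 2 ≤ b * (b - k ^ 2) * τ := by
      rw [hc, mul_right_comm]
      exact mul_le_mul_of_nonneg_left hbτ (mul_nonneg hb0.le (sub_nonneg.2 hkb))
    calc (2 * c * x) ^ 2 = c ^ 2 * (4 * x ^ 2) := by ring
      _ ≤ b * (b - k ^ 2) * τ * τ := mul_le_mul h3 hx (by positivity) ((sq_nonneg c).trans h3)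
      _ < (τ * (b - k ^ 2 / 2)) ^ 2 := by
        have : 0 < τ ^ 2 * (k ^ 2) ^ 2 := by positivity
        nlinarith
  have h2 : 2 * c * x < τ * (b - k ^ 2 / 2) :=
    lt_of_pow_lt_pow_left₀ 2 (mul_nonneg hτ.le (by linarith)) h1
  have h3 : τ * (b - k ^ 2 / 2) ≤ τ * (τ - freq k b - 2 * x ^ 2) :=
    mul_le_mul_of_nonneg_left (by rw [freq]; linarith) hτ.le
  linarith

/-- This makes the reconstructed imaginary part strictly positive. The claim becomes `F V < L` for a
quantity `L > 0`, and `L² - F² V²` is four times `τ ((P'(x) / 2)² + F² P(x))`, up to notation: the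
square is that of `2x³ - ω x - c/2`. -/
theorem sq_lt_bandRho (hk0 : 0 < k) (hk1 : k < 1) (hkb : k ^ 2 ≤ b) (hb1 : b ≤ 1)
    (hc : c ^ 2 = b * (1 - b) * (b - k ^ 2)) {x q : ℝ} (hq : 0 ≤ q) (hτ : 0 < bandTau b q)
    (hx : 4 * x ^ 2 = bandTau b q - bandIntegral k b q ^ 2) : x ^ 2 < bandRho k b c x q := by
  have hv := bandRho_vertex_pos hk0 hkb hc hτ (by rw [bandTau]; nlinarith)
    (by nlinarith [sq_nonneg (bandIntegral k b q)] : 4 * x ^ 2 ≤ bandTau b q)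
  have hP := realPoly_pos hk0 hk1 hkb hb1 hc x
  have hF := bandIntegral_nonneg hk0 hk1 hkb hb1 hq
  have hs := Real.sq_sqrt (bandWeight_pos hk0 hk1 q).le
  have hV : (q * √(bandWeight k q)) ^ 2 = bandTau b q * (bandTau b q - freq k b) ^ 2
      - 4 * omegaConst k b * bandTau b q - c ^ 2 := by
    rw [resolvent_factor hc, mul_pow, hs, bandWeight, bandTau]; ring
  have hV0 : 0 ≤ q * √(bandWeight k q) := mul_nonneg hq (Real.sqrt_nonneg _)
  suffices h : bandIntegral k b q * (q * √(bandWeight k q)) <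
      bandTau b q * (bandTau b q - freq k b) - 2 * c * x - 2 * bandTau b q * x ^ 2 by
    have e : bandRho k b c x q - x ^ 2 = (bandTau b q * (bandTau b q - freq k b) - 2 * c * x
      - 2 * bandTau b q * x ^ 2 - bandIntegral k b q * (q * √(bandWeight k q))) /
        (2 * bandTau b q) := by
      rw [bandRho]; field_simp; ring
    rw [← sub_pos, e]
    exact div_pos (sub_pos.2 h) (by positivity)
  rcases hF.eq_or_lt with h0 | h0
  · rw [← h0, zero_mul]; exact hv
  · refine lt_of_pow_lt_pow_left₀ 2 hv.le ?_
    rw [mul_pow, hV]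
    have hN := sq_nonneg (2 * x ^ 3 - freq k b * x - c / 2)
    have hg : 0 < bandIntegral k b q ^ 2 * realPoly k b c x := by positivity
    have key : 0 < bandTau b q * ((2 * x ^ 3 - freq k b * x - c / 2) ^ 2
        + bandIntegral k b q ^ 2 * realPoly k b c x) := by positivity
    rw [realPoly] at key
    have hF2 : bandIntegral k b q ^ 2 = bandTau b q - 4 * x ^ 2 := by linarith
    rw [hF2] at key ⊢
    nlinarith

theorem exists_im_sqrt {g V x y ω c p τ : ℝ} (hτ : 0 < τ) (hτg : τ = g ^ 2 + 4 * x ^ 2)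
    (hV : V ^ 2 = τ * (τ - ω) ^ 2 - 4 * p * τ - c ^ 2)
    (hgV : g * V = τ * (τ - ω - 2 * (x ^ 2 + y ^ 2)) - 2 * c * x) :
    ∃ Z : ℝ, g * Z = 2 * x ^ 3 - 2 * x * y ^ 2 - ω * x - c / 2 ∧
      4 * x * Z = V - g * (2 * x ^ 2 - 2 * y ^ 2 - ω + τ) ∧
      (g * y) ^ 2 - Z ^ 2 = x ^ 4 - 6 * x ^ 2 * y ^ 2 + y ^ 4 - ω * (x ^ 2 - y ^ 2) - c * x + p := by
  obtain ⟨N, hN⟩ : ∃ N, N = 2 * x ^ 3 - 2 * x * y ^ 2 - ω * x - c / 2 := ⟨_, rfl⟩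
  obtain ⟨M, hM⟩ : ∃ M, M = 2 * x ^ 2 - 2 * y ^ 2 - ω + τ := ⟨_, rfl⟩
  obtain ⟨Z, hZτ⟩ : ∃ Z, τ * Z = g * N + x * (V - g * M) :=
    ⟨(g * N + x * (V - g * M)) / τ, by field_simp⟩
  have h1 : g * (V - g * M) = 4 * x * N := by
    rw [hN, hM]; linear_combination hgV + (2 * x ^ 2 - 2 * y ^ 2 - ω + τ) * hτg
  have h2 : g * Z = N := by
    apply mul_left_cancel₀ hτ.ne'
    linear_combination g * hZτ + x * h1 - N * hτg
  have h3 : 4 * x * Z = V - g * M := by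
    apply mul_left_cancel₀ hτ.ne'
    linear_combination 4 * x * hZτ - g * h1 - (V - g * M) * hτg
  refine ⟨Z, h2.trans hN, by rw [h3, hM], mul_left_cancel₀ hτ.ne' ?_⟩
  have hZ2 : 4 * τ * Z ^ 2 = 4 * N ^ 2 + (V - g * M) ^ 2 := by
    rw [← h2, ← h3]; linear_combination 4 * Z ^ 2 * hτg
  rw [hN, hM] at hZ2
  subst hτg
  linear_combination (-1 / 4) * hZ2 - (1 / 4) * hV
    + ((2 * x ^ 2 - 2 * y ^ 2 - ω + (g ^ 2 + 4 * x ^ 2)) / 2) * hgV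

theorem exists_root_bandPoint (hk0 : 0 < k) (hk1 : k < 1) (hkb : k ^ 2 ≤ b) (hb1 : b ≤ 1)
    (hc : c ^ 2 = b * (1 - b) * (b - k ^ 2)) {x q : ℝ} (hq : 0 ≤ q) (hτ : 0 < bandTau b q)
    (hx : 4 * x ^ 2 = bandTau b q - bandIntegral k b q ^ 2) :
    ∃ Y : ℂ, Y ^ 2 = -omegaSq k b c (bandPoint k b c x q) ∧
      sepG (bandPoint k b c x q) Y = bandIntegral k b q ∧ sepQ k b (bandPoint k b c x q) Y = q := by
  have hρ := sq_lt_bandRho hk0 hk1 hkb hb1 hc hq hτ hx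
  set y := √(bandRho k b c x q - x ^ 2) with hy
  have hy0 : 0 < y := Real.sqrt_pos.2 (sub_pos.2 hρ)
  have hy2 : y ^ 2 = bandRho k b c x q - x ^ 2 := Real.sq_sqrt (sub_pos.2 hρ).le
  have hs := Real.sq_sqrt (bandWeight_pos hk0 hk1 q).le
  have hV : (q * √(bandWeight k q)) ^ 2 = bandTau b q * (bandTau b q - freq k b) ^ 2
      - 4 * omegaConst k b * bandTau b q - c ^ 2 := by
    rw [resolvent_factor hc, mul_pow, hs, bandWeight, bandTau]; ring
  have hgV : bandIntegral k b q * (q * √(bandWeight k q)) =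
      bandTau b q * (bandTau b q - freq k b - 2 * (x ^ 2 + y ^ 2)) - 2 * c * x := by
    rw [hy2, bandRho]; field_simp; ring
  have hQ : q * √(bandWeight k q) / √((bandTau b q + b) * (bandTau b q + b - k ^ 2)) = q := by
    rw [show (bandTau b q + b) * (bandTau b q + b - k ^ 2) = bandWeight k q by
      rw [bandWeight, bandTau]; ring]
    exact mul_div_cancel_right₀ _ (Real.sqrt_pos.2 (bandWeight_pos hk0 hk1 q)).ne'
  set τ := bandTau b q
  set g := bandIntegral k b q
  set V := q * √(bandWeight k q)
  have hτg : g ^ 2 = τ - 4 * x ^ 2 := by linarith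
  obtain ⟨Z, h2, h3, h4⟩ := exists_im_sqrt hτ (by linarith : τ = g ^ 2 + 4 * x ^ 2) hV hgV
  have hG : sepG (bandPoint k b c x q) ⟨g * y, Z⟩ = g := mul_div_cancel_right₀ _ hy0.ne'
  have hT : sepTau (bandPoint k b c x q) ⟨g * y, Z⟩ = τ := by
    rw [sepTau, hG]; change g ^ 2 + 4 * x ^ 2 = τ; linarith
  refine ⟨⟨g * y, Z⟩, ?_, hG, ?_⟩
  · have e : -omegaSq k b c (bandPoint k b c x q)
        = bandPoint k b c x q ^ 4 - (freq k b : ℂ) * bandPoint k b c x q ^ 2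
          - (c : ℂ) * bandPoint k b c x q + (omegaConst k b : ℝ) := by
      rw [omegaSq, omegaConst]; push_cast; ring
    have hzr : (bandPoint k b c x q).re = x := rfl
    have hzi : (bandPoint k b c x q).im = y := rfl
    rw [e, show bandPoint k b c x q ^ 4 = bandPoint k b c x q * bandPoint k b c x q *
      (bandPoint k b c x q * bandPoint k b c x q) by ring, sq, sq]
    apply Complex.ext
    · simp [hzr, hzi]
      linear_combination h4
    · simp [hzr, hzi]
      linear_combination 2 * y * h2
  · have hVe : sepV k b (bandPoint k b c x q) ⟨g * y, Z⟩ = V := by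
      rw [sepV, hT, hG]
      change g * (2 * x ^ 2 - 2 * y ^ 2 - freq k b + τ) + 4 * x * Z = V
      rw [h3]; ring
    rw [sepQ, hVe, hT, hQ]

end BandPoint

/-! ### The arcs `q ↦ ζ(q)` that make up the spectrum above the real axis. -/

section BandArc

variable {k b c : ℝ}

theorem eq_bandPoint (hk0 : 0 < k) (hk1 : k < 1) (hkb : k ^ 2 ≤ b)
    (hc : c ^ 2 = b * (1 - b) * (b - k ^ 2)) {z Y : ℂ} (hz : 0 < z.im)
    (hY : Y ^ 2 = -omegaSq k b c z) (hG : sepG z Y = bandIntegral k b (sepQ k b z Y))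
    (hτ : 0 < bandTau b (sepQ k b z Y)) : z = bandPoint k b c z.re (sepQ k b z Y) := by
  have h1 := sepG_mul_sepV hz.ne' hY
  rw [sepV_eq hk0 hk1 hkb hc hz.ne' hY, hG, ← bandTau_sepQ hk0 hk1 hkb hc hz.ne' hY] at h1
  have h2 : bandRho k b c z.re (sepQ k b z Y) - z.re ^ 2 = z.im ^ 2 := by
    rw [bandRho, h1]; field_simp; ring
  refine Complex.ext rfl ?_
  rw [bandPoint, h2, Real.sqrt_sq hz.le]

theorem four_mul_re_sq (hk0 : 0 < k) (hk1 : k < 1) (hkb : k ^ 2 ≤ b)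
    (hc : c ^ 2 = b * (1 - b) * (b - k ^ 2)) {z Y : ℂ} (hz : 0 < z.im)
    (hY : Y ^ 2 = -omegaSq k b c z) (hG : sepG z Y = bandIntegral k b (sepQ k b z Y)) :
    4 * z.re ^ 2 = bandTau b (sepQ k b z Y) - bandIntegral k b (sepQ k b z Y) ^ 2 := by
  rw [bandTau_sepQ hk0 hk1 hkb hc hz.ne' hY, sepTau, hG]; ring

theorem exists_sepQ_nonneg (hk0 : 0 < k) (hk1 : k < 1) (hkb : k ^ 2 ≤ b)
    (hb1 : b ≤ 1) (hc : c ^ 2 = b * (1 - b) * (b - k ^ 2)) {z : ℂ} (hz : 0 < z.im)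
    (h : z ∈ laxSpectrum (ellipticSol k b c) (freq k b)) :
    ∃ Y : ℂ, Y ^ 2 = -omegaSq k b c z ∧ sepG z Y = bandIntegral k b (sepQ k b z Y) ∧
      0 ≤ sepQ k b z Y := by
  obtain ⟨Y, hY, hG⟩ := (mem_laxSpectrum_iff_sepG hk0 hk1 hkb hb1 hc hz).1 h
  rcases le_total 0 (sepQ k b z Y) with h0 | h0
  · exact ⟨Y, hY, hG, h0⟩
  · exact ⟨-Y, by rw [neg_sq, hY], by rw [sepG_neg, sepQ_neg, bandIntegral_neg, hG],
      by rw [sepQ_neg]; linarith⟩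

theorem bandArc_im_pos (hk0 : 0 < k) (hk1 : k < 1) (hkb : k ^ 2 ≤ b) (hb1 : b < 1)
    (hc : c ^ 2 = b * (1 - b) * (b - k ^ 2)) {ε q : ℝ} (hε : ε ^ 2 = 1) (hq : 0 ≤ q)
    (hF : bandIntegral k b q ^ 2 ≤ bandTau b q) : 0 < (bandArc k b c ε q).im :=
  Real.sqrt_pos.2 (sub_pos.2 (sq_lt_bandRho hk0 hk1 hkb hb1.le hc hq
    (by rw [bandTau]; nlinarith) (four_mul_bandAbs_sq hε hF)))

theorem bandArc_re (k b c ε q : ℝ) : (bandArc k b c ε q).re = ε * bandAbs k b q := rfl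

/-- The spectrum in the upper half plane consists of the points of the arcs. -/
theorem mem_laxSpectrum_iff_bandArc (hk0 : 0 < k) (hk1 : k < 1) (hkb : k ^ 2 ≤ b) (hb1 : b < 1)
    (hc : c ^ 2 = b * (1 - b) * (b - k ^ 2)) {z : ℂ} (hz : 0 < z.im) :
    z ∈ laxSpectrum (ellipticSol k b c) (freq k b) ↔ ∃ q, 0 ≤ q ∧
      bandIntegral k b q ^ 2 ≤ bandTau b q ∧ (z = bandArc k b c 1 q ∨ z = bandArc k b c (-1) q) := by
  have hτ : ∀ q, 0 < bandTau b q := fun q => by rw [bandTau]; nlinarith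
  constructor
  · intro h
    obtain ⟨Y, hY, hG, h0⟩ := exists_sepQ_nonneg hk0 hk1 hkb hb1.le hc hz h
    have h4 := four_mul_re_sq hk0 hk1 hkb hc hz hY hG
    have hF : bandIntegral k b (sepQ k b z Y) ^ 2 ≤ bandTau b (sepQ k b z Y) := by
      linarith [sq_nonneg z.re]
    have hx : z.re ^ 2 = (bandAbs k b (sepQ k b z Y)) ^ 2 := by
      have := four_mul_bandAbs_sq (one_pow 2) hF
      rw [one_mul] at this
      linarith
    have he := eq_bandPoint hk0 hk1 hkb hc hz hY hG (hτ _)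
    refine ⟨sepQ k b z Y, h0, hF, ?_⟩
    rcases sq_eq_sq_iff_eq_or_eq_neg.1 hx with h | h
    · left; rw [bandArc, one_mul, ← h]; exact he
    · right; rw [bandArc, neg_one_mul, ← h]; exact he
  · rintro ⟨q, hq, hF, h⟩
    obtain ⟨ε, hε, rfl⟩ : ∃ ε : ℝ, ε ^ 2 = 1 ∧ z = bandArc k b c ε q := by
      rcases h with h | h
      exacts [⟨1, by norm_num, h⟩, ⟨-1, by norm_num, h⟩]
    obtain ⟨Y, hY, hG, hQ⟩ := exists_root_bandPoint hk0 hk1 hkb hb1.le hc hq (hτ q)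
      (four_mul_bandAbs_sq hε hF)
    exact (mem_laxSpectrum_iff_sepG hk0 hk1 hkb hb1.le hc hz).2 ⟨Y, hY, by
      rw [bandArc, hG, hQ]⟩

/-- A point `ζ` determines `Y` up to sign, hence `q` up to sign, hence `q` once it is nonnegative.
-/
theorem bandArc_eq_imp (hk0 : 0 < k) (hk1 : k < 1) (hkb : k ^ 2 ≤ b) (hb1 : b < 1)
    (hc : c ^ 2 = b * (1 - b) * (b - k ^ 2)) {ε ε' q q' : ℝ} (hε : ε ^ 2 = 1) (hε' : ε' ^ 2 = 1)
    (hq : 0 ≤ q) (hq' : 0 ≤ q') (hF : bandIntegral k b q ^ 2 ≤ bandTau b q)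
    (hF' : bandIntegral k b q' ^ 2 ≤ bandTau b q')
    (h : bandArc k b c ε q = bandArc k b c ε' q') : q = q' := by
  obtain ⟨Y, hY, -, hQ⟩ := exists_root_bandPoint hk0 hk1 hkb hb1.le hc hq
    (by rw [bandTau]; nlinarith) (four_mul_bandAbs_sq hε hF)
  obtain ⟨Y', hY', -, hQ'⟩ := exists_root_bandPoint hk0 hk1 hkb hb1.le hc hq'
    (by rw [bandTau]; nlinarith) (four_mul_bandAbs_sq hε' hF')
  rw [bandArc, bandArc] at h
  rw [h] at hY hQ
  rw [← hY'] at hY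
  rcases sq_eq_sq_iff_eq_or_eq_neg.1 hY with e | e
  · rw [← hQ, e, hQ']
  · rw [e, sepQ_neg, hQ'] at hQ
    linarith

theorem continuous_bandArc (hk0 : 0 < k) (hk1 : k < 1) (hb1 : b < 1) (c ε : ℝ) :
    Continuous (bandArc k b c ε) := by
  have hτ : ∀ q, bandTau b q ≠ 0 := fun q => by rw [bandTau]; nlinarith
  have h1 := continuous_bandTau b
  have h2 := continuous_bandIntegral hk0 hk1 b
  have h3 : Continuous (bandWeight k) := by unfold bandWeight; fun_prop
  have h4 : Continuous (bandAbs k b) := by unfold bandAbs; fun_prop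
  have h5 : Continuous fun q => bandRho k b c (ε * bandAbs k b q) q := by
    unfold bandRho
    exact (((h1.sub continuous_const).div_const 2).sub
      ((continuous_const.mul (continuous_const.mul h4)).div h1 hτ)).sub
      ((h2.mul (continuous_id.mul h3.sqrt)).div (continuous_const.mul h1)
        fun q => mul_ne_zero two_ne_zero (hτ q))
  have h6 : Continuous fun q => ((ε * bandAbs k b q : ℝ) : ℂ) +
      (√(bandRho k b c (ε * bandAbs k b q) q - (ε * bandAbs k b q) ^ 2) : ℝ) * Complex.I := by
    fun_prop
  refine h6.congr fun q => ?_
  rw [bandArc, bandPoint, Complex.mk_eq_add_mul_I]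

theorem bandArc_zero (hb1 : b < 1) {α β₁ β₂ ε : ℝ} (hε : ε ^ 2 = 1) (hα : 0 ≤ α)
    (h4 : 4 * α ^ 2 = 1 - b) (hf : freq k b = 2 * α ^ 2 - β₁ ^ 2 - β₂ ^ 2)
    (hc' : c = 2 * α * (β₂ ^ 2 - β₁ ^ 2)) :
    bandArc k b c ε 0 = ⟨ε * α, √((β₁ ^ 2 + β₂ ^ 2) / 2 - ε * (β₂ ^ 2 - β₁ ^ 2) / 2)⟩ := by
  have hτ : bandTau b 0 = 4 * α ^ 2 := by rw [bandTau, h4]; ring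
  have hx : bandAbs k b 0 = α := by
    rw [bandAbs, bandIntegral_zero, hτ, show 4 * α ^ 2 - 0 ^ 2 = (2 * α) ^ 2 by ring,
      Real.sqrt_sq (by linarith)]
    ring
  have hα0 : α ≠ 0 := fun h => by rw [h] at h4; linarith
  rw [bandArc, bandPoint, hx, bandRho, hτ, bandIntegral_zero, hf, hc']
  congr 2
  field_simp
  linear_combination (-8) * α ^ 4 * hε

/-- The definition is a difference of two large quantities as `q → ∞`. Rationalising it in terms of
`i = 1 / τ` gives an expression continuous at `i = 0`. -/
theorem bandRho_eq (hk0 : 0 < k) (hk1 : k < 1) (hkb : k ^ 2 ≤ b) (hb1 : b ≤ 1)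
    (hc : c ^ 2 = b * (1 - b) * (b - k ^ 2)) {x q : ℝ} (hq : 0 ≤ q) (hτ : 0 < bandTau b q)
    (hω : freq k b < bandTau b q) (hx : 4 * x ^ 2 = bandTau b q - bandIntegral k b q ^ 2) {i W : ℝ}
    (hi : i = (bandTau b q)⁻¹)
    (hW : W = (1 - freq k b * i) ^ 2 - 4 * omegaConst k b * i ^ 2 - c ^ 2 * i ^ 3) :
    bandRho k b c x q = -c * x * i + (4 * omegaConst k b * i + c ^ 2 * i ^ 2 + 4 * x ^ 2 * W) /
      (2 * ((1 - freq k b * i) + √((1 - 4 * x ^ 2 * i) * W))) := by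
  have hF := bandIntegral_nonneg hk0 hk1 hkb hb1 hq
  have hs := Real.sq_sqrt (bandWeight_pos hk0 hk1 q).le
  have hV : (q * √(bandWeight k q)) ^ 2 = bandTau b q * (bandTau b q - freq k b) ^ 2
      - 4 * omegaConst k b * bandTau b q - c ^ 2 := by
    rw [resolvent_factor hc, mul_pow, hs, bandWeight, bandTau]; ring
  have hV0 : 0 ≤ q * √(bandWeight k q) := mul_nonneg hq (Real.sqrt_nonneg _)
  rw [bandRho]
  generalize q * √(bandWeight k q) = V at *
  generalize bandIntegral k b q = g at *
  generalize bandTau b q = τ at *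
  have hτi : i * τ = 1 := by rw [hi, inv_mul_cancel₀ hτ.ne']
  have hS2 : (g * V / τ ^ 2) ^ 2 = (1 - 4 * x ^ 2 * i) * W := by
    rw [div_pow, mul_pow, hV, show g ^ 2 = τ - 4 * x ^ 2 by linarith, hW, hi]
    field_simp
  have hS : √((1 - 4 * x ^ 2 * i) * W) = g * V / τ ^ 2 := by
    rw [← hS2, Real.sqrt_sq (by positivity)]
  have hd : 0 < (1 - freq k b * i) + g * V / τ ^ 2 := by
    have : 0 < 1 - freq k b * i := by
      rw [hi, ← div_eq_mul_inv, sub_pos, div_lt_one hτ]; exact hω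
    positivity
  have hρ : (τ - freq k b) / 2 - c * x / τ - g * V / (2 * τ)
      = -c * x * i + τ / 2 * ((1 - freq k b * i) - g * V / τ ^ 2) := by
    rw [hi]; field_simp; ring
  rw [hS, hρ, add_right_inj, eq_div_iff (by positivity)]
  linear_combination (-τ) * hS2 - τ * hW
    + (4 * x ^ 2 * W + 4 * omegaConst k b * i + c ^ 2 * i ^ 2) * hτi

theorem tendsto_bandArc (hk0 : 0 < k) (hk1 : k < 1) (hkb : k ^ 2 ≤ b) (hb1 : b < 1)
    (hc : c ^ 2 = b * (1 - b) * (b - k ^ 2)) (hC : 0 ≤ quasiConst k b) {ε : ℝ} (hε : ε ^ 2 = 1) :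
    Tendsto (bandArc k b c ε) atTop (𝓝 ((ε * √(quasiConst k b) : ℝ) : ℂ)) := by
  have hτ : ∀ q, 0 < bandTau b q := fun q => by rw [bandTau]; nlinarith
  have hx : Tendsto (fun q => ε * bandAbs k b q) atTop (𝓝 (ε * √(quasiConst k b))) := by
    have h1 := ((tendsto_bandTau_sub_sq hk0 hk1 hkb hb1.le hc).sqrt).div_const 2
    rw [show 4 * quasiConst k b = 2 ^ 2 * quasiConst k b by ring, Real.sqrt_mul (by norm_num),
      Real.sqrt_sq (by norm_num), mul_div_cancel_left₀ _ two_ne_zero] at h1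
    exact h1.const_mul ε
  have hi : Tendsto (fun q => (bandTau b q)⁻¹) atTop (𝓝 0) :=
    (tendsto_bandTau_atTop b).inv_tendsto_atTop
  set X := ε * √(quasiConst k b) with hX
  set Φ : ℝ × ℝ → ℝ := fun p => -c * p.2 * p.1 + (4 * omegaConst k b * p.1 + c ^ 2 * p.1 ^ 2
    + 4 * p.2 ^ 2 * ((1 - freq k b * p.1) ^ 2 - 4 * omegaConst k b * p.1 ^ 2 - c ^ 2 * p.1 ^ 3)) /
      (2 * ((1 - freq k b * p.1) + √((1 - 4 * p.2 ^ 2 * p.1) *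
        ((1 - freq k b * p.1) ^ 2 - 4 * omegaConst k b * p.1 ^ 2 - c ^ 2 * p.1 ^ 3)))) with hΦ
  have hΦc : ContinuousAt Φ (0, X) := by
    refine ContinuousAt.add (by fun_prop) (ContinuousAt.div (by fun_prop) (by fun_prop) ?_)
    norm_num
  -- At `1 / τ = 0` this says that `|ζ|²` tends to the square of the limiting real part, so the
  -- imaginary part tends to `0`.
  have hΦ0 : Φ (0, X) = X ^ 2 := by simp [hΦ]; ring
  have hρ : Tendsto (fun q => bandRho k b c (ε * bandAbs k b q) q) atTop (𝓝 (X ^ 2)) := by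
    rw [← hΦ0]
    refine (hΦc.tendsto.comp (hi.prodMk_nhds hx)).congr' ?_
    filter_upwards [(tendsto_bandTau_atTop b).eventually_gt_atTop (freq k b),
      eventually_ge_atTop 0] with q hω hq
    have hF : bandIntegral k b q ^ 2 ≤ bandTau b q :=
      (Real.le_sqrt (bandIntegral_nonneg hk0 hk1 hkb hb1.le hq)
        (hτ q).le).1 (bandIntegral_lt_sqrt hk0 hk1 hkb hb1.le hc hC hq).le
    exact (bandRho_eq hk0 hk1 hkb hb1.le hc hq (hτ q) hω (four_mul_bandAbs_sq hε hF) rfl rfl).symm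
  have hy := (hρ.sub (hx.pow 2)).sqrt
  rw [sub_self, Real.sqrt_zero] at hy
  have h6 := ((Complex.continuous_ofReal.tendsto _).comp hx).add
    (((Complex.continuous_ofReal.tendsto _).comp hy).mul_const Complex.I)
  rw [Complex.ofReal_zero, zero_mul, add_zero] at h6
  refine h6.congr fun q => ?_
  simp only [Function.comp_apply]
  rw [bandArc, bandPoint, Complex.mk_eq_add_mul_I]

end BandArc
open Filter Topology Set

/-! ### Topology of arcs, and assembly of the spectrum from its upper half. -/

section Bands

theorem isBand_image_Icc {f : ℝ → ℂ} {a b : ℝ} (hab : a < b) (hf : ContinuousOn f (Icc a b))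
    (hi : InjOn f (Icc a b)) : IsBand (f '' Icc a b) (f a) (f b) := by
  refine ⟨⟨⟨fun t => f ((iccHomeoI a b hab).symm t), ?_⟩, ?_, ?_⟩, ?_, ?_⟩
  · exact (continuousOn_iff_continuous_domRestrict.1 hf).comp (iccHomeoI a b hab).symm.continuous
  · simp
  · simp
  · intro s t hst
    exact (iccHomeoI a b hab).symm.injective (Subtype.ext (hi (Subtype.prop _) (Subtype.prop _) hst))
  · ext z
    constructor
    · rintro ⟨t, rfl⟩
      exact mem_image_of_mem f (Subtype.prop _)
    · rintro ⟨t, ht, rfl⟩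
      refine ⟨iccHomeoI a b hab ⟨t, ht⟩, ?_⟩
      change f ((iccHomeoI a b hab).symm (iccHomeoI a b hab ⟨t, ht⟩)) = f t
      rw [Homeomorph.symm_apply_apply]

theorem IsBand.conj {S : Set ℂ} {p q : ℂ} (h : IsBand S p q) :
    IsBand (conj '' S) (conj p) (conj q) := by
  obtain ⟨γ, hi, hr⟩ := h
  refine ⟨γ.map Complex.continuous_conj, fun s t hst => hi ((starRingEnd ℂ).injective hst), ?_⟩
  rw [Path.map_coe, range_comp, hr]

/-- Two arcs with a common initial point and no other common point form a band. -/
theorem isBand_union {f g : ℝ → ℂ} {a : ℝ} (ha : 0 < a) (hf : ContinuousOn f (Icc 0 a))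
    (hg : ContinuousOn g (Icc 0 a)) (hfi : InjOn f (Icc 0 a)) (hgi : InjOn g (Icc 0 a))
    (h0 : f 0 = g 0) (hfg : ∀ s ∈ Icc 0 a, ∀ t ∈ Icc 0 a, f s = g t → s = 0) :
    IsBand (f '' Icc 0 a ∪ g '' Icc 0 a) (f a) (g a) := by
  set h : ℝ → ℂ := fun t => if t ≤ 0 then f (-t) else g t with hh
  have hneg : ∀ t, t ≤ 0 → h t = f (-t) := fun t ht => if_pos ht
  have hpos : ∀ t, 0 ≤ t → h t = g t := fun t ht => by
    rcases ht.eq_or_lt with rfl | ht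
    · rw [hneg 0 le_rfl, neg_zero, h0]
    · exact if_neg ht.not_ge
  have hfg' : ∀ s ∈ Icc 0 a, ∀ t ∈ Icc 0 a, f s = g t → -s = t := fun s hs t ht hst => by
    have hs0 := hfg s hs t ht hst
    subst hs0
    rw [neg_zero, hgi (left_mem_Icc.2 ha.le) ht (h0.symm.trans hst)]
  have hc : ContinuousOn h (Icc (-a) a) := by
    rw [← Icc_union_Icc_eq_Icc (neg_nonpos.2 ha.le) ha.le]
    refine ContinuousOn.union_of_isClosed ?_ ?_ isClosed_Icc isClosed_Icc
    · refine (hf.comp continuous_neg.continuousOn fun t ht => ?_).congr fun t ht => hneg t ht.2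
      exact ⟨neg_nonneg.2 ht.2, neg_le.1 ht.1⟩
    · exact hg.congr fun t ht => hpos t ht.1
  have hi : InjOn h (Icc (-a) a) := by
    intro s hs t ht hst
    rcases le_total s 0 with h1 | h1 <;> rcases le_total t 0 with h2 | h2
    · rw [hneg s h1, hneg t h2] at hst
      exact neg_injective (hfi ⟨neg_nonneg.2 h1, neg_le.1 hs.1⟩ ⟨neg_nonneg.2 h2, neg_le.1 ht.1⟩ hst)
    · rw [hneg s h1, hpos t h2] at hst
      simpa using hfg' _ ⟨neg_nonneg.2 h1, neg_le.1 hs.1⟩ _ ⟨h2, ht.2⟩ hst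
    · rw [hpos s h1, hneg t h2] at hst
      simpa using (hfg' _ ⟨neg_nonneg.2 h2, neg_le.1 ht.1⟩ _ ⟨h1, hs.2⟩ hst.symm).symm
    · rw [hpos s h1, hpos t h2] at hst
      exact hgi ⟨h1, hs.2⟩ ⟨h2, ht.2⟩ hst
  have hb := isBand_image_Icc (by linarith : -a < a) hc hi
  rw [hneg (-a) (by linarith), neg_neg, hpos a ha.le] at hb
  convert hb using 1
  rw [← Icc_union_Icc_eq_Icc (neg_nonpos.2 ha.le) ha.le, image_union]
  congr 1
  · rw [image_congr fun t ht => hneg t ht.2, ← image_image f (fun t => -t), image_neg_eq_neg,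
      neg_Icc]
    simp
  · exact (image_congr fun t ht => hpos t ht.1).symm

theorem mem_realLine {z : ℂ} : z ∈ realLine ↔ z.im = 0 :=
  ⟨by rintro ⟨x, rfl⟩; simp, fun h => ⟨z.re, Complex.ext (by simp) (by simp [h])⟩⟩

variable {k b c : ℝ}

theorem laxSpectrum_eq (hk0 : 0 < k) (hk1 : k < 1) (hkb : k ^ 2 ≤ b) (hb1 : b ≤ 1)
    (hc : c ^ 2 = b * (1 - b) * (b - k ^ 2)) {S : Set ℂ}
    (hS : ∀ z : ℂ, 0 < z.im → (z ∈ laxSpectrum (ellipticSol k b c) (freq k b) ↔ z ∈ S))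
    (hS0 : ∀ z ∈ S, 0 ≤ z.im) :
    laxSpectrum (ellipticSol k b c) (freq k b) = realLine ∪ (S ∪ conj '' S) := by
  obtain ⟨ψ, u, h⟩ := isStationary_ellipticSol hk0 hk1 hkb hb1 hc
  ext z
  rcases lt_trichotomy z.im 0 with hz | hz | hz
  · have h1 : z ∈ laxSpectrum (ellipticSol k b c) (freq k b) ↔ conj z ∈ S := by
      rw [← hS (conj z) (by simpa using hz)]
      refine ⟨h.conj_mem_laxSpectrum, fun hm => ?_⟩
      simpa using h.conj_mem_laxSpectrum hm
    rw [h1]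
    constructor
    · exact fun hm => Or.inr (Or.inr ⟨_, hm, Complex.conj_conj z⟩)
    · rintro (hm | hm | ⟨w, hw, rfl⟩)
      · exact absurd (mem_realLine.1 hm) hz.ne
      · exact absurd (hS0 z hm) hz.not_ge
      · rwa [Complex.conj_conj]
  · have hr := mem_realLine.2 hz
    refine ⟨fun _ => Or.inl hr, fun _ => ?_⟩
    obtain ⟨x, rfl⟩ := hr
    exact h.real_mem_laxSpectrum x
  · rw [hS z hz]
    constructor
    · exact fun hm => Or.inr (Or.inl hm)
    · rintro (hm | hm | ⟨w, hw, rfl⟩)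
      · exact absurd (mem_realLine.1 hm) hz.ne'
      · exact hm
      · have := hS0 w hw
        rw [Complex.conj_im] at hz
        linarith

theorem omegaRoots_eq {α β₁ β₂ : ℝ} (hf : freq k b = 2 * α ^ 2 - β₁ ^ 2 - β₂ ^ 2)
    (hc' : c = 2 * α * (β₂ ^ 2 - β₁ ^ 2))
    (ho : omegaConst k b = (α ^ 2 + β₁ ^ 2) * (α ^ 2 + β₂ ^ 2)) :
    omegaRoots k b c = {(⟨α, β₁⟩ : ℂ), conj (⟨α, β₁⟩ : ℂ), ⟨-α, β₂⟩, conj (⟨-α, β₂⟩ : ℂ)} := by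
  have e1 : (⟨α, β₁⟩ : ℂ) = α + β₁ * Complex.I := Complex.mk_eq_add_mul_I _ _
  have e2 : (⟨-α, β₂⟩ : ℂ) = -α + β₂ * Complex.I := by
    rw [Complex.mk_eq_add_mul_I, Complex.ofReal_neg]
  ext z
  rw [omegaRoots, mem_ofPred_eq, ← neg_eq_zero, neg_omegaSq_eq hf hc' ho, e1, e2]
  simp only [mul_eq_zero, sub_eq_zero, mem_insert_iff, mem_singleton_iff, map_add, map_neg,
    map_mul, Complex.conj_ofReal, Complex.conj_I, mul_neg, ← sub_eq_add_neg, or_assoc]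

end Bands

/-! ### The three configurations `b = 1`, `C < 0` and `C ≥ 0`. -/

section Cases

variable {k b c : ℝ}

theorem bandIntegral_le_sqrt_iff (hk0 : 0 < k) (hk1 : k < 1) (hkb : k ^ 2 ≤ b) (hb1 : b ≤ 1)
    {q : ℝ} (hq : 0 ≤ q) :
    bandIntegral k b q ^ 2 ≤ bandTau b q ↔ bandIntegral k b q ≤ √(bandTau b q) :=
  (Real.le_sqrt (bandIntegral_nonneg hk0 hk1 hkb hb1 hq) (bandTau_nonneg hb1 q)).symm

theorem bandArc_one_zero (hb1 : b < 1) {α β₁ β₂ : ℝ} (hα : 0 ≤ α) (h1 : 0 < β₁)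
    (h4 : 4 * α ^ 2 = 1 - b) (hf : freq k b = 2 * α ^ 2 - β₁ ^ 2 - β₂ ^ 2)
    (hc' : c = 2 * α * (β₂ ^ 2 - β₁ ^ 2)) : bandArc k b c 1 0 = ⟨α, β₁⟩ := by
  rw [bandArc_zero hb1 (one_pow 2) hα h4 hf hc', one_mul,
    show (β₁ ^ 2 + β₂ ^ 2) / 2 - 1 * (β₂ ^ 2 - β₁ ^ 2) / 2 = β₁ ^ 2 by ring, Real.sqrt_sq h1.le]

theorem bandArc_neg_one_zero (hb1 : b < 1) {α β₁ β₂ : ℝ} (hα : 0 ≤ α) (h2 : 0 < β₂)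
    (h4 : 4 * α ^ 2 = 1 - b) (hf : freq k b = 2 * α ^ 2 - β₁ ^ 2 - β₂ ^ 2)
    (hc' : c = 2 * α * (β₂ ^ 2 - β₁ ^ 2)) : bandArc k b c (-1) 0 = ⟨-α, β₂⟩ := by
  rw [bandArc_zero hb1 (by norm_num) hα h4 hf hc', neg_one_mul,
    show (β₁ ^ 2 + β₂ ^ 2) / 2 - -1 * (β₂ ^ 2 - β₁ ^ 2) / 2 = β₂ ^ 2 by ring, Real.sqrt_sq h2.le]

/-- For `b = 1` the spectrum in the upper half plane is a vertical segment. -/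
theorem isBand_upper_of_eq_one (hk0 : 0 < k) (hk1 : k < 1) {β₁ β₂ : ℝ} (h1 : 0 < β₁)
    (h12 : β₁ < β₂) (hf : freq k 1 = - β₁ ^ 2 - β₂ ^ 2) (ho : omegaConst k 1 = β₁ ^ 2 * β₂ ^ 2) :
    ∃ S, IsBand S (⟨0, β₁⟩ : ℂ) ⟨0, β₂⟩ ∧ (∀ z ∈ S, 0 < z.im) ∧
      ∀ z : ℂ, 0 < z.im → (z ∈ laxSpectrum (ellipticSol k 1 0) (freq k 1) ↔ z ∈ S) := by
  have hkb : k ^ 2 ≤ 1 := by nlinarith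
  have hc : (0 : ℝ) ^ 2 = 1 * (1 - 1) * (1 - k ^ 2) := by ring
  set f : ℝ → ℂ := fun t => ⟨0, t⟩ with hf'
  have hfc : Continuous f := by
    have : f = fun t : ℝ => (t : ℂ) * Complex.I := by
      funext t; rw [hf']; simp [Complex.mk_eq_add_mul_I]
    rw [this]; fun_prop
  have hP : ∀ t : ℝ, -omegaSq k 1 0 (⟨0, t⟩ : ℂ) = ((β₁ ^ 2 - t ^ 2) * (β₂ ^ 2 - t ^ 2) : ℝ) := by
    intro t
    rw [neg_omegaSq_eq (α := 0) (β₁ := β₁) (β₂ := β₂) (by rw [hf]; ring) (by ring)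
      (by rw [ho]; ring), show (⟨0, t⟩ : ℂ) = t * Complex.I by simp [Complex.mk_eq_add_mul_I]]
    push_cast
    linear_combination ((t : ℂ) ^ 2 - β₁ ^ 2) * ((t : ℂ) ^ 2 - β₂ ^ 2) * Complex.I_pow_four
  refine ⟨f '' Icc β₁ β₂, isBand_image_Icc h12 hfc.continuousOn
    fun s _ t _ h => congrArg Complex.im h, ?_, fun z hz => ⟨fun h => ?_, ?_⟩⟩
  · rintro _ ⟨t, ht, rfl⟩
    exact h1.trans_le ht.1
  · obtain ⟨Y, hY, hG, h0⟩ := exists_sepQ_nonneg hk0 hk1 hkb le_rfl hc hz h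
    have h4 := four_mul_re_sq hk0 hk1 hkb hc hz hY hG
    -- For `b = 1`, `F = √τ = 0` at `q = 0`, and `C < 0` then gives `F > √τ` for every `q > 0`,
    -- which excludes spectrum there.
    have hq : sepQ k 1 z Y = 0 := by
      by_contra hne
      have h5 := sqrt_lt_bandIntegral_of_le hk0 hk1 hkb le_rfl hc (quasiConst_one_neg hk0 hk1)
        le_rfl (h0.lt_of_ne' hne) (by simp [bandTau, bandIntegral_zero])
      have h6 := (bandIntegral_le_sqrt_iff hk0 hk1 hkb le_rfl h0).1 (by linarith [sq_nonneg z.re])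
      exact h5.not_ge h6
    rw [hq, bandIntegral_zero] at hG h4
    have hx : z.re = 0 := by
      rw [bandTau] at h4
      exact pow_eq_zero_iff two_ne_zero |>.1 (by linarith : z.re ^ 2 = 0)
    have hYr : Y.re = 0 := by rw [re_eq_sepG_mul hz.ne', hG, zero_mul]
    have hz' : z = ⟨0, z.im⟩ := Complex.ext hx rfl
    -- `Y` is imaginary, so `P(i y) = (β₁² - y²)(β₂² - y²)` is nonpositive, which places `y` between
    -- `β₁` and `β₂`.
    have h7 := congrArg Complex.re hY
    rw [hz', hP, Complex.ofReal_re, sq, Complex.mul_re, hYr] at h7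
    have h8 : (β₁ ^ 2 - z.im ^ 2) * (β₂ ^ 2 - z.im ^ 2) ≤ 0 := by nlinarith [sq_nonneg Y.im]
    refine ⟨z.im, ⟨?_, ?_⟩, hz'.symm⟩
    · by_contra hlt
      have hlt := not_le.1 hlt
      nlinarith [mul_pos (by nlinarith : 0 < β₁ ^ 2 - z.im ^ 2)
        (by nlinarith : 0 < β₂ ^ 2 - z.im ^ 2)]
    · by_contra hlt
      have hlt := not_le.1 hlt
      nlinarith [mul_pos (by nlinarith : 0 < z.im ^ 2 - β₁ ^ 2)
        (by nlinarith : 0 < z.im ^ 2 - β₂ ^ 2)]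
  · rintro ⟨t, ht, rfl⟩
    have hr : 0 ≤ (t ^ 2 - β₁ ^ 2) * (β₂ ^ 2 - t ^ 2) :=
      mul_nonneg (by nlinarith [ht.1]) (by nlinarith [ht.1, ht.2])
    refine (mem_laxSpectrum_iff_sepG hk0 hk1 hkb le_rfl hc hz).2
      ⟨(√((t ^ 2 - β₁ ^ 2) * (β₂ ^ 2 - t ^ 2)) : ℝ) * Complex.I, ?_, ?_⟩
    · rw [hf', hP, mul_pow, Complex.I_sq, ← Complex.ofReal_pow, Real.sq_sqrt hr]
      push_cast; ring
    · simp [sepG, sepQ, sepV, bandIntegral_zero, hf']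

/-- For `C < 0`, `b < 1` the spectrum in the upper half plane is a band. -/
theorem isBand_upper_of_neg (hk0 : 0 < k) (hk1 : k < 1) (hkb : k ^ 2 ≤ b) (hb1 : b < 1)
    (hc : c ^ 2 = b * (1 - b) * (b - k ^ 2)) (hC : quasiConst k b < 0) :
    ∃ S, IsBand S (bandArc k b c 1 0) (bandArc k b c (-1) 0) ∧ (∀ z ∈ S, 0 < z.im) ∧
      ∀ z : ℂ, 0 < z.im → (z ∈ laxSpectrum (ellipticSol k b c) (freq k b) ↔ z ∈ S) := by
  obtain ⟨q₀, hq0, hq₀, hle⟩ := exists_bandIntegral_eq_sqrt hk0 hk1 hkb hb1 hc hC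
  have hF : ∀ t ∈ Icc 0 q₀, 0 ≤ q₀ - t ∧ bandIntegral k b (q₀ - t) ^ 2 ≤ bandTau b (q₀ - t) := by
    intro t ht
    have h0 : 0 ≤ q₀ - t := sub_nonneg.2 ht.2
    exact ⟨h0, (bandIntegral_le_sqrt_iff hk0 hk1 hkb hb1.le h0).2
      ((hle _ h0).2 (by linarith [ht.1]))⟩
  have heq : ∀ ε ε' : ℝ, ε ^ 2 = 1 → ε' ^ 2 = 1 → ∀ s ∈ Icc 0 q₀, ∀ t ∈ Icc 0 q₀,
      bandArc k b c ε (q₀ - s) = bandArc k b c ε' (q₀ - t) → s = t := by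
    intro ε ε' hε hε' s hs t ht h
    have := bandArc_eq_imp hk0 hk1 hkb hb1 hc hε hε' (hF s hs).1 (hF t ht).1 (hF s hs).2
      (hF t ht).2 h
    linarith
  have hcont : ∀ ε, ContinuousOn (fun t => bandArc k b c ε (q₀ - t)) (Icc 0 q₀) := fun ε =>
    ((continuous_bandArc hk0 hk1 hb1 c ε).comp (continuous_const.sub continuous_id)).continuousOn
  have h1 : (1 : ℝ) ^ 2 = 1 := one_pow 2
  have h2 : (-1 : ℝ) ^ 2 = 1 := by norm_num
  -- Reversing the parameter to `q₀ - q` makes both arcs start at their common point on the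
  -- imaginary axis and end at the roots.
  have hband := isBand_union hq0 (hcont 1) (hcont (-1))
    (fun s hs t ht h => heq 1 1 h1 h1 s hs t ht h)
    (fun s hs t ht h => heq (-1) (-1) h2 h2 s hs t ht h) ?_ ?_
  · simp only [sub_self] at hband
    refine ⟨_, hband, ?_, fun z hz => ?_⟩
    · rintro _ (⟨t, ht, rfl⟩ | ⟨t, ht, rfl⟩)
      · exact bandArc_im_pos hk0 hk1 hkb hb1 hc h1 (hF t ht).1 (hF t ht).2
      · exact bandArc_im_pos hk0 hk1 hkb hb1 hc h2 (hF t ht).1 (hF t ht).2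
    · rw [mem_laxSpectrum_iff_bandArc hk0 hk1 hkb hb1 hc hz]
      constructor
      · rintro ⟨q, hq, hFq, h⟩
        have hqq := (hle q hq).1 ((bandIntegral_le_sqrt_iff hk0 hk1 hkb hb1.le hq).1 hFq)
        have hm : q₀ - q ∈ Icc 0 q₀ := ⟨by linarith, by linarith⟩
        rcases h with rfl | rfl
        · exact Or.inl ⟨q₀ - q, hm, by simp⟩
        · exact Or.inr ⟨q₀ - q, hm, by simp⟩
      · rintro (⟨t, ht, rfl⟩ | ⟨t, ht, rfl⟩)
        · exact ⟨q₀ - t, (hF t ht).1, (hF t ht).2, Or.inl rfl⟩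
        · exact ⟨q₀ - t, (hF t ht).1, (hF t ht).2, Or.inr rfl⟩
  · have h0 : bandAbs k b q₀ = 0 := by
      rw [bandAbs, hq₀, Real.sq_sqrt (bandTau_nonneg hb1.le q₀), sub_self, Real.sqrt_zero,
        zero_div]
    simp only [sub_zero, bandArc, h0, mul_zero]
  · intro s hs t ht h
    have hst := heq 1 (-1) h1 h2 s hs t ht h
    subst hst
    have hre := congrArg Complex.re h
    simp only [bandArc_re] at hre
    have h0 : bandAbs k b (q₀ - s) = 0 := by linarith
    rw [bandAbs, div_eq_zero_iff, or_iff_left two_ne_zero,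
      Real.sqrt_eq_zero (sub_nonneg.2 (hF s hs).2), sub_eq_zero] at h0
    -- A second common point would have real part `0`, hence `F = √τ` at some `q < q₀`, and then `F
    -- > √τ` at `q₀`.
    by_contra hne
    have hs0 : 0 < s := hs.1.lt_of_ne' hne
    have hFs := bandIntegral_nonneg hk0 hk1 hkb hb1.le (hF s hs).1
    have := sqrt_lt_bandIntegral_of_le hk0 hk1 hkb hb1.le hc hC (hF s hs).1
      (by linarith : q₀ - s < q₀) (by rw [h0, Real.sqrt_sq hFs])
    exact this.ne' hq₀

/-- For `C ≥ 0`, each of the two parts of the spectrum in the upper half plane ends at the real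
axis. -/
theorem isBand_union_conj (hk0 : 0 < k) (hk1 : k < 1) (hkb : k ^ 2 ≤ b) (hb1 : b < 1)
    (hc : c ^ 2 = b * (1 - b) * (b - k ^ 2)) (hC : 0 ≤ quasiConst k b) {ε : ℝ} (hε : ε ^ 2 = 1) :
    let S := insert ((ε * √(quasiConst k b) : ℝ) : ℂ) (bandArc k b c ε '' Ici 0)
    IsBand (S ∪ conj '' S) (bandArc k b c ε 0) (conj (bandArc k b c ε 0)) := by
  intro S
  have hF : ∀ q, 0 ≤ q → bandIntegral k b q ^ 2 ≤ bandTau b q := fun q hq =>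
    (bandIntegral_le_sqrt_iff hk0 hk1 hkb hb1.le hq).2
      (bandIntegral_lt_sqrt hk0 hk1 hkb hb1.le hc hC hq).le
  set X : ℂ := ((ε * √(quasiConst k b) : ℝ) : ℂ) with hX
  -- The substitution `q = 1/t - 1` compactifies `[0, ∞]` to `[0, 1]`; the value at `t = 0` is the
  -- limit point `±√C` on the real axis.
  set f : ℝ → ℂ := Function.update (fun t => bandArc k b c ε (t⁻¹ - 1)) 0 X with hf
  have hf0 : f 0 = X := Function.update_self _ _ _
  have hft : ∀ t, 0 < t → f t = bandArc k b c ε (t⁻¹ - 1) := fun t ht =>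
    Function.update_of_ne ht.ne' _ _
  have hq : ∀ t ∈ Icc (0 : ℝ) 1, 0 < t → 0 ≤ t⁻¹ - 1 := fun t ht h0 =>
    sub_nonneg.2 (one_le_inv_iff₀.2 ⟨h0, ht.2⟩)
  have him : ∀ t ∈ Icc (0 : ℝ) 1, 0 < t → 0 < (f t).im := fun t ht h0 => by
    rw [hft t h0]
    exact bandArc_im_pos hk0 hk1 hkb hb1 hc hε (hq t ht h0) (hF _ (hq t ht h0))
  have hX0 : X.im = 0 := Complex.ofReal_im _
  have him0 : ∀ t ∈ Icc (0 : ℝ) 1, 0 ≤ (f t).im := fun t ht => by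
    rcases ht.1.eq_or_lt with rfl | h0
    · rw [hf0, hX0]
    · exact (him t ht h0).le
  have hzero : ∀ t ∈ Icc (0 : ℝ) 1, (f t).im = 0 → t = 0 := fun t ht h => by
    by_contra hne
    exact (him t ht (ht.1.lt_of_ne' hne)).ne' h
  have hcont : ContinuousOn f (Icc 0 1) := by
    intro t ht
    rcases ht.1.eq_or_lt with rfl | h0
    · refine continuousWithinAt_update_same.2 ?_
      have h1 : Tendsto (fun t : ℝ => t⁻¹ - 1) (𝓝[>] 0) atTop :=
        tendsto_atTop_add_const_right _ (-1) tendsto_inv_nhdsGT_zero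
      refine ((tendsto_bandArc hk0 hk1 hkb hb1 hc hC hε).comp h1).mono_left
        (nhdsWithin_mono _ ?_)
      rintro t ⟨ht, hne⟩
      exact ht.1.lt_of_ne' hne
    · have h1 : ContinuousAt (fun t => bandArc k b c ε (t⁻¹ - 1)) t :=
        (continuous_bandArc hk0 hk1 hb1 c ε).continuousAt.comp
          ((continuousAt_inv₀ h0.ne').sub continuousAt_const)
      exact (h1.congr ((lt_mem_nhds h0).mono fun s hs => (hft s hs).symm)).continuousWithinAt
  have hinj : InjOn f (Icc 0 1) := by
    intro s hs t ht hst
    rcases hs.1.eq_or_lt with rfl | h0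
    · exact (hzero t ht (by rw [← hst, hf0, hX0])).symm
    · rcases ht.1.eq_or_lt with rfl | h0'
      · exact hzero s hs (by rw [hst, hf0, hX0])
      · rw [hft s h0, hft t h0'] at hst
        have := bandArc_eq_imp hk0 hk1 hkb hb1 hc hε hε (hq s hs h0) (hq t ht h0')
          (hF _ (hq s hs h0)) (hF _ (hq t ht h0')) hst
        exact inv_injective (by linarith)
  have himg : f '' Icc 0 1 = S := by
    ext z
    constructor
    · rintro ⟨t, ht, rfl⟩
      rcases ht.1.eq_or_lt with rfl | h0
      · exact Or.inl hf0
      · exact Or.inr ⟨t⁻¹ - 1, hq t ht h0, (hft t h0).symm⟩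
    · rintro (rfl | ⟨q, hq, rfl⟩)
      · exact ⟨0, left_mem_Icc.2 zero_le_one, hf0⟩
      · have hq' : 0 < q + 1 := by linarith [mem_Ici.1 hq]
        refine ⟨(q + 1)⁻¹, ⟨by positivity, inv_le_one_of_one_le₀ (by linarith [mem_Ici.1 hq])⟩, ?_⟩
        rw [hft _ (by positivity), inv_inv, add_sub_cancel_right]
  have hb := isBand_union zero_lt_one hcont
    (Complex.continuous_conj.comp_continuousOn hcont) hinj
    (fun s hs t ht h => hinj hs ht ((starRingEnd ℂ).injective h))
    (by rw [Function.comp_apply, hf0, Complex.conj_ofReal]) fun s hs t ht h => by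
      have h1 := congrArg Complex.im h
      rw [Function.comp_apply, Complex.conj_im] at h1
      exact hzero s hs (by linarith [him0 s hs, him0 t ht])
  rw [image_comp, himg, Function.comp_apply, hft 1 one_pos, inv_one, sub_self] at hb
  exact hb

end Cases

/-- The bands lie strictly in opposite half planes, so they meet neither each other nor the real
line. -/
theorem exists_bands_of_upper {k b c α β₁ β₂ : ℝ} (hk0 : 0 < k) (hk1 : k < 1) (hkb : k ^ 2 ≤ b)
    (hb1 : b ≤ 1) (hc : c ^ 2 = b * (1 - b) * (b - k ^ 2)) (h1 : 0 < β₁) (h2 : 0 < β₂)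
    (hroots : omegaRoots k b c = {(⟨α, β₁⟩ : ℂ), conj (⟨α, β₁⟩ : ℂ), ⟨-α, β₂⟩, conj (⟨-α, β₂⟩ : ℂ)})
    (h : ∃ S, IsBand S (⟨α, β₁⟩ : ℂ) ⟨-α, β₂⟩ ∧ (∀ z ∈ S, 0 < z.im) ∧
      ∀ z : ℂ, 0 < z.im → (z ∈ laxSpectrum (ellipticSol k b c) (freq k b) ↔ z ∈ S)) :
    ∃ (p₁ q₁ p₂ q₂ : ℂ) (S₁ S₂ : Set ℂ),
      IsBand S₁ p₁ q₁ ∧ IsBand S₂ p₂ q₂ ∧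
      p₁ ≠ p₂ ∧ p₁ ≠ q₂ ∧ q₁ ≠ p₂ ∧ q₁ ≠ q₂ ∧
      omegaRoots k b c = {p₁, q₁, p₂, q₂} ∧
      laxSpectrum (ellipticSol k b c) (freq k b) = realLine ∪ S₁ ∪ S₂ ∧
      (S₁ ∩ realLine).Subsingleton ∧ (S₂ ∩ realLine).Subsingleton ∧
      (S₁ ∩ S₂).Subsingleton := by
  obtain ⟨S, hS, him, hmem⟩ := h
  have him' : ∀ z ∈ conj '' S, z.im < 0 := by
    rintro _ ⟨z, hz, rfl⟩
    rw [Complex.conj_im]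
    exact neg_lt_zero.2 (him z hz)
  have hne : ∀ z w : ℂ, 0 < z.im → 0 < w.im → z ≠ conj w := fun z w hz hw h => by
    rw [h, Complex.conj_im] at hz
    linarith
  refine ⟨_, _, _, _, S, conj '' S, hS, hS.conj, hne _ _ h1 h1, hne _ _ h1 h2, hne _ _ h2 h1,
    hne _ _ h2 h2, ?_, ?_, ?_, ?_, ?_⟩
  · rw [hroots, insert_comm (conj (⟨α, β₁⟩ : ℂ))]
  · rw [laxSpectrum_eq hk0 hk1 hkb hb1 hc hmem fun z hz => (him z hz).le, union_assoc]
  · rintro z ⟨hz, hr⟩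
    exact absurd (mem_realLine.1 hr) (him z hz).ne'
  · rintro z ⟨hz, hr⟩
    exact absurd (mem_realLine.1 hr) (him' z hz).ne
  · rintro z ⟨hz, hz'⟩
    exact absurd (him z hz) (him' z hz').not_gt

/-- Strictness of `F < √τ` keeps the nonreal points of the two bands in opposite open half planes
`Re ζ ≷ 0`. Only the endpoints `±√C` are real, and the bands can touch only when these coincide,
that is when `C = 0`. -/
theorem exists_bands_of_nonneg {k b c α β₁ β₂ : ℝ} (hk0 : 0 < k) (hk1 : k < 1) (hkb : k ^ 2 ≤ b)
    (hb1 : b < 1) (hc : c ^ 2 = b * (1 - b) * (b - k ^ 2)) (hC : 0 ≤ quasiConst k b) (hα : 0 < α)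
    (hroots : omegaRoots k b c = {(⟨α, β₁⟩ : ℂ), conj (⟨α, β₁⟩ : ℂ), ⟨-α, β₂⟩, conj (⟨-α, β₂⟩ : ℂ)})
    (ha₁ : bandArc k b c 1 0 = ⟨α, β₁⟩) (ha₂ : bandArc k b c (-1) 0 = ⟨-α, β₂⟩) :
    ∃ (p₁ q₁ p₂ q₂ : ℂ) (S₁ S₂ : Set ℂ),
      IsBand S₁ p₁ q₁ ∧ IsBand S₂ p₂ q₂ ∧
      p₁ ≠ p₂ ∧ p₁ ≠ q₂ ∧ q₁ ≠ p₂ ∧ q₁ ≠ q₂ ∧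
      omegaRoots k b c = {p₁, q₁, p₂, q₂} ∧
      laxSpectrum (ellipticSol k b c) (freq k b) = realLine ∪ S₁ ∪ S₂ ∧
      (S₁ ∩ realLine).Subsingleton ∧ (S₂ ∩ realLine).Subsingleton ∧
      (S₁ ∩ S₂).Subsingleton := by
  have hlt : ∀ q, 0 ≤ q → bandIntegral k b q < √(bandTau b q) := fun q hq =>
    bandIntegral_lt_sqrt hk0 hk1 hkb hb1.le hc hC hq
  have hF : ∀ q, 0 ≤ q → bandIntegral k b q ^ 2 ≤ bandTau b q := fun q hq =>
    (bandIntegral_le_sqrt_iff hk0 hk1 hkb hb1.le hq).2 (hlt q hq).le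
  have habs : ∀ q, 0 ≤ q → 0 < bandAbs k b q := fun q hq =>
    half_pos (Real.sqrt_pos.2 (sub_pos.2
      ((Real.lt_sqrt (bandIntegral_nonneg hk0 hk1 hkb hb1.le hq)).1 (hlt q hq))))
  have h1 : (1 : ℝ) ^ 2 = 1 := one_pow 2
  have h2 : (-1 : ℝ) ^ 2 = 1 := by norm_num
  set U : ℝ → Set ℂ := fun ε =>
    insert ((ε * √(quasiConst k b) : ℝ) : ℂ) (bandArc k b c ε '' Ici 0) with hU
  have him : ∀ ε : ℝ, ε ^ 2 = 1 → ∀ z ∈ U ε,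
      z = ((ε * √(quasiConst k b) : ℝ) : ℂ) ∨ 0 < z.im ∧ 0 < ε * z.re := by
    rintro ε hε z (hz | ⟨q, hq, rfl⟩)
    · exact Or.inl hz
    · refine Or.inr ⟨bandArc_im_pos hk0 hk1 hkb hb1 hc hε hq (hF q hq), ?_⟩
      rw [bandArc_re, ← mul_assoc, ← sq, hε, one_mul]
      exact habs q hq
  have him' : ∀ ε : ℝ, ε ^ 2 = 1 → ∀ z ∈ U ε ∪ conj '' U ε,
      z = ((ε * √(quasiConst k b) : ℝ) : ℂ) ∨ z.im ≠ 0 ∧ 0 < ε * z.re := by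
    rintro ε hε z (hz | ⟨w, hw, rfl⟩)
    · exact (him ε hε z hz).imp_right fun h => ⟨h.1.ne', h.2⟩
    · rcases him ε hε w hw with rfl | h
      · exact Or.inl (Complex.conj_ofReal _)
      · exact Or.inr ⟨by rw [Complex.conj_im]; exact neg_ne_zero.2 h.1.ne',
          by rw [Complex.conj_re]; exact h.2⟩
  have hreal : ∀ ε : ℝ, ε ^ 2 = 1 → ((U ε ∪ conj '' U ε) ∩ realLine).Subsingleton := by
    rintro ε hε z ⟨hz, hzr⟩ w ⟨hw, hwr⟩
    have hz' := (him' ε hε z hz).resolve_right fun h => h.1 (mem_realLine.1 hzr)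
    have hw' := (him' ε hε w hw).resolve_right fun h => h.1 (mem_realLine.1 hwr)
    rw [hz', hw']
  have hb₁ := isBand_union_conj hk0 hk1 hkb hb1 hc hC h1
  have hb₂ := isBand_union_conj hk0 hk1 hkb hb1 hc hC h2
  rw [ha₁] at hb₁
  rw [ha₂] at hb₂
  have hre : ∀ z w : ℂ, z.re = α → w.re = -α → z ≠ w := fun z w hz hw h => by
    rw [h, hw] at hz
    linarith
  refine ⟨_, _, _, _, U 1 ∪ conj '' U 1, U (-1) ∪ conj '' U (-1), hb₁, hb₂, hre _ _ rfl rfl,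
    hre _ _ rfl rfl, hre _ _ rfl rfl, hre _ _ rfl rfl, hroots, ?_, hreal 1 h1, hreal (-1) h2, ?_⟩
  · rw [laxSpectrum_eq hk0 hk1 hkb hb1.le hc (S := U 1 ∪ U (-1)) ?_ ?_, image_union,
      union_union_union_comm, union_assoc, union_assoc, union_assoc]
    · intro z hz
      rw [mem_laxSpectrum_iff_bandArc hk0 hk1 hkb hb1 hc hz]
      constructor
      · rintro ⟨q, hq, -, h | h⟩
        · exact Or.inl (Or.inr ⟨q, hq, h.symm⟩)
        · exact Or.inr (Or.inr ⟨q, hq, h.symm⟩)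
      · rintro ((rfl | ⟨q, hq, rfl⟩) | (rfl | ⟨q, hq, rfl⟩))
        · exact absurd hz (by simp)
        · exact ⟨q, hq, hF q hq, Or.inl rfl⟩
        · exact absurd hz (by simp)
        · exact ⟨q, hq, hF q hq, Or.inr rfl⟩
    · have h0 : ∀ ε : ℝ, ε ^ 2 = 1 → ∀ z ∈ U ε, 0 ≤ z.im := fun ε hε z hz => by
        rcases him ε hε z hz with rfl | h
        · rw [Complex.ofReal_im]
        · exact h.1.le
      rintro z (hz | hz)
      exacts [h0 1 h1 z hz, h0 (-1) h2 z hz]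
  · have hs := Real.sqrt_nonneg (quasiConst k b)
    have hsub : ∀ z ∈ (U 1 ∪ conj '' U 1) ∩ (U (-1) ∪ conj '' U (-1)),
        z = ((1 * √(quasiConst k b) : ℝ) : ℂ) := by
      rintro z ⟨hz, hw⟩
      refine (him' 1 h1 z hz).resolve_right fun h => ?_
      rcases him' (-1) h2 z hw with h' | h'
      · apply h.1
        rw [h', Complex.ofReal_im]
      · linarith [h.2, h'.2]
    intro z hz w hw
    rw [hsub z hz, hsub w hw]

theorem mainTheorem8 (k b c : ℝ) (hk0 : 0 < k) (hk1 : k < 1) (hkb : k ^ 2 ≤ b) (hb1 : b ≤ 1)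
    (hc : c ^ 2 = b * (1 - b) * (b - k ^ 2)) :
    ∃ (p₁ q₁ p₂ q₂ : ℂ) (S₁ S₂ : Set ℂ),
      IsBand S₁ p₁ q₁ ∧ IsBand S₂ p₂ q₂ ∧
      p₁ ≠ p₂ ∧ p₁ ≠ q₂ ∧ q₁ ≠ p₂ ∧ q₁ ≠ q₂ ∧
      omegaRoots k b c = {p₁, q₁, p₂, q₂} ∧
      laxSpectrum (ellipticSol k b c) (freq k b) = realLine ∪ S₁ ∪ S₂ ∧
      (S₁ ∩ realLine).Subsingleton ∧ (S₂ ∩ realLine).Subsingleton ∧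
      (S₁ ∩ S₂).Subsingleton := by
  obtain ⟨α, β₁, β₂, hα, h1, h2, h12, h4, hf, hc', ho⟩ := exists_root_parameters hk0 hk1 hkb hb1 hc
  have hroots := omegaRoots_eq hf hc' ho
  rcases hb1.eq_or_lt with rfl | hb1'
  · have hα0 : α = 0 := pow_eq_zero_iff two_ne_zero |>.1 (by linarith : α ^ 2 = 0)
    subst hα0
    obtain rfl : c = 0 := by rw [hc']; ring
    refine exists_bands_of_upper hk0 hk1 hkb hb1 hc h1 h2 hroots ?_
    rw [neg_zero]
    exact isBand_upper_of_eq_one hk0 hk1 h1 (h12 rfl) (by rw [hf]; ring) (by rw [ho]; ring)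
  · have ha₁ := bandArc_one_zero hb1' hα h1 h4 hf hc'
    have ha₂ := bandArc_neg_one_zero hb1' hα h2 h4 hf hc'
    have hα0 : 0 < α := hα.lt_of_ne' fun h => by rw [h] at h4; linarith
    rcases le_or_gt 0 (quasiConst k b) with hC | hC
    · exact exists_bands_of_nonneg hk0 hk1 hkb hb1' hc hC hα0 hroots ha₁ ha₂
    · refine exists_bands_of_upper hk0 hk1 hkb hb1 hc h1 h2 hroots ?_
      rw [← ha₁, ← ha₂]
      exact isBand_upper_of_neg hk0 hk1 hkb hb1' hc hC
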